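/- Let $\varphi:[0,\infty)\to[0,\infty)$ be increasing (i.e. nondecreasing) and left continuous with $\lim_{t\downarrow 0}\varphi(t)=0$ and $\varphi\neq 0$. Let $\|\cdot\|$ be the Euclidean norm on $\mathbb{R}^2$, $d(x,C)=\inf_{y\in C}\|x-y\|$, and let $X$ be uniformly distributed on the unit square $[0,1)^2$. For $\eta>0$ and real $N\ge 1$ put $$f_N(\eta)=\inf_{C}\ \mathbb{E}\,\varphi\bigl((N/\eta)^{1/2}\,d(X,C)\bigr),$$ the infimum being over all nonempty finite sets $C\subset\mathbb{R}^2$ with at most $\lfloor N\rfloor$ points, and let $g(\eta)=\inf_{N\ge 1} f_N(\eta)$. Let $V\subset\mathbb{R}^2$ be a regular hexagon centered at the origin, of unit area and in arbitrary orientation, let $U$ be uniformly distributed on $V$, and let $\Lambda$ be the hexagonal lattice with $V+\Lambda$ tiling the plane, generated by the vectors from the center of $V$ to the centers of the adjacent hexagons. Then for every $\eta>0$: 1. $g(\eta)=\mathbb{E}\,\varphi\bigl(\eta^{-1/2}\|U\|\bigr)$. 2. $\lim_{N\to\infty} f_N(\eta)=g(\eta)$. 3. The hexagonal lattice is asymptotically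 optimal: for $s>0$ let $C_s$ be the set of the points $p\in s\Lambda$ such that $p+sV$ meets $[0,1)^2$. Then $C_s$ is finite and nonempty, and $$\lim_{s\downarrow 0}\ \mathbb{E}\,\varphi\bigl((|C_s|/\eta)^{1/2}\,d(X,C_s)\bigr)=g(\eta).$$ -/

import Mathlib

open scoped NNReal ENNReal Topology

noncomputable section

namespace HexQuant

/-- The Euclidean plane. -/
abbrev Plane : Type := EuclideanSpace ℝ (Fin 2)

/-- The functions `φ : [0,∞) → [0,∞)` that define the distortion: increasing (in the weak sense),
left continuous, with limit `0` at `0+`, and not identically zero. -/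
structure IsOrliczFunction (φ : ℝ≥0 → ℝ≥0) : Prop where
  monotone : Monotone φ
  left_continuous : ∀ t : ℝ≥0, ContinuousWithinAt φ (Set.Iic t) t
  tendsto_zero : Filter.Tendsto φ (𝓝[>] 0) (𝓝 0)
  ne_zero : φ ≠ 0

/-- The half-open unit square `[0,1)²`, which has unit area. -/
def unitSquare : Set Plane := {x | ∀ i, x i ∈ Set.Ico (0 : ℝ) 1}

/-- `E φ((N/η)^{1/2} d(X, C))` for `X` uniformly distributed on the unit square.
It is used for nonempty `C` only. -/
def distortion (φ : ℝ≥0 → ℝ≥0) (N η : ℝ≥0) (C : Set Plane) : ℝ≥0∞ :=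
  ∫⁻ x in unitSquare, (φ ((N / η) ^ (1 / 2 : ℝ) * Metric.infNndist x C) : ℝ≥0∞)

/-- `f_N(η)`: the infimum of the distortion over the codebooks with at least one and at most `⌊N⌋`
points (for `N < 1` there is none, and the value is `∞`). -/
def optimalDistortion (φ : ℝ≥0 → ℝ≥0) (N η : ℝ≥0) : ℝ≥0∞ :=
  ⨅ (C : Finset Plane) (_ : C.Nonempty) (_ : C.card ≤ ⌊N⌋₊), distortion φ N η (C : Set Plane)

/-- `g(η) = inf_{N ≥ 1} f_N(η)`, the infimum being over real `N ≥ 1`. -/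
def g (φ : ℝ≥0 → ℝ≥0) (η : ℝ≥0) : ℝ≥0∞ :=
  ⨅ (N : ℝ≥0) (_ : 1 ≤ N), optimalDistortion φ N η

/-- The point with polar coordinates `(R, θ + k π / 3)`. -/
def hexVertex (R θ : ℝ) (k : ℕ) : Plane :=
  !₂[R * Real.cos (θ + k * (Real.pi / 3)), R * Real.sin (θ + k * (Real.pi / 3))]

/-- The closed regular hexagon with center `0`, circumradius `R` and a vertex in direction `θ`. -/
def hexagon (R θ : ℝ) : Set Plane :=
  convexHull ℝ (Set.range fun k : Fin 6 => hexVertex R θ k)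

/-- The lattice whose translates of `hexagon R θ` tile the plane: the vectors from the center of the
hexagon to the centers of the adjacent hexagons are the sums of two consecutive vertices. -/
def hexLattice (R θ : ℝ) : Submodule ℤ Plane :=
  Submodule.span ℤ {hexVertex R θ 0 + hexVertex R θ 1, hexVertex R θ 1 + hexVertex R θ 2}

/-- The points `p` of the scaled lattice `s Λ` whose hexagonal cell `p + s V` meets the
unit square. -/
def latticeCodebook (R θ s : ℝ) : Set Plane :=
  {p | ∃ l ∈ hexLattice R θ, p = s • l ∧ ∃ v ∈ hexagon R θ, p + s • v ∈ unitSquare}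

end HexQuant

end

namespace HexQuant
open MeasureTheory Set Pointwise

/-! The lower bound is a theorem of Fejes Tóth on discs (`volume_covered_le`): `n` discs of radius
`r` cover no more of a square of area `n` than `n` times the area of `V ∩ B(0, r)`, where `V` is the
hexagon. Applied for every `r`, it says that the rescaled distance from `X` to a codebook
stochastically dominates the rescaled norm of `U`. The superlevel sets of `φ` at positive levels are
empty or open half-lines, so the layer-cake formula carries this over to `φ`
(`lintegral_le_of_superlevel`). For the upper bound, the lattice of mesh `s` uses at most `(1 +
4Rs)² / s²` cells that meet the square, each contributes at most the integral over a scaled hexagon,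
and `s` tends to `0`.

For the disc theorem only radii between the inradius and the circumradius `R` matter. With a
multiplier `lam`, the quantity area(cell ∩ disc) - `lam` area(cell) is, in polar coordinates, the
integral of a function of the distance to the boundary. A second multiplier `B` for the total angle
`2π` leaves the integrand `EdgeData.W`. An edge at distance `h` seen under the directions `J` then
contributes the integral of `W (h / cos x)` over `J`. The multipliers are tuned so that this is at
most `2A` for every `h` and every interval `J` (`EdgeData.setIntegral_W_le`), with equality for an
edge of the hexagon. A cell with `m` edges is thus bounded by `2Am + 2πB`, and the hexagon has
exactly `12A + 2πB`.

This bound is linear in `m` and `A ≥ 0`, so only the total number of edges counts. An Euler-type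
count bounds it by `6n` for the bounded Voronoi cells of `n` points (`sum_card_neighbor_le`).
Boundary effects disappear by laying out `M × M` copies of the configuration, keeping the cells
inside the large box, and letting `M → ∞` (`mul_covered_le`). -/

/-! ### The plane, unit vectors and area in polar coordinates -/

/-- The unit vector in direction `θ`. -/
noncomputable def dir (θ : ℝ) : Plane := !₂[Real.cos θ, Real.sin θ]

@[simp] lemma dir_zero (θ : ℝ) : dir θ 0 = Real.cos θ := rfl

@[simp] lemma dir_one (θ : ℝ) : dir θ 1 = Real.sin θ := rfl

lemma inner_eq (x y : Plane) : inner ℝ x y = x 0 * y 0 + x 1 * y 1 := by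
  simp [PiLp.inner_apply, Fin.sum_univ_two, mul_comm]

lemma norm_sq_eq (x : Plane) : ‖x‖ ^ 2 = x 0 ^ 2 + x 1 ^ 2 := by
  rw [EuclideanSpace.norm_sq_eq]; simp

lemma plane_ext {x y : Plane} (h0 : x 0 = y 0) (h1 : x 1 = y 1) : x = y := by
  ext i; fin_cases i <;> assumption

@[simp] lemma norm_dir (θ : ℝ) : ‖dir θ‖ = 1 := by
  have h : ‖dir θ‖ ^ 2 = 1 := by rw [norm_sq_eq]; simp
  have := norm_nonneg (dir θ)
  nlinarith

lemma inner_dir_dir (a b : ℝ) : inner ℝ (dir a) (dir b) = Real.cos (a - b) := by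
  rw [inner_eq, Real.cos_sub]; simp

/-- Polar coordinates of a point of the plane. -/
lemma exists_polar (x : Plane) : ∃ θ : ℝ, x = ‖x‖ • dir θ := by
  refine ⟨Complex.arg ⟨x 0, x 1⟩, ?_⟩
  have hn : ‖(⟨x 0, x 1⟩ : ℂ)‖ = ‖x‖ := by
    have h1 : ‖(⟨x 0, x 1⟩ : ℂ)‖ ^ 2 = ‖x‖ ^ 2 := by
      rw [Complex.sq_norm, Complex.normSq_mk, norm_sq_eq]; ring
    exact (pow_left_inj₀ (norm_nonneg _) (norm_nonneg _) two_ne_zero).1 h1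
  refine plane_ext ?_ ?_
  · have := Complex.norm_mul_cos_arg ⟨x 0, x 1⟩
    rw [hn] at this
    simpa using this.symm
  · have := Complex.norm_mul_sin_arg ⟨x 0, x 1⟩
    rw [hn] at this
    simpa using this.symm

/-- The identification of `ℝ × ℝ` with the plane. -/
noncomputable def ofProd : ℝ × ℝ ≃ᵐ Plane :=
  MeasurableEquiv.finTwoArrow.symm.trans (MeasurableEquiv.toLp 2 (Fin 2 → ℝ))

lemma ofProd_apply (p : ℝ × ℝ) : ofProd p = !₂[p.1, p.2] := by
  refine plane_ext ?_ ?_ <;> rfl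

lemma measurePreserving_ofProd : MeasurePreserving ofProd volume volume := by
  have h1 := (volume_preserving_finTwoArrow ℝ).symm
  have h2 := (EuclideanSpace.volume_preserving_symm_measurableEquiv_toLp (Fin 2)).symm
  exact h2.comp h1

/-- The area of a star-shaped set with radial function `ρ`. -/
lemma volume_eq_polar {S : Set Plane} (hS : MeasurableSet S) {ρ : ℝ → ℝ} (hρ : ∀ θ, 0 ≤ ρ θ)
    (h : ∀ θ t, 0 < t → (t • dir θ ∈ S ↔ t ≤ ρ θ)) :
    volume S = ∫⁻ θ in Ioo (-Real.pi) Real.pi, ENNReal.ofReal (ρ θ ^ 2 / 2) := by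
  rw [← measurePreserving_ofProd.measure_preimage hS.nullMeasurableSet]
  have hS' : MeasurableSet (ofProd ⁻¹' S) := ofProd.measurable hS
  rw [← lintegral_indicator_one hS', ← lintegral_comp_polarCoord_symm, polarCoord_target,
    Measure.volume_eq_prod, setLIntegral_prod_symm]
  · refine setLIntegral_congr_fun measurableSet_Ioo fun θ _ => ?_
    have key : ∀ t ∈ Ioi (0 : ℝ), ENNReal.ofReal t •
        (ofProd ⁻¹' S).indicator (1 : ℝ × ℝ → ℝ≥0∞) (polarCoord.symm (t, θ)) =
        (Iic (ρ θ)).indicator (fun t => ENNReal.ofReal t) t := by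
      intro t ht
      have he : ofProd (polarCoord.symm (t, θ)) = t • dir θ := by
        rw [ofProd_apply, polarCoord_symm_apply]
        exact plane_ext rfl rfl
      by_cases htρ : t ≤ ρ θ
      · rw [indicator_of_mem, indicator_of_mem (mem_Iic.2 htρ)]
        · simp
        · rw [mem_preimage, he]; exact (h θ t ht).2 htρ
      · rw [indicator_of_notMem, indicator_of_notMem (by simpa using htρ)]
        · simp
        · rw [mem_preimage, he]; exact fun hh => htρ ((h θ t ht).1 hh)
    rw [setLIntegral_congr_fun measurableSet_Ioi key, lintegral_indicator measurableSet_Iic,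
      Measure.restrict_restrict measurableSet_Iic, inter_comm, Ioi_inter_Iic,
      ← ofReal_integral_eq_lintegral_ofReal]
    · rw [← intervalIntegral.integral_of_le (hρ θ), integral_id]
      simp
    · exact (continuous_id.integrableOn_Icc).mono_set Ioc_subset_Icc_self
    · exact (ae_restrict_iff' measurableSet_Ioc).2 (ae_of_all _ fun t ht => ht.1.le)
  · refine Measurable.aemeasurable ?_
    refine (ENNReal.measurable_ofReal.comp measurable_fst).smul ?_
    refine (measurable_one.indicator hS').comp ?_
    have : Measurable fun p : ℝ × ℝ => (p.1 * Real.cos p.2, p.1 * Real.sin p.2) := by fun_prop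
    convert this using 2
    exact polarCoord_symm_apply _


/-! ### Circular segments and trigonometric integrals -/

/-- The area of the half circular segment of the disc of radius `a` beyond a chord at distance `h`
from the center, with the opposite sign; it vanishes for `h ≥ a`. -/
noncomputable def segArea (a h : ℝ) : ℝ :=
  h * √(a ^ 2 - h ^ 2) / 2 - a ^ 2 / 2 * Real.arccos (h / a)

lemma segArea_of_le {a h : ℝ} (ha : 0 < a) (hh : a ≤ h) : segArea a h = 0 := by
  have h1 : √(a ^ 2 - h ^ 2) = 0 := Real.sqrt_eq_zero_of_nonpos (by nlinarith)
  have h2 : Real.arccos (h / a) = 0 := Real.arccos_eq_zero.2 ((one_le_div ha).2 hh)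
  simp [segArea, h1, h2]

lemma continuous_segArea (a : ℝ) : Continuous (segArea a) := by
  unfold segArea
  have := Real.continuous_arccos
  fun_prop

/-- Moving the chord outwards removes a strip whose length is the half chord. For `h > a` both sides
vanish, since the square root of a negative number is `0`. The kink at `h = a` is left to
continuity. -/
lemma hasDerivAt_segArea {a h : ℝ} (ha : 0 < a) (hh : 0 < h) (hne : h ≠ a) :
    HasDerivAt (segArea a) (√(a ^ 2 - h ^ 2)) h := by
  rcases lt_or_gt_of_ne hne with hlt | hgt
  · have hpos : 0 < a ^ 2 - h ^ 2 := by nlinarith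
    have hs : √(a ^ 2 - h ^ 2) ≠ 0 := (Real.sqrt_pos.2 hpos).ne'
    have hd1 : HasDerivAt (fun x : ℝ => a ^ 2 - x ^ 2) (-(2 * h)) h := by
      simpa using ((hasDerivAt_id h).pow 2).const_sub (a ^ 2)
    have hd2 := ((hasDerivAt_id h).mul (hd1.sqrt hpos.ne')).div_const 2
    have hlt1 : h / a < 1 := (div_lt_one ha).2 hlt
    have hgt1 : 0 < h / a := div_pos hh ha
    have hd3 := ((Real.hasDerivAt_arccos (by linarith : h / a ≠ -1) hlt1.ne).comp h
      ((hasDerivAt_id h).div_const a)).const_mul (a ^ 2 / 2)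
    have hsq : √(1 - (h / a) ^ 2) = √(a ^ 2 - h ^ 2) / a := by
      rw [← Real.sqrt_sq ha.le, ← Real.sqrt_div' _ (sq_nonneg a), Real.sqrt_sq ha.le]
      congr 1; field_simp
    refine (hd2.sub hd3).congr_deriv ?_
    rw [hsq]
    have hss : √(a ^ 2 - h ^ 2) ^ 2 = a ^ 2 - h ^ 2 := Real.sq_sqrt hpos.le
    simp only [id]
    field_simp
    rw [hss]; ring
  · have h0 : √(a ^ 2 - h ^ 2) = 0 := Real.sqrt_eq_zero_of_nonpos (by nlinarith)
    rw [h0]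
    refine (hasDerivAt_const h (0 : ℝ)).congr_of_eventuallyEq ?_
    filter_upwards [lt_mem_nhds hgt] with x hx
    exact segArea_of_le ha hx.le

lemma sq_mul_tan_arccos {a h : ℝ} (ha : 0 < a) (hh : 0 < h) :
    h ^ 2 * Real.tan (Real.arccos (h / a)) = h * √(a ^ 2 - h ^ 2) := by
  have hsq : √(1 - (h / a) ^ 2) = √(a ^ 2 - h ^ 2) / a := by
    rw [← Real.sqrt_sq ha.le, ← Real.sqrt_div' _ (sq_nonneg a), Real.sqrt_sq ha.le]
    congr 1; field_simp
  rw [Real.tan_arccos, hsq]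
  field_simp

lemma cos_pos_of_abs {x : ℝ} (hx : x ∈ Ioo (-(Real.pi / 2)) (Real.pi / 2)) : 0 < Real.cos x :=
  Real.cos_pos_of_mem_Ioo hx

lemma integral_div_cos_sq_add (k m : ℝ) {a b : ℝ} (ha : 0 ≤ a) (hab : a ≤ b)
    (hb : b < Real.pi / 2) :
    ∫ x in a..b, (k * (1 / Real.cos x ^ 2) + m) =
      k * (Real.tan b - Real.tan a) + m * (b - a) := by
  have hsub : ∀ x ∈ uIcc a b, x ∈ Ioo (-(Real.pi / 2)) (Real.pi / 2) := by
    intro x hx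
    rw [uIcc_of_le hab] at hx
    exact ⟨by linarith [hx.1, Real.pi_pos], by linarith [hx.2]⟩
  rw [intervalIntegral.integral_eq_sub_of_hasDerivAt
    (f := fun x => k * Real.tan x + m * x) (f' := fun x => k * (1 / Real.cos x ^ 2) + m)]
  · ring
  · intro x hx
    exact (((Real.hasDerivAt_tan_of_mem_Ioo (hsub x hx)).const_mul k).add
      ((hasDerivAt_id x).const_mul m)).congr_deriv (by ring)
  · refine ContinuousOn.intervalIntegrable fun x hx => ContinuousAt.continuousWithinAt ?_
    have := (cos_pos_of_abs (hsub x hx)).ne'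
    fun_prop (disch := positivity)

/-! ### The Lagrangian bound for a single edge -/

/-- The data of the Lagrangian problem: `h₀` and `R` are the inradius and the circumradius of the
hexagon, `r` is the radius of the discs, and `lam` and `B` are the multipliers of the area and the
angle. The function `EdgeData.W` is nonnegative precisely on `[ρ₁, R]`. -/
structure EdgeData where
  h₀ : ℝ
  r : ℝ
  R : ℝ
  lam : ℝ
  B : ℝ
  ρ₁ : ℝ
  h₀_pos : 0 < h₀
  h₀_lt : h₀ < r
  r_lt : r < R
  lam_pos : 0 < lam
  lam_lt : lam < 1
  -- The three equations say that `T` is stationary at `h₀`, that `W` vanishes at `R`, and that its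
  -- other positive zero is `ρ₁`.
  lam_eq : lam * √(R ^ 2 - h₀ ^ 2) = √(r ^ 2 - h₀ ^ 2)
  B_eq : 2 * B = r ^ 2 - lam * R ^ 2
  ρ₁_eq : (1 - lam) * ρ₁ ^ 2 = 2 * B
  ρ₁_pos : 0 < ρ₁

namespace EdgeData

variable (p : EdgeData)

/-- The Lagrangian of a radius. -/
noncomputable def W (x : ℝ) : ℝ := (min x p.r ^ 2 - p.lam * x ^ 2) / 2 - p.B

/-- The optimal integral over a right triangle with a leg `h`. -/
noncomputable def T (h : ℝ) : ℝ := segArea p.r h - p.lam * segArea p.R h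

/-- The contribution of half an edge of the hexagon. -/
noncomputable def A : ℝ := p.T p.h₀

lemma r_pos : 0 < p.r := p.h₀_pos.trans p.h₀_lt

lemma R_pos : 0 < p.R := p.r_pos.trans p.r_lt

/-- From `(1 - lam) ρ₁² = r² - lam R² < (1 - lam) r²`. Hence `ρ₁` lies on the branch of `W` on which
the minimum is `x`. -/
lemma ρ₁_lt : p.ρ₁ < p.r := by
  have h1 := p.B_eq; have h2 := p.ρ₁_eq; have h3 := p.r_lt; have h4 := p.lam_lt
  have h5 := p.lam_pos; have h6 := p.r_pos
  by_contra hc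
  push Not at hc
  have : p.r ^ 2 ≤ p.ρ₁ ^ 2 := by nlinarith
  have h7 : (1 - p.lam) * p.r ^ 2 ≤ (1 - p.lam) * p.ρ₁ ^ 2 :=
    mul_le_mul_of_nonneg_left this (by linarith)
  have h8 : p.lam * p.r ^ 2 < p.lam * p.R ^ 2 := by
    apply mul_lt_mul_of_pos_left _ h5
    nlinarith
  nlinarith

lemma B_pos : 0 < p.B := by
  have := p.ρ₁_eq
  have h1 : 0 < (1 - p.lam) * p.ρ₁ ^ 2 :=
    mul_pos (by linarith [p.lam_lt]) (pow_pos p.ρ₁_pos 2)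
  linarith

lemma W_nonneg {x : ℝ} (h1 : p.ρ₁ ≤ x) (h2 : x ≤ p.R) : 0 ≤ p.W x := by
  have hb := p.B_eq; have hr := p.ρ₁_eq; have := p.ρ₁_pos; have hl := p.lam_lt
  have hl' := p.lam_pos
  unfold W
  rcases le_total x p.r with hx | hx
  · rw [min_eq_left hx]
    nlinarith [mul_le_mul_of_nonneg_left (pow_le_pow_left₀ this.le h1 2) (by linarith : 0 ≤ 1 - p.lam)]
  · rw [min_eq_right hx]
    nlinarith [mul_le_mul_of_nonneg_left (pow_le_pow_left₀ (this.le.trans h1) h2 2) hl'.le]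

lemma W_nonpos_of_le {x : ℝ} (h0 : 0 ≤ x) (h1 : x ≤ p.ρ₁) : p.W x ≤ 0 := by
  have hb := p.B_eq; have hr := p.ρ₁_eq; have hl := p.lam_lt
  unfold W
  rw [min_eq_left (h1.trans p.ρ₁_lt.le)]
  nlinarith [mul_le_mul_of_nonneg_left (pow_le_pow_left₀ h0 h1 2) (by linarith : 0 ≤ 1 - p.lam)]

lemma W_nonpos_of_ge {x : ℝ} (h1 : p.R ≤ x) : p.W x ≤ 0 := by
  have hb := p.B_eq; have hl := p.lam_pos
  unfold W
  rw [min_eq_right (p.r_lt.le.trans h1)]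
  nlinarith [mul_le_mul_of_nonneg_left (pow_le_pow_left₀ p.R_pos.le h1 2) hl.le]

lemma continuous_W : Continuous p.W := by
  unfold W; fun_prop

lemma continuousOn_W_div_cos (h : ℝ) :
    ContinuousOn (fun x => p.W (h / Real.cos x)) (Ioo (-(Real.pi / 2)) (Real.pi / 2)) := by
  refine p.continuous_W.comp_continuousOn fun x hx => ContinuousAt.continuousWithinAt ?_
  have := (cos_pos_of_abs hx).ne'
  fun_prop (disch := positivity)

lemma T_of_R_le {h : ℝ} (hh : p.R ≤ h) : p.T h = 0 := by
  rw [T, segArea_of_le p.r_pos (p.r_lt.le.trans hh), segArea_of_le p.R_pos hh]; simp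

lemma continuous_T : Continuous p.T :=
  (continuous_segArea _).sub (continuous_const.mul (continuous_segArea _))

lemma hasDerivAt_T {h : ℝ} (hh : 0 < h) (h1 : h ≠ p.r) (h2 : h ≠ p.R) :
    HasDerivAt p.T (√(p.r ^ 2 - h ^ 2) - p.lam * √(p.R ^ 2 - h ^ 2)) h :=
  (hasDerivAt_segArea p.r_pos hh h1).sub ((hasDerivAt_segArea p.R_pos hh h2).const_mul _)

lemma lam_sq : p.lam ^ 2 * (p.R ^ 2 - p.h₀ ^ 2) = p.r ^ 2 - p.h₀ ^ 2 := by
  have h1 : 0 ≤ p.R ^ 2 - p.h₀ ^ 2 := by nlinarith [p.h₀_pos, p.h₀_lt, p.r_lt]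
  have h2 : 0 ≤ p.r ^ 2 - p.h₀ ^ 2 := by nlinarith [p.h₀_pos, p.h₀_lt, p.r_lt]
  rw [← Real.sq_sqrt h1, ← Real.sq_sqrt h2, ← p.lam_eq]; ring

/-- The derivative of `T` is `√(r² - h²) - lam √(R² - h²)`. By `lam_sq` the difference of the
radicands `r² - h²` and `lam² (R² - h²)` is `(1 - lam²)(h₀² - h²)`, so `T` increases up to `h₀` and
decreases from `h₀` to `R`, where it reaches `0`. The decreasing range is split at `r`, where the
derivative formula is not available. -/
lemma T_le_A {h : ℝ} (hh : 0 < h) : p.T h ≤ p.A := by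
  have h0 := p.h₀_pos; have h1 := p.h₀_lt; have h2 := p.r_lt; have hl := p.lam_pos
  have hsq := p.lam_sq
  have hlow : ∀ x, 0 < x → x ≤ p.h₀ → p.T x ≤ p.T p.h₀ := by
    intro x hx hxh
    refine monotoneOn_of_deriv_nonneg (convex_Icc x p.h₀) p.continuous_T.continuousOn ?_ ?_
      (left_mem_Icc.2 hxh) (right_mem_Icc.2 hxh) hxh
    · intro y hy
      rw [interior_Icc] at hy
      exact (p.hasDerivAt_T (hx.trans hy.1) (by linarith [hy.2]) (by linarith [hy.2])).differentiableAt.differentiableWithinAt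
    · intro y hy
      rw [interior_Icc] at hy
      have hy0 : 0 < y := hx.trans hy.1
      rw [(p.hasDerivAt_T hy0 (by linarith [hy.2]) (by linarith [hy.2])).deriv, sub_nonneg]
      refine Real.le_sqrt_of_sq_le ?_
      rw [mul_pow, Real.sq_sqrt (by nlinarith [hy.2])]
      have : p.lam ^ 2 ≤ 1 := by nlinarith [p.lam_lt]
      have h3 : 0 ≤ p.h₀ ^ 2 - y ^ 2 := by nlinarith [hy.2]
      linarith [mul_nonneg (sub_nonneg.2 this) h3]
  have hhigh : ∀ x y, p.h₀ ≤ x → x ≤ y → y ≤ p.R → (y ≤ p.r ∨ p.r ≤ x) → p.T y ≤ p.T x := by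
    intro x y hx hxy hyR hr
    refine antitoneOn_of_deriv_nonpos (convex_Icc x y) p.continuous_T.continuousOn ?_ ?_
      (left_mem_Icc.2 hxy) (right_mem_Icc.2 hxy) hxy
    · intro z hz
      rw [interior_Icc] at hz
      refine (p.hasDerivAt_T (by linarith [hz.1]) ?_ (by linarith [hz.2])).differentiableAt.differentiableWithinAt
      rcases hr with hr | hr
      · linarith [hz.2]
      · linarith [hz.1]
    · intro z hz
      rw [interior_Icc] at hz
      have hne : z ≠ p.r := by
        rcases hr with hr | hr
        · linarith [hz.2]
        · linarith [hz.1]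
      rw [(p.hasDerivAt_T (by linarith [hz.1]) hne (by linarith [hz.2])).deriv, sub_nonpos]
      have hzR : 0 ≤ p.R ^ 2 - z ^ 2 := by nlinarith [hz.1, hz.2]
      refine Real.sqrt_le_iff.2 ⟨by positivity, ?_⟩
      rw [mul_pow, Real.sq_sqrt hzR]
      have : p.lam ^ 2 ≤ 1 := by nlinarith [p.lam_lt]
      have h3 : 0 ≤ z ^ 2 - p.h₀ ^ 2 := by nlinarith [hz.1]
      linarith [mul_nonneg (sub_nonneg.2 this) h3]
  unfold A
  rcases le_total h p.h₀ with hc | hc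
  · exact hlow h hh hc
  rcases le_total h p.r with hc' | hc'
  · exact hhigh _ _ le_rfl hc (by linarith) (Or.inl hc')
  have hA := hhigh _ _ le_rfl h1.le h2.le (Or.inl le_rfl)
  rcases le_total h p.R with hc'' | hc''
  · exact (hhigh _ _ h1.le hc' hc'' (Or.inr le_rfl)).trans hA
  · rw [p.T_of_R_le hc'', ← p.T_of_R_le le_rfl]
    exact (hhigh _ _ h1.le h2.le le_rfl (Or.inr le_rfl)).trans hA

lemma A_nonneg : 0 ≤ p.A := by
  rw [← p.T_of_R_le le_rfl]; exact p.T_le_A p.R_pos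

/-- The choice of `B` and `ρ₁` makes `r²` the convex combination `lam R² + (1 - lam) ρ₁²`; the claim
is concavity of the square root at these points shifted by `h²`. -/
lemma sqrt_concave {h : ℝ} (h0 : 0 ≤ h) (h1 : h ≤ p.ρ₁) :
    p.lam * √(p.R ^ 2 - h ^ 2) + (1 - p.lam) * √(p.ρ₁ ^ 2 - h ^ 2) ≤ √(p.r ^ 2 - h ^ 2) := by
  have hR : p.ρ₁ ≤ p.R := (p.ρ₁_lt.trans p.r_lt).le
  have := Real.strictConcaveOn_sqrt.concaveOn.2 (x := p.R ^ 2 - h ^ 2) (y := p.ρ₁ ^ 2 - h ^ 2)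
    (by simp only [mem_Ici]; nlinarith) (by simp only [mem_Ici]; nlinarith) p.lam_pos.le
    (by linarith [p.lam_lt] : 0 ≤ 1 - p.lam) (by ring)
  simp only [smul_eq_mul] at this
  refine this.trans (le_of_eq ?_)
  congr 1
  have h2 := p.ρ₁_eq; have h3 := p.B_eq
  linear_combination h2 + h3

/-- The left side is the integral of `W` over one of the two positive pieces of a line that passes
inside the circle of radius `ρ₁`. By `sqrt_concave` it increases with `h`, and at `h = ρ₁` it equals
`T ρ₁`. -/
lemma T_sub_segArea_le {h : ℝ} (hh : 0 < h) (h1 : h ≤ p.ρ₁) :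
    p.T h - (1 - p.lam) * segArea p.ρ₁ h ≤ p.A := by
  have hr := p.ρ₁_lt; have hR := p.r_lt
  have hm : MonotoneOn (fun x => p.T x - (1 - p.lam) * segArea p.ρ₁ x) (Icc h p.ρ₁) := by
    have hd : ∀ y ∈ Ioo h p.ρ₁, HasDerivAt (fun x => p.T x - (1 - p.lam) * segArea p.ρ₁ x)
        ((√(p.r ^ 2 - y ^ 2) - p.lam * √(p.R ^ 2 - y ^ 2)) -
          (1 - p.lam) * √(p.ρ₁ ^ 2 - y ^ 2)) y := fun y hy =>
      (p.hasDerivAt_T (hh.trans hy.1) (by linarith [hy.2]) (by linarith [hy.2])).sub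
        ((hasDerivAt_segArea p.ρ₁_pos (hh.trans hy.1) hy.2.ne).const_mul _)
    refine monotoneOn_of_deriv_nonneg (convex_Icc _ _)
      (p.continuous_T.sub (continuous_const.mul (continuous_segArea _))).continuousOn ?_ ?_
    · intro y hy
      rw [interior_Icc] at hy
      exact (hd y hy).differentiableAt.differentiableWithinAt
    · intro y hy
      rw [interior_Icc] at hy
      rw [(hd y hy).deriv]
      linarith [p.sqrt_concave (hh.trans hy.1).le hy.2.le]
  have h2 := hm (left_mem_Icc.2 h1) (right_mem_Icc.2 h1) h1
  simp only [segArea_of_le p.ρ₁_pos le_rfl, mul_zero, sub_zero] at h2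
  exact h2.trans (p.T_le_A p.ρ₁_pos)

/-- The range is cut at `β`, where the line `h / cos x` leaves the disc of radius `r`. On each piece
`W` is affine in `1 / cos²`, with a tangent as primitive. The terms linear in the upper limit cancel
by `B_eq`. If `h ≥ r`, the first piece is empty. -/
lemma integral_W_div_cos {h a : ℝ} (hh : 0 < h) (ha0 : 0 ≤ a)
    (ha : a ≤ Real.arccos (h / p.r)) :
    ∫ x in a..Real.arccos (h / p.R), p.W (h / Real.cos x) =
      p.T h - ((1 - p.lam) / 2 * (h ^ 2 * Real.tan a) - p.B * a) := by
  set β := Real.arccos (h / p.r) with hβ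
  set b := Real.arccos (h / p.R) with hb
  have hβb : β ≤ b := Real.arccos_le_arccos (div_le_div_of_nonneg_left hh.le p.r_pos p.r_lt.le)
  have hbpi : b < Real.pi / 2 := Real.arccos_lt_pi_div_two.2 (div_pos hh p.R_pos)
  have hmem : ∀ x, a ≤ x → x ≤ b → x ∈ Ioo (-(Real.pi / 2)) (Real.pi / 2) := fun x h1 h2 =>
    ⟨by linarith [Real.pi_pos], by linarith⟩
  have hint : ∀ x y, a ≤ x → x ≤ y → y ≤ b →
      IntervalIntegrable (fun x => p.W (h / Real.cos x)) volume x y := fun x y h1 h2 h3 =>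
    ((p.continuousOn_W_div_cos h).mono (by
      rw [uIcc_of_le h2]; exact fun z hz => hmem z (h1.trans hz.1) (hz.2.trans h3))).intervalIntegrable
  rw [← intervalIntegral.integral_add_adjacent_intervals (hint a β le_rfl ha hβb)
    (hint β b ha hβb le_rfl)]
  have e1 : ∫ x in a..β, p.W (h / Real.cos x) =
      ∫ x in a..β, ((1 - p.lam) / 2 * h ^ 2 * (1 / Real.cos x ^ 2) + -p.B) := by
    rcases eq_or_lt_of_le ha with rfl | hlt'
    · simp
    have hlt : h < p.r := by
      by_contra hge
      have : β = 0 := Real.arccos_eq_zero.2 ((one_le_div p.r_pos).2 (not_lt.1 hge))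
      linarith
    refine intervalIntegral.integral_congr fun x hx => ?_
    rw [uIcc_of_le ha] at hx
    have hc := cos_pos_of_abs (hmem x hx.1 (hx.2.trans hβb))
    have hle : h / Real.cos x ≤ p.r := by
      have h1 : Real.cos β ≤ Real.cos x :=
        Real.cos_le_cos_of_nonneg_of_le_pi (ha0.trans hx.1) (by linarith [Real.pi_pos]) hx.2
      rw [hβ, Real.cos_arccos (by linarith [div_pos hh p.r_pos]) ((div_lt_one p.r_pos).2 hlt).le,
        div_le_iff₀ p.r_pos] at h1
      rw [div_le_iff₀ hc]; linarith
    simp only [W, min_eq_left hle]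
    field_simp; ring
  have e2 : ∫ x in β..b, p.W (h / Real.cos x) =
      ∫ x in β..b, (-p.lam / 2 * h ^ 2 * (1 / Real.cos x ^ 2) + (p.r ^ 2 / 2 - p.B)) := by
    refine intervalIntegral.integral_congr fun x hx => ?_
    rw [uIcc_of_le hβb] at hx
    have hc := cos_pos_of_abs (hmem x (ha.trans hx.1) hx.2)
    have hge : p.r ≤ h / Real.cos x := by
      have h1 : Real.cos x ≤ h / p.r := by
        rcases le_total h p.r with hlt | hge
        · have h1 : Real.cos x ≤ Real.cos β :=
            Real.cos_le_cos_of_nonneg_of_le_pi (ha0.trans ha) (by linarith [Real.pi_pos, hx.2]) hx.1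
          rwa [hβ, Real.cos_arccos (by linarith [div_pos hh p.r_pos])
            ((div_le_one p.r_pos).2 hlt)] at h1
        · exact (Real.cos_le_one x).trans ((one_le_div p.r_pos).2 hge)
      rw [le_div_iff₀ p.r_pos] at h1
      rw [le_div_iff₀ hc]; linarith
    simp only [W, min_eq_right hge]
    field_simp; ring
  rw [e1, e2, integral_div_cos_sq_add _ _ ha0 ha (hβb.trans_lt hbpi),
    integral_div_cos_sq_add _ _ (ha0.trans ha) hβb hbpi]
  have t1 := sq_mul_tan_arccos p.r_pos hh
  have t2 := sq_mul_tan_arccos p.R_pos hh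
  rw [← hβ] at t1
  rw [← hb] at t2
  simp only [T, segArea, ← hβ, ← hb]
  linear_combination (1 / 2) * t1 - p.lam / 2 * t2 - b / 2 * p.B_eq

end EdgeData

/-- Passing from `J` to `K` discards only nonpositive values and adds only nonnegative ones. -/
lemma setIntegral_le_of_sign {f : ℝ → ℝ} {J K : Set ℝ} (hJ : MeasurableSet J)
    (hK : MeasurableSet K) (hfJ : IntegrableOn f J) (hfK : IntegrableOn f K)
    (h1 : ∀ x ∈ J \ K, f x ≤ 0) (h2 : ∀ x ∈ K \ J, 0 ≤ f x) :
    ∫ x in J, f x ≤ ∫ x in K, f x := by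
  have e1 := integral_inter_add_sdiff hK hfJ
  have e2 := integral_inter_add_sdiff hJ hfK
  rw [inter_comm] at e2
  have i1 := setIntegral_nonpos (μ := volume) (hJ.diff hK) h1
  have i2 := setIntegral_nonneg (μ := volume) (hK.diff hJ) h2
  linarith

namespace EdgeData

variable (p : EdgeData)

lemma integral_W_from_zero {h : ℝ} (hh : 0 < h) :
    ∫ x in (0)..Real.arccos (h / p.R), p.W (h / Real.cos x) = p.T h := by
  rw [p.integral_W_div_cos hh le_rfl (Real.arccos_nonneg _)]; simp

lemma integral_W_outer {h : ℝ} (hh : 0 < h) :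
    ∫ x in Real.arccos (h / p.ρ₁)..Real.arccos (h / p.R), p.W (h / Real.cos x) =
      p.T h - (1 - p.lam) * segArea p.ρ₁ h := by
  rw [p.integral_W_div_cos hh (Real.arccos_nonneg _)
    (Real.arccos_le_arccos (div_le_div_of_nonneg_left hh.le p.ρ₁_pos p.ρ₁_lt.le)),
    sq_mul_tan_arccos p.ρ₁_pos hh, segArea]
  linear_combination -(Real.arccos (h / p.ρ₁) / 2) * p.ρ₁_eq

lemma integral_W_symm (h : ℝ) {b : ℝ} (hb0 : 0 ≤ b) (hb : b < Real.pi / 2) :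
    ∫ x in Icc (-b) b, p.W (h / Real.cos x) = 2 * ∫ x in (0)..b, p.W (h / Real.cos x) := by
  have hint : ∀ x y, -b ≤ x → x ≤ y → y ≤ b →
      IntervalIntegrable (fun x => p.W (h / Real.cos x)) volume x y := fun x y _ h2 _ =>
    ((p.continuousOn_W_div_cos h).mono (by
      rw [uIcc_of_le h2]
      exact fun z hz => ⟨by linarith [hz.1], by linarith [hz.2]⟩)).intervalIntegrable
  rw [integral_Icc_eq_integral_Ioc, ← intervalIntegral.integral_of_le (by linarith),
    ← intervalIntegral.integral_add_adjacent_intervals (hint (-b) 0 le_rfl (by linarith) hb0)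
      (hint 0 b (by linarith) hb0 le_rfl)]
  have := intervalIntegral.integral_comp_neg (a := 0) (b := b)
    (fun x => p.W (h / Real.cos x))
  simp only [Real.cos_neg, neg_zero] at this
  rw [← this]; ring

lemma integral_W_neg (h : ℝ) {a b : ℝ} (hab : a ≤ b) :
    ∫ x in Icc (-b) (-a), p.W (h / Real.cos x) = ∫ x in a..b, p.W (h / Real.cos x) := by
  rw [integral_Icc_eq_integral_Ioc, ← intervalIntegral.integral_of_le (by linarith)]
  have := intervalIntegral.integral_comp_neg (a := a) (b := b)
    (fun x => p.W (h / Real.cos x))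
  simp only [Real.cos_neg] at this
  exact this.symm

/-- The bound for the contribution of a single edge at distance `h` from the center that is seen
from the center under the directions `J`. -/
lemma setIntegral_W_le {h : ℝ} (hh : 0 < h) {J : Set ℝ} (hJ : J.OrdConnected)
    (hJs : J ⊆ Ioo (-(Real.pi / 2)) (Real.pi / 2))
    (hint : IntegrableOn (fun x => p.W (h / Real.cos x)) J) :
    ∫ x in J, p.W (h / Real.cos x) ≤ 2 * p.A := by
  have hA := p.A_nonneg
  have hJm : MeasurableSet J := hJ.measurableSet
  rcases le_or_gt p.R h with hR | hR
  · refine (setIntegral_nonpos hJm fun x hx => p.W_nonpos_of_ge ?_).trans (by linarith)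
    have hc := cos_pos_of_abs (hJs hx)
    rw [le_div_iff₀ hc]
    nlinarith [Real.cos_le_one x, p.R_pos]
  set b := Real.arccos (h / p.R) with hb
  have hb0 : 0 ≤ b := Real.arccos_nonneg _
  have hbpi : b < Real.pi / 2 := Real.arccos_lt_pi_div_two.2 (div_pos hh p.R_pos)
  have hcb : Real.cos b = h / p.R := Real.cos_arccos
    (by linarith [div_pos hh p.R_pos]) ((div_lt_one p.R_pos).2 hR).le
  have hT : 2 * ∫ x in (0)..b, p.W (h / Real.cos x) ≤ 2 * p.A := by
    rw [hb, p.integral_W_from_zero hh]; linarith [p.T_le_A hh]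
  have out : ∀ x ∈ J, b ≤ |x| → p.W (h / Real.cos x) ≤ 0 := by
    intro x hx hxb
    have hc := cos_pos_of_abs (hJs hx)
    have hx' : |x| < Real.pi / 2 := abs_lt.2 (hJs hx)
    have : Real.cos |x| ≤ Real.cos b :=
      Real.cos_le_cos_of_nonneg_of_le_pi hb0 (by linarith [Real.pi_pos]) hxb
    rw [Real.cos_abs, hcb, le_div_iff₀ p.R_pos] at this
    refine p.W_nonpos_of_ge ?_
    rw [le_div_iff₀ hc]; linarith
  have le_R : ∀ x, |x| ≤ b → 0 < Real.cos x ∧ h / Real.cos x ≤ p.R := by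
    intro x hx
    have : Real.cos b ≤ Real.cos |x| :=
      Real.cos_le_cos_of_nonneg_of_le_pi (abs_nonneg x) (by linarith [Real.pi_pos]) hx
    rw [Real.cos_abs, hcb] at this
    have hc : 0 < Real.cos x := (div_pos hh p.R_pos).trans_le this
    refine ⟨hc, ?_⟩
    rw [div_le_iff₀ p.R_pos] at this
    rw [div_le_iff₀ hc]; linarith
  have hintK : ∀ x y, -b ≤ x → y ≤ b →
      IntegrableOn (fun x => p.W (h / Real.cos x)) (Icc x y) := fun x y h1 h2 =>
    ((p.continuousOn_W_div_cos h).mono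
      (fun z hz => ⟨by linarith [hz.1], by linarith [hz.2]⟩)).integrableOn_compact isCompact_Icc
  -- For `h ≥ ρ₁` the integrand is nonnegative on all of `[-b, b]` and nonpositive on the rest of
  -- `J`, so the symmetric interval is the best one.
  rcases le_or_gt p.ρ₁ h with hρ | hρ
  · refine le_trans ?_ ((p.integral_W_symm h hb0 hbpi).le.trans hT)
    refine setIntegral_le_of_sign hJm measurableSet_Icc hint (hintK _ _ le_rfl le_rfl) ?_ ?_
    · intro x hx
      refine out x hx.1 (le_of_lt ?_)
      by_contra hc
      exact hx.2 (abs_le.1 (not_lt.1 hc))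
    · intro x hx
      obtain ⟨hc, hc'⟩ := le_R x (abs_le.2 hx.1)
      refine p.W_nonneg ?_ hc'
      rw [le_div_iff₀ hc]
      nlinarith [Real.cos_le_one x, p.ρ₁_pos]
  · set a := Real.arccos (h / p.ρ₁) with ha
    have ha0 : 0 ≤ a := Real.arccos_nonneg _
    have hab : a ≤ b := Real.arccos_le_arccos
      (div_le_div_of_nonneg_left hh.le p.ρ₁_pos (p.ρ₁_lt.trans p.r_lt).le)
    have hca : Real.cos a = h / p.ρ₁ := Real.cos_arccos
      (by linarith [div_pos hh p.ρ₁_pos]) ((div_lt_one p.ρ₁_pos).2 hρ).le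
    have hD : ∫ x in a..b, p.W (h / Real.cos x) ≤ 2 * p.A := by
      rw [ha, hb, p.integral_W_outer hh]
      linarith [p.T_sub_segArea_le hh hρ.le]
    have mid : ∀ x ∈ J, |x| ≤ a → p.W (h / Real.cos x) ≤ 0 := by
      intro x hx hxa
      have hc := cos_pos_of_abs (hJs hx)
      have : Real.cos a ≤ Real.cos |x| :=
        Real.cos_le_cos_of_nonneg_of_le_pi (abs_nonneg x) (by linarith [Real.pi_pos]) hxa
      rw [Real.cos_abs, hca, div_le_iff₀ p.ρ₁_pos] at this
      refine p.W_nonpos_of_le (div_pos hh hc).le ?_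
      rw [div_le_iff₀ hc]; linarith
    have pos : ∀ x, a ≤ |x| → |x| ≤ b → 0 ≤ p.W (h / Real.cos x) := by
      intro x hxa hxb
      obtain ⟨hc, hc'⟩ := le_R x hxb
      refine p.W_nonneg ?_ hc'
      have : Real.cos |x| ≤ Real.cos a :=
        Real.cos_le_cos_of_nonneg_of_le_pi ha0 (by linarith [Real.pi_pos]) hxa
      rw [Real.cos_abs, hca, le_div_iff₀ p.ρ₁_pos] at this
      rw [le_div_iff₀ hc]; linarith
    by_cases hcov : Icc (-a) a ⊆ J
    · refine le_trans ?_ ((p.integral_W_symm h hb0 hbpi).le.trans hT)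
      refine setIntegral_le_of_sign hJm measurableSet_Icc hint (hintK _ _ le_rfl le_rfl) ?_ ?_
      · intro x hx
        refine out x hx.1 (le_of_lt ?_)
        by_contra hc
        exact hx.2 (abs_le.1 (not_lt.1 hc))
      · intro x hx
        refine pos x (le_of_lt ?_) (abs_le.2 hx.1)
        by_contra hc
        exact hx.2 (hcov (abs_le.1 (not_lt.1 hc)))
    -- An interval that misses a point of `[-a, a]` lies on one side of it, so it meets at most one
    -- of the two positive pieces `[a, b]` and `[-b, -a]`, up to a null set.
    obtain ⟨z, hz, hzJ⟩ := not_subset.1 hcov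
    by_cases hside : ∃ y ∈ J, z < y
    · obtain ⟨y, hyJ, hzy⟩ := hside
      have hall : ∀ x ∈ J, z < x := by
        intro x hx
        by_contra hc
        exact hzJ (hJ.out hx hyJ ⟨not_lt.1 hc, hzy.le⟩)
      refine le_trans ?_ hD
      rw [intervalIntegral.integral_of_le hab, ← integral_Icc_eq_integral_Ioc]
      refine setIntegral_le_of_sign hJm measurableSet_Icc hint (hintK _ _ (by linarith) le_rfl) ?_ ?_
      · intro x hx
        have hzx := hall x hx.1
        rcases le_or_gt |x| a with hxa | hxa
        · exact mid x hx.1 hxa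
        refine out x hx.1 ?_
        rcases lt_abs.1 hxa with h' | h'
        · by_contra hc
          exact hx.2 ⟨h'.le, (le_abs_self x).trans (not_le.1 hc).le⟩
        · linarith [hz.1]
      · intro x hx
        have h0 : 0 ≤ x := ha0.trans hx.1.1
        exact pos x (by rw [abs_of_nonneg h0]; exact hx.1.1) (by rw [abs_of_nonneg h0]; exact hx.1.2)
    · push Not at hside
      refine le_trans ?_ hD
      rw [← p.integral_W_neg h hab]
      refine setIntegral_le_of_sign hJm measurableSet_Icc hint (hintK _ _ le_rfl (by linarith)) ?_ ?_
      · intro x hx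
        have hzx := hside x hx.1
        rcases le_or_gt |x| a with hxa | hxa
        · exact mid x hx.1 hxa
        refine out x hx.1 ?_
        rcases lt_abs.1 hxa with h' | h'
        · linarith [hz.2]
        · by_contra hc
          exact hx.2 ⟨by linarith [neg_le_abs x], by linarith⟩
      · intro x hx
        have h0 : x ≤ 0 := by linarith [hx.1.2]
        exact pos x (by rw [abs_of_nonpos h0]; linarith [hx.1.2])
          (by rw [abs_of_nonpos h0]; linarith [hx.1.1])

end EdgeData

/-! ### From edges to bounded polygons -/

lemma continuous_dir : Continuous dir := by
  unfold dir
  refine (PiLp.continuous_toLp 2 _).comp (continuous_pi fun i => ?_)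
  fin_cases i
  · exact Real.continuous_cos
  · exact Real.continuous_sin

lemma dir_add_two_pi (θ : ℝ) : dir (θ + 2 * Real.pi) = dir θ := by
  refine plane_ext ?_ ?_ <;> simp

lemma dir_injOn : InjOn dir (Ioo (-Real.pi) Real.pi) := by
  intro a ha b hb hab
  have h : Real.cos (a - b) = 1 := by
    rw [← inner_dir_dir, hab, real_inner_self_eq_norm_sq, norm_dir]; norm_num
  have := (Real.cos_eq_one_iff_of_lt_of_lt (by linarith [ha.1, hb.2]) (by linarith [ha.2, hb.1])).1 h
  linarith

lemma volume_setOf_inner_dir_eq_zero {w : Plane} (hw : w ≠ 0) :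
    volume {θ : ℝ | inner ℝ (dir θ) w = 0} = 0 := by
  obtain ⟨ψ, hψ⟩ := exists_polar w
  refine Set.Countable.measure_zero ?_ _
  refine (countable_range fun k : ℤ => (2 * k + 1) * Real.pi / 2 + ψ).mono fun θ hθ => ?_
  rw [mem_ofPred_eq, hψ, real_inner_smul_right, inner_dir_dir, mul_eq_zero] at hθ
  obtain ⟨k, hk⟩ := Real.cos_eq_zero_iff.1 (hθ.resolve_left (norm_ne_zero_iff.2 hw))
  exact ⟨k, by simp only; linarith⟩

namespace EdgeData

variable (p : EdgeData)

/-- The radial functions of `S` and of its part in the disc are `1 / m` and `min (1 / m) r`.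
Integrating half their squares gives the areas, and the constant `B` in `W` accounts for `2πB`. -/
lemma area_sub_eq_integral {m : ℝ → ℝ} (hm : Continuous m) (hpos : ∀ θ, 0 < m θ) {S : Set Plane}
    (hS : MeasurableSet S) (h : ∀ θ t, 0 < t → (t • dir θ ∈ S ↔ t * m θ ≤ 1)) :
    volume.real (S ∩ Metric.closedBall 0 p.r) - p.lam * volume.real S =
      (∫ θ in Ioo (-Real.pi) Real.pi, p.W (1 / m θ)) + 2 * Real.pi * p.B := by
  have hr := p.r_pos
  have hρ : ∀ θ, 0 < 1 / m θ := fun θ => one_div_pos.2 (hpos θ)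
  have hcont : Continuous fun θ => 1 / m θ := continuous_const.div hm fun θ => (hpos θ).ne'
  have hint : ∀ g : ℝ → ℝ, Continuous g → IntegrableOn g (Ioo (-Real.pi) Real.pi) := fun g hg =>
    (hg.continuousOn.integrableOn_compact isCompact_Icc).mono_set Ioo_subset_Icc_self
  have area : ∀ (S' : Set Plane) (ρ : ℝ → ℝ), MeasurableSet S' → Continuous ρ → (∀ θ, 0 < ρ θ) →
      (∀ θ t, 0 < t → (t • dir θ ∈ S' ↔ t ≤ ρ θ)) →
      volume.real S' = ∫ θ in Ioo (-Real.pi) Real.pi, ρ θ ^ 2 / 2 := by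
    intro S' ρ hS' hρ hρ0 h'
    rw [measureReal_def, volume_eq_polar hS' (fun θ => (hρ0 θ).le) h',
      integral_eq_lintegral_of_nonneg_ae (ae_of_all _ fun θ => by positivity)
        (by fun_prop)]
  rw [area S (fun θ => 1 / m θ) hS hcont hρ, area (S ∩ Metric.closedBall 0 p.r)
    (fun θ => min (1 / m θ) p.r) (hS.inter Metric.isClosed_closedBall.measurableSet)
    (hcont.min continuous_const) fun θ => lt_min (hρ θ) hr]
  · have e : ∀ θ, p.W (1 / m θ) = min (1 / m θ) p.r ^ 2 / 2 - p.lam * ((1 / m θ) ^ 2 / 2) - p.B :=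
      fun θ => by unfold W; ring
    simp_rw [e]
    rw [integral_sub, integral_sub, integral_const_mul]
    · simp [Real.pi_pos.le]
      ring
    · exact hint _ (by fun_prop)
    · exact hint _ (by fun_prop)
    · exact hint _ (by fun_prop)
    · exact hint _ (by fun_prop)
  · intro θ t ht
    rw [mem_inter_iff, h θ t ht, mem_closedBall_zero_iff, norm_smul, norm_dir, mul_one,
      Real.norm_of_nonneg ht.le, le_min_iff, le_div_iff₀ (hpos θ)]
  · intro θ t ht
    rw [h θ t ht, le_div_iff₀ (hpos θ)]

end EdgeData

/-- The polygon with the dual vectors `D`. -/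
def polygon (D : Finset Plane) : Set Plane := {x | ∀ d ∈ D, inner ℝ x d ≤ 1}

/-- The reciprocal of the radial function of `polygon D`. -/
noncomputable def gaugeMax (D : Finset Plane) (hD : D.Nonempty) (θ : ℝ) : ℝ :=
  D.sup' hD fun d => inner ℝ (dir θ) d

section polygon

variable {D : Finset Plane} (hD : D.Nonempty)

lemma isClosed_polygon (D : Finset Plane) : IsClosed (polygon D) := by
  have : polygon D = ⋂ d ∈ D, {x : Plane | inner ℝ x d ≤ 1} := by ext; simp [polygon]
  rw [this]
  exact isClosed_biInter fun d _ => isClosed_le (by fun_prop) continuous_const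

lemma continuous_gaugeMax : Continuous (gaugeMax D hD) := by
  refine Continuous.finset_sup'_apply hD fun d _ => ?_
  exact continuous_dir.inner continuous_const

lemma smul_dir_mem_polygon_iff {θ t : ℝ} (ht : 0 < t) :
    t • dir θ ∈ polygon D ↔ t * gaugeMax D hD θ ≤ 1 := by
  have : t * gaugeMax D hD θ ≤ 1 ↔ gaugeMax D hD θ ≤ 1 / t := by
    rw [le_div_iff₀ ht, mul_comm]
  rw [this, gaugeMax, Finset.sup'_le_iff]
  refine forall₂_congr fun d _ => ?_
  rw [real_inner_smul_left, le_div_iff₀ ht, mul_comm]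

/-- Otherwise the whole ray in direction `θ` would lie in the polygon. -/
lemma gaugeMax_pos (hb : Bornology.IsBounded (polygon D)) (θ : ℝ) : 0 < gaugeMax D hD θ := by
  by_contra hc
  obtain ⟨K, hK⟩ := hb.exists_norm_le
  have h1 : 0 < |K| + 1 := by positivity
  have := hK _ ((smul_dir_mem_polygon_iff hD h1 (θ := θ)).2 (by nlinarith [not_lt.1 hc]))
  rw [norm_smul, norm_dir, mul_one, Real.norm_of_nonneg h1.le] at this
  linarith [le_abs_self K]

/-- The dual vector `d` is active along a nondegenerate edge of the polygon. -/
def IsEdge (D : Finset Plane) (d : Plane) : Prop :=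
  ∃ x ∈ polygon D, ∃ y ∈ polygon D, x ≠ y ∧ inner ℝ x d = 1 ∧ inner ℝ y d = 1

/-- The directions in which the boundary of the polygon lies on the line with dual vector `d`. -/
def activeSet (hD : D.Nonempty) (d : Plane) : Set ℝ := {θ | gaugeMax D hD θ = inner ℝ (dir θ) d}

lemma isClosed_activeSet (d : Plane) : IsClosed (activeSet hD d) :=
  isClosed_eq (continuous_gaugeMax hD) (continuous_dir.inner continuous_const)

lemma mem_activeSet_iff {d : Plane} (hd : d ∈ D) {θ : ℝ} :
    θ ∈ activeSet hD d ↔ ∀ d' ∈ D, inner ℝ (dir θ) d' ≤ inner ℝ (dir θ) d := by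
  constructor
  · intro h d' hd'
    rw [← show gaugeMax D hD θ = _ from h]
    exact Finset.le_sup' (fun d => inner ℝ (dir θ) d) hd'
  · intro h
    exact le_antisymm (Finset.sup'_le _ _ h) (Finset.le_sup' (fun d => inner ℝ (dir θ) d) hd)

lemma isEdge_of_volume_ne_zero (hpos : ∀ θ, 0 < gaugeMax D hD θ) {d : Plane}
    (h : volume (activeSet hD d ∩ Ioo (-Real.pi) Real.pi) ≠ 0) : IsEdge D d := by
  have hns : ¬ (activeSet hD d ∩ Ioo (-Real.pi) Real.pi).Subsingleton := fun hs =>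
    h (hs.measure_zero _)
  rw [not_subsingleton_iff] at hns
  obtain ⟨a, ha, b, hb, hab⟩ := hns
  have key : ∀ θ ∈ activeSet hD d, (1 / gaugeMax D hD θ) • dir θ ∈ polygon D ∧
      inner ℝ ((1 / gaugeMax D hD θ) • dir θ) d = 1 := by
    intro θ hθ
    refine ⟨(smul_dir_mem_polygon_iff hD (one_div_pos.2 (hpos θ))).2 ?_, ?_⟩
    · rw [one_div_mul_cancel (hpos θ).ne']
    · rw [real_inner_smul_left, ← show gaugeMax D hD θ = _ from hθ,
        one_div_mul_cancel (hpos θ).ne']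
  refine ⟨_, (key a ha.1).1, _, (key b hb.1).1, fun heq => hab ?_, (key a ha.1).2, (key b hb.1).2⟩
  have hn := congrArg norm heq
  simp only [norm_smul, norm_dir, mul_one, Real.norm_of_nonneg (one_div_pos.2 (hpos _)).le] at hn
  rw [hn] at heq
  exact dir_injOn ha.2 hb.2 (smul_right_injective _ (one_div_pos.2 (hpos b)).ne' heq)

/-- Measured from the direction of `d`, the active directions form an interval inside `(-π/2, π/2)`
on which the radial function is `(1 / ‖d‖) / cos x`. This is the situation of
`EdgeData.setIntegral_W_le`. -/
lemma setIntegral_activeSet_le (p : EdgeData) (hpos : ∀ θ, 0 < gaugeMax D hD θ) {d : Plane}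
    (hd : d ∈ D) :
    ∫ θ in activeSet hD d ∩ Ioo (-Real.pi) Real.pi, p.W (1 / gaugeMax D hD θ) ≤ 2 * p.A := by
  obtain ⟨φ, hφ⟩ := exists_polar d
  by_cases hd0 : d = 0
  · have : activeSet hD d = ∅ := by
      refine eq_empty_of_forall_notMem fun θ hθ => ?_
      have h1 : gaugeMax D hD θ = _ := hθ
      rw [hd0, inner_zero_right] at h1
      exact (hpos θ).ne' h1
    rw [this]; simpa using p.A_nonneg
  have hn : 0 < ‖d‖ := norm_pos_iff.2 hd0
  set g : ℝ → ℝ := (activeSet hD d).indicator fun θ => p.W (1 / gaugeMax D hD θ) with hg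
  have hgm : ∀ θ, gaugeMax D hD (θ + 2 * Real.pi) = gaugeMax D hD θ := fun θ => by
    simp only [gaugeMax, dir_add_two_pi]
  -- Periodicity permits centring the window of angles at the direction of `d`, so that the active
  -- interval is not cut in two.
  have hper : Function.Periodic g (2 * Real.pi) := by
    intro θ
    have : θ + 2 * Real.pi ∈ activeSet hD d ↔ θ ∈ activeSet hD d := by
      simp only [activeSet, mem_ofPred_eq, hgm, dir_add_two_pi]
    by_cases hθ : θ ∈ activeSet hD d
    · rw [hg, indicator_of_mem hθ, indicator_of_mem (this.2 hθ), hgm]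
    · rw [hg, indicator_of_notMem hθ, indicator_of_notMem (fun hc => hθ (this.1 hc))]
  have hmeas := (isClosed_activeSet hD d).measurableSet
  have hin : ∀ x, inner ℝ (dir (x + φ)) d = ‖d‖ * Real.cos x := by
    intro x
    conv_lhs => rw [hφ]
    rw [real_inner_smul_right, inner_dir_dir, add_sub_cancel_right]
  set J : Set ℝ := ((fun x => x + φ) ⁻¹' activeSet hD d) ∩ Ioc (-Real.pi) Real.pi with hJ
  have hJgauge : ∀ x ∈ J, gaugeMax D hD (x + φ) = ‖d‖ * Real.cos x := fun x hx => by
    rw [← hin]; exact hx.1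
  have hcos : ∀ x ∈ J, 0 < Real.cos x := fun x hx => by
    have := hpos (x + φ)
    rw [hJgauge x hx] at this
    exact pos_of_mul_pos_right this hn.le
  have hJs : J ⊆ Ioo (-(Real.pi / 2)) (Real.pi / 2) := by
    intro x hx
    have h1 := hcos x hx
    constructor
    · by_contra hc
      have := Real.cos_nonpos_of_pi_div_two_le_of_le (x := -x) (by linarith) (by linarith [hx.2.1])
      rw [Real.cos_neg] at this; linarith
    · by_contra hc
      have := Real.cos_nonpos_of_pi_div_two_le_of_le (x := x) (by linarith) (by linarith [hx.2.2])
      linarith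
  have hJm : MeasurableSet J :=
    ((isClosed_activeSet hD d).preimage (continuous_add_const φ)).measurableSet.inter
      measurableSet_Ioc
  have hJc : J.OrdConnected := by
    refine ⟨fun x hx z hz y hy => ⟨?_, hx.2.1.trans_le hy.1, hy.2.trans hz.2.2⟩⟩
    rcases eq_or_lt_of_le hy.1 with rfl | hxy
    · exact hx.1
    have hyz := hy.2
    have hx2 := hJs hx; have hz2 := hJs hz
    have hsin : 0 < Real.sin (z - x) :=
      Real.sin_pos_of_pos_of_lt_pi (by linarith) (by linarith [hx2.1, hz2.2])
    have s1 : 0 ≤ Real.sin (z - y) :=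
      Real.sin_nonneg_of_nonneg_of_le_pi (by linarith) (by linarith [hx2.1, hz2.2])
    have s2 : 0 ≤ Real.sin (y - x) :=
      Real.sin_nonneg_of_nonneg_of_le_pi (by linarith) (by linarith [hx2.1, hz2.2])
    -- An intermediate direction is a nonnegative combination of the outer two, and being active
    -- amounts to homogeneous linear inequalities.
    have comb : Real.sin (z - x) • dir (y + φ) =
        Real.sin (z - y) • dir (x + φ) + Real.sin (y - x) • dir (z + φ) := by
      refine plane_ext ?_ ?_
      · simp only [PiLp.smul_apply, PiLp.add_apply, dir_zero, smul_eq_mul, Real.sin_sub,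
          Real.cos_add]
        ring
      · simp only [PiLp.smul_apply, PiLp.add_apply, dir_one, smul_eq_mul, Real.sin_sub,
          Real.sin_add]
        ring
    refine (mem_activeSet_iff hD hd).2 fun d' hd' => ?_
    have i1 := (mem_activeSet_iff hD hd).1 hx.1 d' hd'
    have i2 := (mem_activeSet_iff hD hd).1 hz.1 d' hd'
    refine le_of_mul_le_mul_left ?_ hsin
    rw [← real_inner_smul_left, ← real_inner_smul_left, comb, inner_add_left, inner_add_left,
      real_inner_smul_left, real_inner_smul_left, real_inner_smul_left, real_inner_smul_left]
    exact add_le_add (mul_le_mul_of_nonneg_left i1 s1) (mul_le_mul_of_nonneg_left i2 s2)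
  have hWc : Continuous fun θ => p.W (1 / gaugeMax D hD (θ + φ)) :=
    p.continuous_W.comp (continuous_const.div
      ((continuous_gaugeMax hD).comp (continuous_add_const φ)) fun θ => (hpos _).ne')
  have hJi : IntegrableOn (fun θ => p.W (1 / gaugeMax D hD (θ + φ))) J :=
    (hWc.continuousOn.integrableOn_compact isCompact_Icc).mono_set
      ((inter_subset_right).trans Ioc_subset_Icc_self)
  have hval : ∀ x ∈ J, p.W (1 / gaugeMax D hD (x + φ)) = p.W (1 / ‖d‖ / Real.cos x) := by
    intro x hx
    rw [hJgauge x hx]; congr 1; rw [div_div]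
  have hpi : -Real.pi ≤ Real.pi := by linarith [Real.pi_pos]
  calc ∫ θ in activeSet hD d ∩ Ioo (-Real.pi) Real.pi, p.W (1 / gaugeMax D hD θ)
      = ∫ θ in (-Real.pi)..Real.pi, g θ := by
        rw [intervalIntegral.integral_of_le hpi, integral_Ioc_eq_integral_Ioo, hg,
          setIntegral_indicator hmeas, inter_comm]
    _ = ∫ θ in (-Real.pi + φ)..(Real.pi + φ), g θ := by
        have := hper.intervalIntegral_add_eq (-Real.pi) (-Real.pi + φ)
        rw [show -Real.pi + 2 * Real.pi = Real.pi by ring,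
          show -Real.pi + φ + 2 * Real.pi = Real.pi + φ by ring] at this
        exact this
    _ = ∫ θ in (-Real.pi)..Real.pi, g (θ + φ) :=
        (intervalIntegral.integral_comp_add_right g φ).symm
    _ = ∫ x in J, p.W (1 / gaugeMax D hD (x + φ)) := by
        have hind : (fun θ => g (θ + φ)) = ((fun x => x + φ) ⁻¹' activeSet hD d).indicator
            fun x => p.W (1 / gaugeMax D hD (x + φ)) := rfl
        rw [intervalIntegral.integral_of_le hpi, hind, setIntegral_indicator
          ((isClosed_activeSet hD d).preimage (continuous_add_const φ)).measurableSet, inter_comm]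
    _ = ∫ x in J, p.W (1 / ‖d‖ / Real.cos x) := setIntegral_congr_fun hJm hval
    _ ≤ 2 * p.A := p.setIntegral_W_le (one_div_pos.2 hn) hJc hJs
        (hJi.congr_fun hval hJm)

-- The active sets cover all directions and overlap in null sets, because two distinct dual vectors
-- agree only in countably many directions. Those that do not come from an edge are null themselves.
open Classical in
lemma integral_W_gaugeMax_le (p : EdgeData) (hpos : ∀ θ, 0 < gaugeMax D hD θ) :
    ∫ θ in Ioo (-Real.pi) Real.pi, p.W (1 / gaugeMax D hD θ) ≤
      2 * p.A * (D.filter (IsEdge D)).card := by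
  have hcov : (⋃ d : D, activeSet hD d ∩ Ioo (-Real.pi) Real.pi) = Ioo (-Real.pi) Real.pi := by
    refine subset_antisymm (iUnion_subset fun d => inter_subset_right) fun θ hθ => ?_
    obtain ⟨d, hd, he⟩ := Finset.exists_mem_eq_sup' hD fun d => inner ℝ (dir θ) d
    exact mem_iUnion.2 ⟨⟨d, hd⟩, he, hθ⟩
  have hWc : Continuous fun θ => p.W (1 / gaugeMax D hD θ) :=
    p.continuous_W.comp (continuous_const.div (continuous_gaugeMax hD) fun θ => (hpos _).ne')
  have hint : IntegrableOn (fun θ => p.W (1 / gaugeMax D hD θ)) (Ioo (-Real.pi) Real.pi) :=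
    (hWc.continuousOn.integrableOn_compact isCompact_Icc).mono_set Ioo_subset_Icc_self
  conv_lhs => rw [← hcov]
  rw [integral_iUnion_ae (fun d : D => ((isClosed_activeSet hD d).measurableSet.inter
    measurableSet_Ioo).nullMeasurableSet) ?_ ?_, tsum_fintype]
  · rw [Finset.sum_coe_sort D fun d => ∫ θ in activeSet hD d ∩ Ioo (-Real.pi) Real.pi,
      p.W (1 / gaugeMax D hD θ)]
    calc _ ≤ ∑ d ∈ D, if IsEdge D d then 2 * p.A else 0 := by
          refine Finset.sum_le_sum fun d hd => ?_
          split_ifs with he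
          · exact setIntegral_activeSet_le hD p hpos hd
          · have h0 : volume (activeSet hD d ∩ Ioo (-Real.pi) Real.pi) = 0 := by
              by_contra hc
              exact he (isEdge_of_volume_ne_zero hD hpos hc)
            rw [setIntegral_measure_zero _ h0]
      _ = 2 * p.A * (D.filter (IsEdge D)).card := by
          rw [← Finset.sum_filter, Finset.sum_const, nsmul_eq_mul, mul_comm]
  · intro d d' hdd
    have hne : (d : Plane) - d' ≠ 0 := sub_ne_zero.2 fun h => hdd (Subtype.ext h)
    refine measure_mono_null (fun θ hθ => ?_) (volume_setOf_inner_dir_eq_zero hne)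
    have h1 : gaugeMax D hD θ = _ := hθ.1.1
    have h2 : gaugeMax D hD θ = _ := hθ.2.1
    rw [mem_ofPred_eq, inner_sub_right, ← h1, ← h2, sub_self]
  · rw [hcov]; exact hint

end polygon

/-- The Lagrangian of a bounded polygon is at most that of a hexagon with the same number of
edges. -/
lemma polygon_lagrangian_le {D : Finset Plane} (hD : D.Nonempty) (p : EdgeData)
    (hb : Bornology.IsBounded (polygon D)) :
    volume.real (polygon D ∩ Metric.closedBall 0 p.r) - p.lam * volume.real (polygon D) ≤
      2 * p.A * {d | d ∈ D ∧ IsEdge D d}.ncard + 2 * Real.pi * p.B := by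
  classical
  rw [p.area_sub_eq_integral (continuous_gaugeMax hD) (gaugeMax_pos hD hb)
    (isClosed_polygon D).measurableSet fun θ t ht => smul_dir_mem_polygon_iff hD ht]
  have := integral_W_gaugeMax_le hD p (gaugeMax_pos hD hb)
  rw [← Set.ncard_coe_finset, Finset.coe_filter] at this
  linarith


/-! ### Voronoi cells and the count of their edges -/

/-- The Voronoi cell of the point `c` of `C`. -/
def cell (C : Finset Plane) (c : Plane) : Set Plane := {x | ∀ c' ∈ C, dist x c ≤ dist x c'}

/-- The rotation by a right angle. -/
def rot (x : Plane) : Plane := !₂[-x 1, x 0]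

@[simp] lemma rot_zero (x : Plane) : rot x 0 = -x 1 := rfl

@[simp] lemma rot_one (x : Plane) : rot x 1 = x 0 := rfl

lemma dist_le_dist_iff (x c c' : Plane) :
    dist x c ≤ dist x c' ↔ 2 * inner ℝ (x - c) (c' - c) ≤ ‖c' - c‖ ^ 2 := by
  rw [dist_eq_norm, dist_eq_norm, ← pow_le_pow_iff_left₀ (norm_nonneg _) (norm_nonneg _) two_ne_zero,
    show x - c' = (x - c) - (c' - c) by abel, norm_sub_sq_real (x - c)]
  constructor <;> intro h <;> linarith

lemma dist_eq_dist_iff (x c c' : Plane) :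
    dist x c = dist x c' ↔ 2 * inner ℝ (x - c) (c' - c) = ‖c' - c‖ ^ 2 := by
  rw [dist_eq_norm, dist_eq_norm, ← pow_left_inj₀ (norm_nonneg _) (norm_nonneg _) two_ne_zero,
    show x - c' = (x - c) - (c' - c) by abel, norm_sub_sq_real (x - c)]
  constructor <;> intro h <;> linarith

lemma isClosed_cell (C : Finset Plane) (c : Plane) : IsClosed (cell C c) := by
  have : cell C c = ⋂ d ∈ C, {x : Plane | dist x c ≤ dist x d} := by ext; simp [cell]
  rw [this]
  exact isClosed_biInter fun d _ => isClosed_le (by fun_prop) (by fun_prop)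

lemma dist_eq_of_mem_cell {C : Finset Plane} {c c' x : Plane} (hc : c ∈ C) (hc' : c' ∈ C)
    (h : x ∈ cell C c) (h' : x ∈ cell C c') : dist x c = dist x c' :=
  le_antisymm (h c' hc') (h' c hc)

lemma inner_nonpos_of_mem_cell {C : Finset Plane} {c a v y : Plane} (hc : c ∈ C) (ha : a ∈ C)
    (hv : v ∈ cell C c) (hv' : v ∈ cell C a) (hy : y ∈ cell C c) :
    inner ℝ (y - v) (a - c) ≤ 0 := by
  have h1 := (dist_eq_dist_iff v c a).1 (dist_eq_of_mem_cell hc ha hv hv')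
  have h2 := (dist_le_dist_iff y c a).1 (hy a ha)
  rw [show y - v = (y - c) - (v - c) by abel, inner_sub_left]
  linarith

/-- The three points lie on a circle about `v` and on a line through `c`; such a line meets the
circle in at most one point other than `c`. -/
lemma eq_of_rot_inner_eq_zero {v a b c : Plane} (h1 : dist v c = dist v a)
    (h2 : dist v c = dist v b) (ha : a ≠ c) (hb : b ≠ c)
    (h : inner ℝ (rot (a - c)) (b - c) = 0) : a = b := by
  rw [dist_eq_dist_iff] at h1 h2
  rw [← sub_eq_zero, ← norm_eq_zero, ← sq_eq_zero_iff]
  have na : 0 < ‖a - c‖ ^ 2 := by have := norm_pos_iff.2 (sub_ne_zero.2 ha); positivity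
  have nb : 0 < ‖b - c‖ ^ 2 := by have := norm_pos_iff.2 (sub_ne_zero.2 hb); positivity
  rw [show a - b = (a - c) - (b - c) by abel, norm_sub_sq_real]
  set x := a - c
  set y := b - c
  set q := v - c
  have e1 : ‖x‖ ^ 2 * ‖y‖ ^ 2 = ‖x‖ ^ 2 * inner ℝ x y := by
    have : ‖x‖ ^ 2 * inner ℝ q y = inner ℝ x y * inner ℝ q x +
        inner ℝ (rot x) y * (q 1 * x 0 - q 0 * x 1) := by
      simp only [norm_sq_eq, inner_eq, rot_zero, rot_one]; ring
    rw [h] at this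
    linear_combination -‖x‖ ^ 2 * h2 + 2 * this + inner ℝ x y * h1
  have e2 : ‖y‖ ^ 2 * ‖x‖ ^ 2 = ‖y‖ ^ 2 * inner ℝ x y := by
    have : ‖y‖ ^ 2 * inner ℝ q x = inner ℝ x y * inner ℝ q y +
        inner ℝ (rot x) y * (q 0 * y 1 - q 1 * y 0) := by
      simp only [norm_sq_eq, inner_eq, rot_zero, rot_one]; ring
    rw [h] at this
    linear_combination -‖y‖ ^ 2 * h1 + 2 * this + inner ℝ x y * h2
  have f1 := mul_left_cancel₀ na.ne' e1
  have f2 := mul_left_cancel₀ nb.ne' e2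
  linarith

/-- The Voronoi cells of `c` and `c'` share a nondegenerate edge. -/
def Neighbor (C : Finset Plane) (c c' : Plane) : Prop :=
  c' ≠ c ∧ (cell C c ∩ cell C c').Nontrivial

open Classical in
/-- The points of `C` that are nearest to `v`. -/
noncomputable def nearest (C : Finset Plane) (v : Plane) : Finset Plane :=
  C.filter fun c => v ∈ cell C c

lemma mem_nearest {C : Finset Plane} {v c : Plane} :
    c ∈ nearest C v ↔ c ∈ C ∧ v ∈ cell C c := by
  classical simp [nearest]

lemma eq_smul_rot {x w : Plane} (hw : w ≠ 0) (h : inner ℝ x w = 0) :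
    x = (inner ℝ x (rot w) / ‖w‖ ^ 2) • rot w := by
  have hn : ‖w‖ ^ 2 ≠ 0 := by have := norm_ne_zero_iff.2 hw; positivity
  have hn' := hn
  rw [norm_sq_eq] at hn'
  rw [inner_eq] at h
  refine plane_ext ?_ ?_ <;> simp only [PiLp.smul_apply, smul_eq_mul, inner_eq, norm_sq_eq,
    rot_zero, rot_one] <;> field_simp
  · linear_combination w 0 * h
  · linear_combination w 1 * h

lemma inner_rot_self (w : Plane) : inner ℝ (rot w) w = 0 := by
  rw [inner_eq, rot_zero, rot_one]; ring

lemma norm_rot_sq (w : Plane) : ‖rot w‖ ^ 2 = ‖w‖ ^ 2 := by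
  rw [norm_sq_eq, norm_sq_eq, rot_zero, rot_one]; ring

/-- An edge of a bounded cell has an endpoint on its left side, where a third cell meets. -/
lemma exists_left_endpoint {C : Finset Plane} {c c' : Plane} (hc : c ∈ C) (hc' : c' ∈ C)
    (hb : Bornology.IsBounded (cell C c)) (h : Neighbor C c c') :
    ∃ p ∈ cell C c ∩ cell C c', (∃ s : ℝ, 0 < s ∧ p - s • rot (c' - c) ∈ cell C c) ∧
      ∃ c'' ∈ C, c'' ≠ c ∧ c'' ≠ c' ∧ p ∈ cell C c'' := by
  set w := c' - c with hw
  have hw0 : w ≠ 0 := sub_ne_zero.2 h.1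
  have hwn : 0 < ‖w‖ ^ 2 := by have := norm_pos_iff.2 hw0; positivity
  set E := cell C c ∩ cell C c' with hE
  have hcomp : IsCompact E := Metric.isCompact_of_isClosed_isBounded
    ((isClosed_cell C c).inter (isClosed_cell C c')) (hb.subset inter_subset_left)
  -- The left endpoint is the farthest point of the common edge in the direction `rot w`.
  obtain ⟨p, hp, hmax⟩ := hcomp.exists_isMaxOn h.2.nonempty
    (f := fun x => inner ℝ x (rot w)) (by fun_prop)
  refine ⟨p, hp, ?_, ?_⟩
  · obtain ⟨q, hq, hqp⟩ := h.2.exists_ne p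
    have hperp : inner ℝ (p - q) w = 0 := by
      have h1 := (dist_eq_dist_iff p c c').1 (dist_eq_of_mem_cell hc hc' hp.1 hp.2)
      have h2 := (dist_eq_dist_iff q c c').1 (dist_eq_of_mem_cell hc hc' hq.1 hq.2)
      rw [show p - q = (p - c) - (q - c) by abel, inner_sub_left]
      linarith
    have he := eq_smul_rot hw0 hperp
    set s := inner ℝ (p - q) (rot w) / ‖w‖ ^ 2 with hs
    have hs0 : 0 ≤ s := by
      refine div_nonneg ?_ hwn.le
      rw [inner_sub_left, sub_nonneg]
      exact hmax hq
    refine ⟨s, lt_of_le_of_ne hs0 fun h0 => ?_, ?_⟩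
    · rw [← h0, zero_smul, sub_eq_zero] at he
      exact hqp he.symm
    · rw [← he, sub_sub_cancel]; exact hq.1
  -- If no third point were as near, `p` could be moved a little further along `rot w` without
  -- leaving the two cells, against maximality.
  · by_contra hcon
    push Not at hcon
    have hlt : ∀ d ∈ C, d ≠ c → d ≠ c' → dist p c < dist p d := by
      intro d hd hdc hdc'
      refine lt_of_le_of_ne (hp.1 d hd) fun heq => hcon d hd hdc hdc' fun e he => ?_
      rw [← heq]; exact hp.1 e he
    have hev : ∀ᶠ ε : ℝ in 𝓝 0, ∀ d ∈ C, d ≠ c → d ≠ c' →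
        dist (p + ε • rot w) c < dist (p + ε • rot w) d := by
      refine (Filter.eventually_all_finset C).2 fun d hd => ?_
      by_cases hdc : d = c
      · exact Filter.Eventually.of_forall fun _ h => absurd hdc h
      by_cases hdc' : d = c'
      · exact Filter.Eventually.of_forall fun _ _ h => absurd hdc' h
      have hc1 : Continuous fun ε : ℝ => dist (p + ε • rot w) c := by fun_prop
      have hc2 : Continuous fun ε : ℝ => dist (p + ε • rot w) d := by fun_prop
      filter_upwards [hc1.continuousAt.eventually_lt hc2.continuousAt
        (by simpa using hlt d hd hdc hdc')] with ε hε _ _ using hε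
    obtain ⟨ε, hε, hε0⟩ := ((hev.filter_mono nhdsWithin_le_nhds).and
      (self_mem_nhdsWithin : Ioi (0 : ℝ) ∈ 𝓝[>] 0)).exists
    have heq : dist (p + ε • rot w) c = dist (p + ε • rot w) c' := by
      have h1 := (dist_eq_dist_iff p c c').1 (dist_eq_of_mem_cell hc hc' hp.1 hp.2)
      rw [dist_eq_dist_iff, show p + ε • rot w - c = (p - c) + ε • rot w by abel, inner_add_left,
        real_inner_smul_left, inner_rot_self, mul_zero, add_zero, h1]
    have hmem : p + ε • rot w ∈ E := by
      have : p + ε • rot w ∈ cell C c := by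
        intro d hd
        by_cases hdc : d = c
        · rw [hdc]
        by_cases hdc' : d = c'
        · rw [hdc']; exact heq.le
        exact (hε d hd hdc hdc').le
      exact ⟨this, fun d hd => heq ▸ this d hd⟩
    have h1 : inner ℝ (p + ε • rot w) (rot w) ≤ inner ℝ p (rot w) := hmax hmem
    rw [inner_add_left, real_inner_smul_left, real_inner_self_eq_norm_sq, norm_rot_sq] at h1
    nlinarith [mul_pos (show 0 < ε from hε0) hwn]

/-- The half-plane of each edge contains a point of the other edge to the right of `p`. This bounds
the cross product of `a - c` and `b - c` from both sides, so it vanishes and the two edges coincide.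
-/
lemma left_endpoint_injective {C : Finset Plane} {c a b p : Plane} (hc : c ∈ C) (ha : a ∈ C)
    (hb : b ∈ C) (hac : a ≠ c) (hbc : b ≠ c) (hp : p ∈ cell C c) (hpa : p ∈ cell C a)
    (hpb : p ∈ cell C b) {s t : ℝ} (hs : 0 < s) (ht : 0 < t)
    (hsa : p - s • rot (a - c) ∈ cell C c) (htb : p - t • rot (b - c) ∈ cell C c) : a = b := by
  refine eq_of_rot_inner_eq_zero (dist_eq_of_mem_cell hc ha hp hpa)
    (dist_eq_of_mem_cell hc hb hp hpb) hac hbc ?_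
  have h1 := inner_nonpos_of_mem_cell hc hb hp hpb hsa
  have h2 := inner_nonpos_of_mem_cell hc ha hp hpa htb
  rw [sub_sub_cancel_left, inner_neg_left, real_inner_smul_left] at h1 h2
  have e : inner ℝ (rot (b - c)) (a - c) = -inner ℝ (rot (a - c)) (b - c) := by
    simp only [inner_eq, rot_zero, rot_one]; ring
  rw [e] at h2
  refine le_antisymm ?_ ?_ <;> by_contra hh <;> push Not at hh
  · nlinarith [mul_pos ht hh]
  · nlinarith [mul_pos hs (neg_pos.2 hh)]

/-- Each pair of distinct points rules out only a null set of directions. -/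
lemma exists_dir_injOn (C : Finset Plane) :
    ∃ θ : ℝ, ∀ a ∈ C, ∀ b ∈ C, inner ℝ a (dir θ) = inner ℝ b (dir θ) → a = b := by
  by_contra! h
  have hu : (univ : Set ℝ) ⊆ ⋃ a ∈ C, ⋃ b ∈ C, {θ | a ≠ b ∧ inner ℝ (dir θ) (a - b) = 0} := by
    intro θ _
    obtain ⟨a, ha, b, hb, he, hne⟩ := h θ
    simp only [mem_iUnion]
    refine ⟨a, ha, b, hb, hne, ?_⟩
    rw [inner_sub_right, real_inner_comm, he, real_inner_comm, sub_self]
  have h0 : volume (univ : Set ℝ) = 0 := by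
    refine measure_mono_null hu ?_
    refine (measure_biUnion_null_iff C.countable_toSet).2 fun a _ =>
      (measure_biUnion_null_iff C.countable_toSet).2 fun b _ => ?_
    by_cases hab : a = b
    · simp [hab]
    · exact measure_mono_null (fun θ hθ => hθ.2)
        (volume_setOf_inner_dir_eq_zero (sub_ne_zero.2 hab))
  simp at h0

/-- If `c` lies strictly between two other points nearest to `v` in the direction of `w`, then `v`
is the unique extreme point of the cell of `c` in one of the two directions orthogonal to `w`. -/
lemma extreme_of_between {C : Finset Plane} {v a b c w : Plane} (hw : ‖w‖ = 1) (hc : c ∈ C)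
    (ha : a ∈ C) (hb : b ∈ C) (hvc : v ∈ cell C c) (hva : v ∈ cell C a) (hvb : v ∈ cell C b)
    (hac : inner ℝ a w < inner ℝ c w) (hcb : inner ℝ c w < inner ℝ b w) :
    ((∀ y ∈ cell C c, inner ℝ (y - v) (rot w) ≤ 0) ∨
      (∀ y ∈ cell C c, 0 ≤ inner ℝ (y - v) (rot w))) ∧
    ∀ y ∈ cell C c, inner ℝ (y - v) (rot w) = 0 → y = v := by
  have hw0 : w ≠ 0 := norm_ne_zero_iff.1 (by rw [hw]; norm_num)
  set α := inner ℝ b w - inner ℝ c w with hα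
  set β := inner ℝ c w - inner ℝ a w with hβ
  have hα0 : 0 < α := sub_pos.2 hcb
  have hβ0 : 0 < β := sub_pos.2 hac
  -- With these positive weights the combination is a multiple `τ` of `rot w`. The cell lies in the
  -- half-planes `⟨y - v, a - c⟩ ≤ 0` and `⟨y - v, b - c⟩ ≤ 0`, so `τ ⟨y - v, rot w⟩ ≤ 0` on it.
  -- Three distinct points on a circle are not collinear, hence `τ ≠ 0`, and equality forces `y =
  -- v`.
  have hperp : inner ℝ (α • (a - c) + β • (b - c)) w = 0 := by
    rw [inner_add_left, real_inner_smul_left, real_inner_smul_left, inner_sub_left, inner_sub_left]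
    ring
  have hz := eq_smul_rot hw0 hperp
  set τ := inner ℝ (α • (a - c) + β • (b - c)) (rot w) / ‖w‖ ^ 2
  have hA : ∀ y ∈ cell C c, inner ℝ (y - v) (a - c) ≤ 0 := fun y hy =>
    inner_nonpos_of_mem_cell hc ha hvc hva hy
  have hB : ∀ y ∈ cell C c, inner ℝ (y - v) (b - c) ≤ 0 := fun y hy =>
    inner_nonpos_of_mem_cell hc hb hvc hvb hy
  have hcross : inner ℝ (rot (a - c)) (b - c) ≠ 0 := by
    intro h0
    have : a = b := eq_of_rot_inner_eq_zero (dist_eq_of_mem_cell hc ha hvc hva)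
      (dist_eq_of_mem_cell hc hb hvc hvb) (by rintro rfl; exact hac.false)
      (by rintro rfl; exact hcb.false) h0
    rw [this] at hac
    exact (hac.trans hcb).false
  have hτ : ∀ y, α * inner ℝ (y - v) (a - c) + β * inner ℝ (y - v) (b - c) =
      τ * inner ℝ (y - v) (rot w) := by
    intro y
    rw [← real_inner_smul_right, ← real_inner_smul_right, ← real_inner_smul_right, ← hz,
      inner_add_right]
  have hle : ∀ y ∈ cell C c, τ * inner ℝ (y - v) (rot w) ≤ 0 := by
    intro y hy
    rw [← hτ]
    nlinarith [mul_nonneg hα0.le (neg_nonneg.2 (hA y hy)),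
      mul_nonneg hβ0.le (neg_nonneg.2 (hB y hy))]
  have hτ0 : τ ≠ 0 := by
    intro h0
    rw [h0, zero_smul] at hz
    apply hcross
    have e0 : α * (a - c) 0 + β * (b - c) 0 = 0 := by
      exact congrArg (fun z : Plane => z 0) hz
    have e1 : α * (a - c) 1 + β * (b - c) 1 = 0 := by
      exact congrArg (fun z : Plane => z 1) hz
    refine (mul_eq_zero.1 (?_ : β * _ = 0)).resolve_left hβ0.ne'
    rw [inner_eq, rot_zero, rot_one]
    linear_combination (a - c) 0 * e1 - (a - c) 1 * e0
  refine ⟨?_, ?_⟩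
  · rcases lt_or_gt_of_ne hτ0 with hneg | hpos
    · right
      intro y hy
      by_contra hh
      nlinarith [hle y hy, mul_pos_of_neg_of_neg hneg (not_le.1 hh)]
    · left
      intro y hy
      by_contra hh
      nlinarith [hle y hy, mul_pos hpos (not_le.1 hh)]
  · intro y hy h0
    have h1 := hτ y
    rw [h0, mul_zero] at h1
    have i1 := hA y hy
    have i2 := hB y hy
    have z1 : inner ℝ (y - v) (a - c) = 0 := by
      by_contra hne
      nlinarith [mul_pos hα0 (neg_pos.2 (lt_of_le_of_ne i1 hne)), mul_nonneg hβ0.le (neg_nonneg.2 i2)]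
    have z2 : inner ℝ (y - v) (b - c) = 0 := by
      rw [z1, mul_zero, zero_add] at h1
      exact (mul_eq_zero.1 h1).resolve_left hβ0.ne'
    rw [inner_eq] at z1 z2
    rw [inner_eq, rot_zero, rot_one] at hcross
    rw [← sub_eq_zero]
    refine plane_ext ?_ ?_
    · refine (mul_eq_zero.1 (?_ : (y - v) 0 * _ = 0)).resolve_right hcross
      linear_combination -(a - c) 1 * z2 + (b - c) 1 * z1
    · refine (mul_eq_zero.1 (?_ : (y - v) 1 * _ = 0)).resolve_right hcross
      linear_combination (a - c) 0 * z2 - (b - c) 0 * z1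

/-- Euler's bound: the Delaunay polygons of `n` points amount to at most `2 n` triangles. -/
lemma sum_card_nearest_sub_two_le (C F : Finset Plane) :
    ∑ v ∈ F, ((nearest C v).card - 2) ≤ 2 * C.card := by
  classical
  obtain ⟨θ, hθ⟩ := exists_dir_injOn C
  set w := dir θ
  -- In a generic direction all nearest points except the lowest and the highest lie strictly
  -- between two others. For each of these, `v` is the unique extreme point of its cell at one of
  -- the two ends orthogonal to `w`.
  set mid : Plane → Finset Plane := fun v => (nearest C v).filter fun c =>
    ∃ a ∈ nearest C v, ∃ b ∈ nearest C v, inner ℝ a w < inner ℝ c w ∧ inner ℝ c w < inner ℝ b w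
    with hmid
  have hcard : ∀ v, (nearest C v).card - 2 ≤ (mid v).card := by
    intro v
    rcases (nearest C v).eq_empty_or_nonempty with he | hne
    · simp [he]
    obtain ⟨a, ha, hamin⟩ := (nearest C v).exists_min_image (fun x => inner ℝ x w) hne
    obtain ⟨b, hb, hbmax⟩ := (nearest C v).exists_max_image (fun x => inner ℝ x w) hne
    have hsub : nearest C v ⊆ insert a (insert b (mid v)) := by
      intro c hc
      rw [Finset.mem_insert, Finset.mem_insert]
      by_cases hca : c = a
      · exact Or.inl hca
      by_cases hcb : c = b
      · exact Or.inr (Or.inl hcb)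
      refine Or.inr (Or.inr (Finset.mem_filter.2 ⟨hc, a, ha, b, hb, ?_, ?_⟩))
      · exact lt_of_le_of_ne (hamin c hc) fun h =>
          hca (hθ a (mem_nearest.1 ha).1 c (mem_nearest.1 hc).1 h).symm
      · exact lt_of_le_of_ne (hbmax c hc) fun h =>
          hcb (hθ c (mem_nearest.1 hc).1 b (mem_nearest.1 hb).1 h)
    have h1 := Finset.card_le_card hsub
    have h2 := Finset.card_insert_le a (insert b (mid v))
    have h3 := Finset.card_insert_le b (mid v)
    omega
  have hext : ∀ v, ∀ c ∈ mid v, c ∈ C ∧ v ∈ cell C c ∧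
      (((∀ y ∈ cell C c, inner ℝ (y - v) (rot w) ≤ 0) ∨
      (∀ y ∈ cell C c, 0 ≤ inner ℝ (y - v) (rot w))) ∧
      ∀ y ∈ cell C c, inner ℝ (y - v) (rot w) = 0 → y = v) := by
    intro v c hc
    obtain ⟨hc, a, ha, b, hb, h1, h2⟩ := Finset.mem_filter.1 hc
    rw [mem_nearest] at hc ha hb
    exact ⟨hc.1, hc.2, extreme_of_between (norm_dir θ) hc.1 ha.1 hb.1 hc.2 ha.2 hb.2 h1 h2⟩
  calc ∑ v ∈ F, ((nearest C v).card - 2) ≤ ∑ v ∈ F, (mid v).card :=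
        Finset.sum_le_sum fun v _ => hcard v
    _ = (F.sigma mid).card := (Finset.card_sigma _ _).symm
    _ ≤ (C ×ˢ (Finset.univ : Finset Bool)).card := by
        -- The Boolean records the end of the cell at which `v` is extreme. A cell has at most one
        -- such point at each end, which gives the factor `2`.
        refine Finset.card_le_card_of_injOn (fun x => (x.2,
          decide (∀ y ∈ cell C x.2, inner ℝ (y - x.1) (rot w) ≤ 0))) ?_ ?_
        · intro x hx
          have hx' := (Finset.mem_sigma.1 hx).2
          exact Finset.mem_product.2 ⟨(hext _ _ hx').1, Finset.mem_univ _⟩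
        · rintro ⟨v, c⟩ hx ⟨v', c'⟩ hx' he
          obtain ⟨hcc, hdec⟩ := Prod.mk.inj he
          obtain rfl : c = c' := hcc
          obtain ⟨-, hv, hor, huniq⟩ := hext _ _ (Finset.mem_sigma.1 hx).2
          obtain ⟨-, hv', hor', -⟩ := hext _ _ (Finset.mem_sigma.1 hx').2
          rw [decide_eq_decide] at hdec
          have hanti : inner ℝ (v - v') (rot w) = -inner ℝ (v' - v) (rot w) := by
            rw [← inner_neg_left, neg_sub]
          have hz : inner ℝ (v' - v) (rot w) = 0 := by
            by_cases hP : ∀ y ∈ cell C c, inner ℝ (y - v) (rot w) ≤ 0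
            · have h1 := hP v' hv'
              have h2 := hdec.1 hP v hv
              simp only at h1 h2 hanti
              linarith
            · have h1 := hor.resolve_left hP v' hv'
              have h2 := hor'.resolve_left (fun h => hP (hdec.2 h)) v hv
              simp only at h1 h2 hanti
              linarith
          have : v' = v := huniq v' hv' hz
          subst this; rfl
    _ = 2 * C.card := by simp [mul_comm]

open Classical in
/-- The bounded Voronoi cells of `n` points have at most `6 n` edges. -/
lemma sum_card_neighbor_le (C I : Finset Plane) (hI : I ⊆ C)
    (hb : ∀ c ∈ I, Bornology.IsBounded (cell C c)) :
    ∑ c ∈ I, (C.filter (Neighbor C c)).card ≤ 6 * C.card := by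
  set E : Finset (Σ _ : Plane, Plane) := I.sigma fun c => C.filter (Neighbor C c) with hE
  have hex : ∀ e ∈ E, ∃ p ∈ cell C e.1 ∩ cell C e.2,
      (∃ s : ℝ, 0 < s ∧ p - s • rot (e.2 - e.1) ∈ cell C e.1) ∧
      ∃ c'' ∈ C, c'' ≠ e.1 ∧ c'' ≠ e.2 ∧ p ∈ cell C c'' := by
    intro e he
    obtain ⟨h1, h2⟩ := Finset.mem_sigma.1 he
    obtain ⟨h2, h3⟩ := Finset.mem_filter.1 h2
    exact exists_left_endpoint (hI h1) h2 (hb _ h1) h3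
  choose! P hP1 hP2 hP3 using hex
  set F := E.image P with hF
  have hmemE : ∀ e ∈ E, e.1 ∈ C ∧ e.2 ∈ C ∧ e.2 ≠ e.1 := by
    intro e he
    obtain ⟨h1, h2⟩ := Finset.mem_sigma.1 he
    obtain ⟨h2, h3⟩ := Finset.mem_filter.1 h2
    exact ⟨hI h1, h2, h3.1⟩
  have hthree : ∀ v ∈ F, 3 ≤ (nearest C v).card := by
    intro v hv
    obtain ⟨e, he, rfl⟩ := Finset.mem_image.1 hv
    obtain ⟨c, hc, hc1, hc2, hpc⟩ := hP3 e he
    obtain ⟨m1, m2, m3⟩ := hmemE e he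
    have hsub : ({e.1, e.2, c} : Finset Plane) ⊆ nearest C (P e) := by
      intro x hx
      simp only [Finset.mem_insert, Finset.mem_singleton] at hx
      rw [mem_nearest]
      rcases hx with rfl | rfl | rfl
      · exact ⟨m1, (hP1 e he).1⟩
      · exact ⟨m2, (hP1 e he).2⟩
      · exact ⟨hc, hpc⟩
    rw [← Finset.card_eq_three.2 ⟨e.1, e.2, c, m3.symm, hc1.symm, hc2.symm, rfl⟩]
    exact Finset.card_le_card hsub
  calc ∑ c ∈ I, (C.filter (Neighbor C c)).card = E.card := (Finset.card_sigma _ _).symm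
    -- An edge of a cell is determined by the cell and the left endpoint.
    _ ≤ (F.sigma (nearest C)).card := by
        refine Finset.card_le_card_of_injOn (fun e => ⟨P e, e.1⟩) ?_ ?_
        · intro e he
          exact Finset.mem_sigma.2 ⟨Finset.mem_image_of_mem P he,
            mem_nearest.2 ⟨(hmemE e he).1, (hP1 e he).1⟩⟩
        · rintro ⟨c, a⟩ he ⟨c', b⟩ he' heq
          obtain ⟨hpe, hcc⟩ := Sigma.mk.inj heq
          obtain rfl : c = c' := eq_of_heq hcc
          obtain ⟨s, hs, hsm⟩ := hP2 _ he
          obtain ⟨t, ht, htm⟩ := hP2 _ he'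
          obtain ⟨m1, m2, m3⟩ := hmemE _ he
          obtain ⟨-, m2', m3'⟩ := hmemE _ he'
          have q1 := hP1 _ he
          have q2 := hP1 _ he'
          rw [← hpe] at htm q2
          have : a = b := left_endpoint_injective m1 m2 m2' m3 m3' q1.1 q1.2 q2.2 hs ht hsm htm
          rw [this]
    _ = ∑ v ∈ F, (nearest C v).card := Finset.card_sigma _ _
    -- At least three cells meet at a left endpoint, and `d ≤ 3 (d - 2)` for `d ≥ 3`.
    _ ≤ ∑ v ∈ F, 3 * ((nearest C v).card - 2) := Finset.sum_le_sum fun v hv => by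
        have := hthree v hv; omega
    _ = 3 * ∑ v ∈ F, ((nearest C v).card - 2) := by rw [Finset.mul_sum]
    _ ≤ 6 * C.card := by
        have := sum_card_nearest_sub_two_le C F; omega


/-! ### The Lagrangian bound summed over Voronoi cells -/

/-- The dual vector of the bisector of `c` and `c'`, seen from `c`. -/
noncomputable def dualVec (c c' : Plane) : Plane := (2 / ‖c' - c‖ ^ 2) • (c' - c)

lemma inner_dualVec (x c c' : Plane) :
    inner ℝ (x - c) (dualVec c c') = 2 * inner ℝ (x - c) (c' - c) / ‖c' - c‖ ^ 2 := by
  rw [dualVec, real_inner_smul_right]; ring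

lemma norm_sub_sq_pos {c c' : Plane} (h : c' ≠ c) : 0 < ‖c' - c‖ ^ 2 := by
  have := norm_pos_iff.2 (sub_ne_zero.2 h); positivity

open Classical in
lemma mem_cell_iff_mem_polygon {C : Finset Plane} {c x : Plane} :
    x ∈ cell C c ↔ x - c ∈ polygon ((C.erase c).image (dualVec c)) := by
  simp only [cell, polygon, mem_ofPred_eq, Finset.mem_image, Finset.mem_erase]
  constructor
  · rintro h _ ⟨c', ⟨hne, hc'⟩, rfl⟩
    rw [inner_dualVec, div_le_one (norm_sub_sq_pos hne)]
    exact (dist_le_dist_iff x c c').1 (h c' hc')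
  · intro h c' hc'
    by_cases hne : c' = c
    · rw [hne]
    have := h _ ⟨c', ⟨hne, hc'⟩, rfl⟩
    rw [inner_dualVec, div_le_one (norm_sub_sq_pos hne)] at this
    exact (dist_le_dist_iff x c c').2 this

-- After moving `c` to the origin, the cell is a polygon whose dual vectors come from bisectors. A
-- nondegenerate edge on the bisector with `c'` makes `c'` a neighbour, so the neighbours bound the
-- number of edges.
open Classical in
lemma cell_lagrangian_le (p : EdgeData) {C : Finset Plane} {c : Plane}
    (hb : Bornology.IsBounded (cell C c)) :
    volume.real (cell C c ∩ Metric.closedBall c p.r) - p.lam * volume.real (cell C c) ≤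
      2 * p.A * (C.filter (Neighbor C c)).card + 2 * Real.pi * p.B := by
  set D := (C.erase c).image (dualVec c) with hD
  have hcell : cell C c = (fun x => x + -c) ⁻¹' polygon D := by
    ext x
    rw [mem_cell_iff_mem_polygon, mem_preimage, sub_eq_add_neg]
  have hball : cell C c ∩ Metric.closedBall c p.r =
      (fun x => x + -c) ⁻¹' (polygon D ∩ Metric.closedBall 0 p.r) := by
    rw [preimage_inter, ← hcell]
    congr 1
    ext x
    rw [mem_preimage, mem_closedBall_zero_iff, Metric.mem_closedBall, dist_eq_norm, sub_eq_add_neg]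
  have hbD : Bornology.IsBounded (polygon D) := by
    have : polygon D = (fun x => x + -c) '' cell C c := by
      rw [hcell]
      exact (image_preimage_eq _ (Equiv.addRight (-c)).surjective).symm
    rw [this]
    obtain ⟨K, hK⟩ := hb.exists_norm_le
    refine isBounded_iff_forall_norm_le.2 ⟨K + ‖c‖, ?_⟩
    rintro _ ⟨x, hx, rfl⟩
    have := norm_add_le x (-c)
    rw [norm_neg] at this
    linarith [hK x hx]
  have hne : D.Nonempty := by
    by_contra he
    rw [Finset.not_nonempty_iff_eq_empty] at he
    have : polygon D = univ := by ext; simp [polygon, he]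
    rw [this] at hbD
    exact NormedSpace.unbounded_univ ℝ Plane hbD
  have key := polygon_lagrangian_le hne p hbD
  rw [hball, hcell, measureReal_def, measureReal_def, measure_preimage_add_right,
    measure_preimage_add_right, ← measureReal_def, ← measureReal_def]
  refine key.trans ?_
  have hcard : {d | d ∈ D ∧ IsEdge D d}.ncard ≤ (C.filter (Neighbor C c)).card := by
    rw [← Set.ncard_coe_finset]
    refine (Set.ncard_le_ncard ?_ ((C.filter (Neighbor C c)).finite_toSet.image (dualVec c))).trans
      (Set.ncard_image_le (Finset.finite_toSet _))
    rintro d ⟨hd, x, hx, y, hy, hxy, hxd, hyd⟩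
    obtain ⟨c', hc', rfl⟩ := Finset.mem_image.1 hd
    obtain ⟨hne', hc'C⟩ := Finset.mem_erase.1 hc'
    refine ⟨c', Finset.mem_coe.2 (Finset.mem_filter.2 ⟨hc'C, hne', ?_⟩), rfl⟩
    have hmem : ∀ z ∈ polygon D, inner ℝ z (dualVec c c') = 1 →
        z + c ∈ cell C c ∩ cell C c' := by
      intro z hz hzd
      have h1 : z + c ∈ cell C c := by
        rw [mem_cell_iff_mem_polygon, add_sub_cancel_right]; exact hz
      refine ⟨h1, fun e he => ?_⟩
      have heq : dist (z + c) c = dist (z + c) c' := by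
        rw [dist_eq_dist_iff]
        have h2 : inner ℝ (z + c - c) (dualVec c c') = 1 := by rw [add_sub_cancel_right, hzd]
        rwa [inner_dualVec, div_eq_one_iff_eq (norm_sub_sq_pos hne').ne'] at h2
      exact heq ▸ h1 e he
    exact ⟨x + c, hmem x hx hxd, y + c, hmem y hy hyd, fun h => hxy (add_right_cancel h)⟩
  have h1 : ({d | d ∈ D ∧ IsEdge D d}.ncard : ℝ) ≤ (C.filter (Neighbor C c)).card := by
    exact_mod_cast hcard
  have := p.A_nonneg
  gcongr

lemma sum_cell_lagrangian_le (p : EdgeData) (C I : Finset Plane) (hI : I ⊆ C)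
    (hb : ∀ c ∈ I, Bornology.IsBounded (cell C c)) :
    ∑ c ∈ I, (volume.real (cell C c ∩ Metric.closedBall c p.r) - p.lam * volume.real (cell C c)) ≤
      C.card * (12 * p.A + 2 * Real.pi * p.B) := by
  classical
  have h6 : (∑ c ∈ I, ((C.filter (Neighbor C c)).card : ℝ)) ≤ 6 * C.card := by
    exact_mod_cast sum_card_neighbor_le C I hI hb
  have hIC : (I.card : ℝ) ≤ C.card := by exact_mod_cast Finset.card_le_card hI
  have hA := p.A_nonneg
  have hB := mul_pos Real.pi_pos p.B_pos
  calc _ ≤ ∑ c ∈ I, (2 * p.A * (C.filter (Neighbor C c)).card + 2 * Real.pi * p.B) :=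
        Finset.sum_le_sum fun c hc => cell_lagrangian_le p (hb c hc)
    _ = 2 * p.A * (∑ c ∈ I, ((C.filter (Neighbor C c)).card : ℝ)) +
          I.card * (2 * (Real.pi * p.B)) := by
        rw [Finset.sum_add_distrib, Finset.mul_sum, Finset.sum_const, nsmul_eq_mul]; ring
    _ ≤ 2 * p.A * (6 * C.card) + C.card * (2 * (Real.pi * p.B)) := by gcongr
    _ = _ := by ring

/-! ### The regular hexagon -/

lemma dir_add_int_mul_two_pi (θ : ℝ) (q : ℤ) : dir (θ + q * (2 * Real.pi)) = dir θ := by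
  refine plane_ext ?_ ?_ <;> simp [Real.cos_add_int_mul_two_pi, Real.sin_add_int_mul_two_pi]

lemma exists_nat_lt_six (j : ℤ) : ∃ k : ℕ, k < 6 ∧
    ∀ θ, dir (θ + j * (Real.pi / 3)) = dir (θ + k * (Real.pi / 3)) := by
  refine ⟨(j % 6).toNat, by omega, fun θ => ?_⟩
  have hk : (((j % 6).toNat : ℕ) : ℤ) = j % 6 := Int.toNat_of_nonneg (by omega)
  have hk' : (((j % 6).toNat : ℕ) : ℝ) = ((j % 6 : ℤ) : ℝ) := by rw [← hk]; norm_cast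
  have hj : (j : ℝ) = 6 * ((j / 6 : ℤ) : ℝ) + ((j % 6 : ℤ) : ℝ) := by
    exact_mod_cast (Int.mul_ediv_add_emod j 6).symm
  rw [hk', ← dir_add_int_mul_two_pi (θ + ((j % 6 : ℤ) : ℝ) * (Real.pi / 3)) (j / 6), hj]
  congr 1; ring

/-- Rotating by a multiple of `π / 3` either returns to the same direction or moves the angle at
least `π / 6` away from `0` modulo `2π`. -/
lemma cos_add_int_mul_le {x : ℝ} (hx : |x| ≤ Real.pi / 6) (j : ℤ) :
    Real.cos (x + j * (Real.pi / 3)) ≤ Real.cos x := by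
  have hpi := Real.pi_pos
  obtain ⟨hx1, hx2⟩ := abs_le.1 hx
  have hx0 : Real.cos (Real.pi / 6) ≤ Real.cos x := by
    rw [← Real.cos_abs x]
    exact Real.cos_le_cos_of_nonneg_of_le_pi (abs_nonneg x) (by linarith) hx
  have hle : ∀ y, Real.pi / 6 ≤ y → y ≤ 11 * Real.pi / 6 → Real.cos y ≤ Real.cos (Real.pi / 6) := by
    intro y h1 h2
    rcases le_total y Real.pi with h | h
    · exact Real.cos_le_cos_of_nonneg_of_le_pi (by linarith) h h1
    · rw [← Real.cos_two_pi_sub y]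
      exact Real.cos_le_cos_of_nonneg_of_le_pi (by linarith) (by linarith) (by linarith)
  obtain ⟨k, hk, he⟩ := exists_nat_lt_six j
  have := congrArg (fun z : Plane => z 0) (he x)
  simp only [dir_zero] at this
  rw [this]
  rcases Nat.eq_zero_or_pos k with rfl | hk0
  · simp
  · have h1 : (1 : ℝ) ≤ k := by exact_mod_cast hk0
    have h2 : (k : ℝ) ≤ 5 := by exact_mod_cast Nat.le_of_lt_succ hk
    refine (hle _ ?_ ?_).trans hx0 <;> nlinarith

/-- The inradius of the hexagon. -/
noncomputable def inradius (R : ℝ) : ℝ := R * Real.cos (Real.pi / 6)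

lemma cos_pi_div_six_pos : 0 < Real.cos (Real.pi / 6) :=
  Real.cos_pos_of_mem_Ioo ⟨by linarith [Real.pi_pos], by linarith [Real.pi_pos]⟩

lemma inradius_pos {R : ℝ} (hR : 0 < R) : 0 < inradius R := mul_pos hR cos_pi_div_six_pos

lemma hexVertex_eq (R θ : ℝ) (k : ℕ) : hexVertex R θ k = R • dir (θ + k * (Real.pi / 3)) :=
  plane_ext rfl rfl

lemma smul_dir_mem_hexagon (R θ : ℝ) (j : ℤ) : R • dir (θ + j * (Real.pi / 3)) ∈ hexagon R θ := by
  obtain ⟨k, hk, he⟩ := exists_nat_lt_six j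
  refine subset_convexHull ℝ _ ⟨⟨k, hk⟩, ?_⟩
  simp only [hexVertex_eq, he]

lemma zero_mem_hexagon (R θ : ℝ) : (0 : Plane) ∈ hexagon R θ := by
  have h0 := smul_dir_mem_hexagon R θ 0
  have h3 := smul_dir_mem_hexagon R θ 3
  have := convex_convexHull ℝ _ h0 h3 (by norm_num : (0 : ℝ) ≤ 1 / 2)
    (by norm_num : (0 : ℝ) ≤ 1 / 2) (by norm_num)
  have e : dir (θ + ((3 : ℤ) : ℝ) * (Real.pi / 3)) = -dir θ := by
    have : θ + ((3 : ℤ) : ℝ) * (Real.pi / 3) = θ + Real.pi := by push_cast; ring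
    rw [this]
    refine plane_ext ?_ ?_ <;> simp
  have key : (1 / 2 : ℝ) • R • dir (θ + ((0 : ℤ) : ℝ) * (Real.pi / 3)) +
      (1 / 2 : ℝ) • R • dir (θ + ((3 : ℤ) : ℝ) * (Real.pi / 3)) = 0 := by
    rw [e]; simp
  rw [← key]; exact this

lemma mem_hexagon_iff {R : ℝ} (hR : 0 < R) (θ : ℝ) (x : Plane) :
    x ∈ hexagon R θ ↔
      ∀ j : ℤ, inner ℝ x (dir (θ + Real.pi / 6 + j * (Real.pi / 3))) ≤ inradius R := by
  constructor
  · intro hx j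
    have hc : Convex ℝ {x : Plane |
        inner ℝ x (dir (θ + Real.pi / 6 + j * (Real.pi / 3))) ≤ inradius R} := by
      exact convex_halfSpace_le ⟨fun _ _ => inner_add_left _ _ _,
        fun _ _ => real_inner_smul_left _ _ _⟩ _
    refine convexHull_min ?_ hc hx
    rintro _ ⟨k, rfl⟩
    simp only [mem_ofPred_eq, hexVertex_eq]
    rw [real_inner_smul_left, inner_dir_dir, inradius]
    refine mul_le_mul_of_nonneg_left ?_ hR.le
    have := cos_add_int_mul_le (x := -(Real.pi / 6))
      (by rw [abs_neg, abs_of_pos (by positivity)]) ((k : ℕ) - j)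
    rw [Real.cos_neg] at this
    refine le_trans (le_of_eq ?_) this
    congr 1
    push_cast; ring
  · intro h
    obtain ⟨φ, hφ⟩ := exists_polar x
    have hpi := Real.pi_pos
    -- `j` is the index of the sector between consecutive vertices that contains `x`, and `a`, `b`
    -- below are the coordinates of `x` with respect to these vertices. The inequality for the
    -- normal of this sector is precisely `a + b ≤ 1`.
    set j : ℤ := ⌊(φ - θ) / (Real.pi / 3)⌋ with hj
    set ψ := φ - θ - j * (Real.pi / 3) with hψ
    have hψ0 : 0 ≤ ψ := by
      have := Int.floor_le ((φ - θ) / (Real.pi / 3))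
      rw [← hj, le_div_iff₀ (by positivity)] at this
      linarith
    have hψ1 : ψ ≤ Real.pi / 3 := by
      have := (Int.lt_floor_add_one ((φ - θ) / (Real.pi / 3))).le
      rw [← hj, div_le_iff₀ (by positivity)] at this
      linarith
    have hs : Real.sin (Real.pi / 3) = Real.cos (Real.pi / 6) := by
      rw [← Real.cos_pi_div_two_sub]; congr 1; ring
    have hs0 := cos_pi_div_six_pos
    have hRs : 0 < R * Real.cos (Real.pi / 6) := mul_pos hR hs0
    set a := ‖x‖ * Real.sin (Real.pi / 3 - ψ) / (R * Real.cos (Real.pi / 6)) with ha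
    set b := ‖x‖ * Real.sin ψ / (R * Real.cos (Real.pi / 6)) with hb
    have ha0 : 0 ≤ a := div_nonneg (mul_nonneg (norm_nonneg x)
      (Real.sin_nonneg_of_nonneg_of_le_pi (by linarith) (by linarith))) hRs.le
    have hb0 : 0 ≤ b := div_nonneg (mul_nonneg (norm_nonneg x)
      (Real.sin_nonneg_of_nonneg_of_le_pi (by linarith) (by linarith))) hRs.le
    have hab : a + b ≤ 1 := by
      have h1 := h j
      conv_lhs at h1 => rw [hφ]
      rw [real_inner_smul_left, inner_dir_dir,
        show φ - (θ + Real.pi / 6 + j * (Real.pi / 3)) = ψ - Real.pi / 6 by rw [hψ]; ring,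
        inradius] at h1
      rw [ha, hb, ← add_div, div_le_one hRs]
      refine le_trans (le_of_eq ?_) h1
      rw [Real.sin_sub (Real.pi / 3) ψ, Real.cos_sub ψ, hs, Real.cos_pi_div_three, Real.sin_pi_div_six]; ring
    have hx : x = a • (R • dir (θ + j * (Real.pi / 3))) +
        b • (R • dir (θ + (j + 1 : ℤ) * (Real.pi / 3))) := by
      have hφ' : φ = θ + j * (Real.pi / 3) + ψ := by rw [hψ]; ring
      have e1 : θ + ((j + 1 : ℤ) : ℝ) * (Real.pi / 3) = θ + j * (Real.pi / 3) + Real.pi / 3 := by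
        push_cast; ring
      have hsq : Real.cos (Real.pi / 6) ≠ 0 := hs0.ne'
      conv_lhs => rw [hφ, hφ']
      rw [e1, ha, hb]
      set ω := θ + j * (Real.pi / 3)
      refine plane_ext ?_ ?_
      · simp only [PiLp.add_apply, PiLp.smul_apply, smul_eq_mul, dir_zero, Real.cos_add,
          Real.sin_sub, hs]
        field_simp; ring
      · simp only [PiLp.add_apply, PiLp.smul_apply, smul_eq_mul, dir_one, Real.sin_add,
          Real.sin_sub, hs]
        field_simp; ring
    have hconv : Convex ℝ (hexagon R θ) := convex_convexHull ℝ _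
    have m1 := smul_dir_mem_hexagon R θ j
    have m2 := smul_dir_mem_hexagon R θ (j + 1)
    rcases (add_nonneg ha0 hb0).eq_or_lt with h0 | hpos
    · have : a = 0 := by linarith
      have : b = 0 := by linarith
      rw [hx, ‹a = 0›, ‹b = 0›]
      simpa using zero_mem_hexagon R θ
    · have hy := hconv m1 m2 (div_nonneg ha0 hpos.le) (div_nonneg hb0 hpos.le)
        (by rw [← add_div, div_self hpos.ne'])
      have := hconv.smul_mem_of_zero_mem (zero_mem_hexagon R θ) hy ⟨hpos.le, hab⟩
      convert this using 1
      rw [smul_add, smul_smul _ (a / (a + b)), smul_smul _ (b / (a + b)), mul_div_cancel₀ _ hpos.ne',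
        mul_div_cancel₀ _ hpos.ne']
      exact hx


open Classical in
/-- The dual vectors of the edges of the hexagon. -/
noncomputable def hexDual (R θ : ℝ) : Finset Plane :=
  (Finset.range 6).image fun k : ℕ =>
    (1 / inradius R) • dir (θ + Real.pi / 6 + k * (Real.pi / 3))

lemma hexDual_nonempty (R θ : ℝ) : (hexDual R θ).Nonempty :=
  Finset.Nonempty.image ⟨0, by simp⟩ _

lemma smul_dir_mem_hexDual (R θ : ℝ) (j : ℤ) :
    (1 / inradius R) • dir (θ + Real.pi / 6 + j * (Real.pi / 3)) ∈ hexDual R θ := by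
  obtain ⟨k, hk, he⟩ := exists_nat_lt_six j
  exact Finset.mem_image.2 ⟨k, Finset.mem_range.2 hk, by rw [he]⟩

lemma polygon_hexDual {R : ℝ} (hR : 0 < R) (θ : ℝ) : polygon (hexDual R θ) = hexagon R θ := by
  have hi := inradius_pos hR
  have hiff : ∀ (x : Plane) (ω : ℝ), inner ℝ x ((1 / inradius R) • dir ω) ≤ 1 ↔
      inner ℝ x (dir ω) ≤ inradius R := fun x ω => by
    rw [real_inner_smul_right, one_div_mul_eq_div, div_le_one hi]
  ext x
  rw [mem_hexagon_iff hR]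
  constructor
  · intro h j
    exact (hiff _ _).1 (h _ (smul_dir_mem_hexDual R θ j))
  · intro h d hd
    obtain ⟨k, -, rfl⟩ := Finset.mem_image.1 hd
    exact (hiff _ _).2 (h k)

lemma hexagon_subset_closedBall {R : ℝ} (hR : 0 < R) (θ : ℝ) :
    hexagon R θ ⊆ Metric.closedBall 0 R := by
  refine convexHull_min ?_ (convex_closedBall 0 R)
  rintro _ ⟨k, rfl⟩
  simp only [hexVertex_eq, mem_closedBall_zero_iff, norm_smul, norm_dir, mul_one]
  rw [Real.norm_of_nonneg hR.le]

lemma closedBall_subset_hexagon {R : ℝ} (hR : 0 < R) (θ : ℝ) :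
    Metric.closedBall 0 (inradius R) ⊆ hexagon R θ := by
  intro x hx
  rw [mem_hexagon_iff hR]
  intro j
  refine (real_inner_le_norm _ _).trans ?_
  rw [norm_dir, mul_one]
  exact mem_closedBall_zero_iff.1 hx

lemma isClosed_hexagon {R : ℝ} (hR : 0 < R) (θ : ℝ) : IsClosed (hexagon R θ) := by
  rw [← polygon_hexDual hR]; exact isClosed_polygon _

lemma isBounded_hexagon {R : ℝ} (hR : 0 < R) (θ : ℝ) : Bornology.IsBounded (hexagon R θ) :=
  Metric.isBounded_closedBall.subset (hexagon_subset_closedBall hR θ)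

lemma gaugeMax_hexDual {R : ℝ} (hR : 0 < R) (θ : ℝ) (k : ℕ) {x : ℝ} (hx : |x| ≤ Real.pi / 6) :
    gaugeMax (hexDual R θ) (hexDual_nonempty R θ) (x + (θ + Real.pi / 6 + k * (Real.pi / 3))) =
      Real.cos x / inradius R := by
  have hi := inradius_pos hR
  have hval : ∀ i : ℤ, inner ℝ (dir (x + (θ + Real.pi / 6 + k * (Real.pi / 3))))
      ((1 / inradius R) • dir (θ + Real.pi / 6 + i * (Real.pi / 3))) =
      Real.cos (x + ((k - i : ℤ) : ℝ) * (Real.pi / 3)) / inradius R := by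
    intro i
    rw [real_inner_smul_right, inner_dir_dir, one_div_mul_eq_div]
    congr 2; push_cast; ring
  refine le_antisymm (Finset.sup'_le _ _ fun d hd => ?_) ?_
  · obtain ⟨i, -, rfl⟩ := Finset.mem_image.1 hd
    have := hval i
    rw [Int.cast_natCast] at this
    rw [this]
    exact div_le_div_of_nonneg_right (cos_add_int_mul_le hx _) hi.le
  · have h1 := hval k
    rw [sub_self, Int.cast_zero, zero_mul, add_zero] at h1
    rw [← h1]
    exact Finset.le_sup' (fun d => inner ℝ (dir _) d) (smul_dir_mem_hexDual R θ k)

/-- This is the case of equality. Each edge is at distance `h₀` and is seen under `[-π/6, π/6]`, and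
`arccos (h₀ / R) = π / 6`; it therefore contributes exactly `2 T h₀ = 2A`. -/
lemma hexagon_lagrangian (p : EdgeData) (θ : ℝ) (hp : p.h₀ = inradius p.R) :
    volume.real (hexagon p.R θ ∩ Metric.closedBall 0 p.r) - p.lam * volume.real (hexagon p.R θ) =
      12 * p.A + 2 * Real.pi * p.B := by
  have hR := p.R_pos
  have hpi := Real.pi_pos
  set m := gaugeMax (hexDual p.R θ) (hexDual_nonempty p.R θ) with hm
  have hmpos : ∀ φ, 0 < m φ := gaugeMax_pos _ (by
    rw [polygon_hexDual hR]; exact isBounded_hexagon hR θ)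
  have hmc : Continuous m := continuous_gaugeMax _
  have h := p.area_sub_eq_integral hmc hmpos (isClosed_hexagon hR θ).measurableSet
    (fun φ t ht => by rw [← polygon_hexDual hR]; exact smul_dir_mem_polygon_iff _ ht)
  rw [h]
  congr 1
  set g : ℝ → ℝ := fun φ => p.W (1 / m φ) with hg
  have hgc : Continuous g := p.continuous_W.comp (continuous_const.div hmc fun φ => (hmpos φ).ne')
  have hper : Function.Periodic g (2 * Real.pi) := fun φ => by
    simp only [hg, hm, gaugeMax, dir_add_two_pi]
  have hpiece : ∀ k : ℕ, ∫ φ in (θ + k * (Real.pi / 3))..(θ + (k + 1 : ℕ) * (Real.pi / 3)), g φ =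
      2 * p.A := by
    intro k
    set ω := θ + Real.pi / 6 + k * (Real.pi / 3) with hω
    have h1 : θ + k * (Real.pi / 3) = -(Real.pi / 6) + ω := by rw [hω]; ring
    have h2 : θ + (k + 1 : ℕ) * (Real.pi / 3) = Real.pi / 6 + ω := by rw [hω]; push_cast; ring
    rw [h1, h2, ← intervalIntegral.integral_comp_add_right]
    have hcongr : ∫ x in -(Real.pi / 6)..(Real.pi / 6), g (x + ω) =
        ∫ x in -(Real.pi / 6)..(Real.pi / 6), p.W (p.h₀ / Real.cos x) := by
      refine intervalIntegral.integral_congr fun x hx => ?_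
      rw [uIcc_of_le (by linarith)] at hx
      simp only [hg, hm, hω, gaugeMax_hexDual hR θ k (abs_le.2 hx), one_div_div, hp]
    have harc : Real.arccos (p.h₀ / p.R) = Real.pi / 6 := by
      rw [hp, inradius, mul_div_cancel_left₀ _ hR.ne', Real.arccos_cos (by linarith) (by linarith)]
    have hA := p.integral_W_from_zero p.h₀_pos
    rw [harc] at hA
    rw [hcongr, intervalIntegral.integral_of_le (by linarith), ← integral_Icc_eq_integral_Ioc,
      p.integral_W_symm p.h₀ (by linarith) (by linarith), hA]
    rfl
  have hsum := intervalIntegral.sum_integral_adjacent_intervals (n := 6) (μ := volume) (f := g)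
    (a := fun k : ℕ => θ + k * (Real.pi / 3)) fun k _ => hgc.intervalIntegrable _ _
  simp only [hpiece, Finset.sum_const, Finset.card_range, nsmul_eq_mul] at hsum
  have hshift := hper.intervalIntegral_add_eq (-Real.pi) θ
  rw [show -Real.pi + 2 * Real.pi = Real.pi by ring] at hshift
  rw [← integral_Ioc_eq_integral_Ioo, ← intervalIntegral.integral_of_le (by linarith), hshift]
  have e0 : θ + ((0 : ℕ) : ℝ) * (Real.pi / 3) = θ := by simp
  have e6 : θ + ((6 : ℕ) : ℝ) * (Real.pi / 3) = θ + 2 * Real.pi := by push_cast; ring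
  rw [e0, e6] at hsum
  rw [← hsum]; norm_num; ring

lemma exists_edgeData {R r : ℝ} (hR : 0 < R) (h1 : inradius R < r) (h2 : r < R) :
    ∃ p : EdgeData, p.R = R ∧ p.r = r ∧ p.h₀ = inradius R := by
  have hi := inradius_pos hR
  have hi2 : inradius R ^ 2 = 3 / 4 * R ^ 2 := by
    rw [inradius, Real.cos_pi_div_six, mul_pow, div_pow, Real.sq_sqrt (by norm_num)]; ring
  have hRs : √(R ^ 2 - inradius R ^ 2) = R / 2 := by
    rw [hi2, show R ^ 2 - 3 / 4 * R ^ 2 = (R / 2) ^ 2 by ring, Real.sqrt_sq (by positivity)]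
  set t := √(r ^ 2 - inradius R ^ 2) with ht
  have hpos : 0 < r ^ 2 - inradius R ^ 2 := by nlinarith
  have ht0 : 0 < t := Real.sqrt_pos.2 hpos
  have ht2 : t ^ 2 = r ^ 2 - inradius R ^ 2 := Real.sq_sqrt hpos.le
  have htR : t < R / 2 := by
    rw [ht, ← hRs]
    exact Real.sqrt_lt_sqrt hpos.le (by nlinarith)
  set lam := t / (R / 2) with hlam
  have hl0 : 0 < lam := by positivity
  have hl1 : lam < 1 := (div_lt_one (by positivity)).2 htR
  have hlR : lam * R ^ 2 = 2 * R * t := by rw [hlam]; field_simp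
  -- Since the squared inradius is `3R² / 4`, the expression factors as `(R/2 - t)(3R/2 - t)`.
  have hB : 0 < r ^ 2 - lam * R ^ 2 := by
    rw [hlR]
    nlinarith [mul_pos (sub_pos.2 htR) (by linarith : 0 < 3 * R / 2 - t)]
  have hq : 0 < (r ^ 2 - lam * R ^ 2) / (1 - lam) := div_pos hB (by linarith)
  refine ⟨⟨inradius R, r, R, lam, (r ^ 2 - lam * R ^ 2) / 2,
    √((r ^ 2 - lam * R ^ 2) / (1 - lam)), hi, h1, h2, hl0, hl1, ?_, by ring, ?_,
    Real.sqrt_pos.2 hq⟩, rfl, rfl, rfl⟩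
  · rw [hRs, hlam]; field_simp; rw [ht]
  · rw [Real.sq_sqrt hq.le]
    have : 1 - lam ≠ 0 := by linarith
    field_simp

/-- The Lagrangian form of the moment theorem for a finite set and the bounded cells of some of its
points. -/
lemma sum_cell_lagrangian_le_hexagon {R r : ℝ} (hR : 0 < R) (h1 : inradius R < r) (h2 : r < R)
    (θ : ℝ) : ∃ lam : ℝ, 0 ≤ lam ∧
      0 ≤ volume.real (hexagon R θ ∩ Metric.closedBall 0 r) - lam * volume.real (hexagon R θ) ∧
      ∀ C I : Finset Plane, I ⊆ C → (∀ c ∈ I, Bornology.IsBounded (cell C c)) →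
        ∑ c ∈ I, (volume.real (cell C c ∩ Metric.closedBall c r) - lam * volume.real (cell C c)) ≤
          C.card * (volume.real (hexagon R θ ∩ Metric.closedBall 0 r) -
            lam * volume.real (hexagon R θ)) := by
  obtain ⟨p, rfl, rfl, hp⟩ := exists_edgeData hR h1 h2
  refine ⟨p.lam, p.lam_pos.le, ?_, fun C I hI hb => ?_⟩
  · rw [hexagon_lagrangian p θ hp]
    nlinarith [p.A_nonneg, mul_pos Real.pi_pos p.B_pos]
  · rw [hexagon_lagrangian p θ hp]
    exact sum_cell_lagrangian_le p C I hI hb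


/-! ### Copies on a grid and Fejes Tóth's theorem for a square -/

/-- The square `s × s`. -/
def square (s : Set ℝ) : Set Plane := {x | ∀ i, x i ∈ s}

lemma measurableSet_square {s : Set ℝ} (hs : MeasurableSet s) : MeasurableSet (square s) := by
  have : square s = ⋂ i, (fun x : Plane => x i) ⁻¹' s := by ext; simp [square]
  rw [this]
  exact MeasurableSet.iInter fun i => (by fun_prop : Measurable fun x : Plane => x i) hs

lemma volume_square {s : Set ℝ} (hs : MeasurableSet s) : volume (square s) = volume s ^ 2 := by
  have h := EuclideanSpace.volume_preserving_symm_measurableEquiv_toLp (Fin 2)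
  have hpi : square s = (MeasurableEquiv.toLp 2 (Fin 2 → ℝ)).symm ⁻¹' (univ.pi fun _ => s) := by
    ext x
    simp [square, MeasurableEquiv.coe_toLp_symm]
  rw [hpi, h.measure_preimage (MeasurableSet.univ_pi fun _ => hs).nullMeasurableSet, volume_pi_pi]
  simp

lemma abs_apply_le_norm (x : Plane) (i : Fin 2) : |x i| ≤ ‖x‖ := PiLp.norm_apply_le x i

lemma volume_bisector {c c' : Plane} (h : c ≠ c') : volume {x : Plane | dist x c = dist x c'} = 0 := by
  have : {x : Plane | dist x c = dist x c'} = AffineSubspace.perpBisector c c' := by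
    ext x; exact AffineSubspace.mem_perpBisector_iff_dist_eq.symm
  rw [this]
  exact Measure.addHaar_affineSubspace _ _ (by simpa using h)

lemma aedisjoint_cell {C : Finset Plane} {c c' : Plane} (hc : c ∈ C) (hc' : c' ∈ C) (h : c ≠ c') :
    AEDisjoint volume (cell C c) (cell C c') :=
  measure_mono_null (fun _ hx => dist_eq_of_mem_cell hc hc' hx.1 hx.2) (volume_bisector h)

/-- The cell is an intersection of half-planes that contain `c`. -/
lemma cell_starShaped {C : Finset Plane} {c z : Plane} (hz : z ∈ cell C c) {t : ℝ} (h0 : 0 ≤ t)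
    (h1 : t ≤ 1) : c + t • (z - c) ∈ cell C c := by
  intro c' hc'
  have h := (dist_le_dist_iff z c c').1 (hz c' hc')
  rw [dist_le_dist_iff, add_sub_cancel_left, real_inner_smul_left]
  nlinarith [sq_nonneg ‖c' - c‖, mul_le_mul_of_nonneg_left h h0,
    mul_le_mul_of_nonneg_right h1 (sq_nonneg ‖c' - c‖)]

/-- The point of the square grid with mesh `L` with indices `q`. -/
noncomputable def gridPoint (L : ℝ) (q : ℕ × ℕ) : Plane := !₂[L * q.1, L * q.2]

@[simp] lemma gridPoint_zero (L : ℝ) (q : ℕ × ℕ) : gridPoint L q 0 = L * q.1 := rfl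

@[simp] lemma gridPoint_one (L : ℝ) (q : ℕ × ℕ) : gridPoint L q 1 = L * q.2 := rfl

open Classical in
/-- The union of `M × M` translates of `C`. -/
noncomputable def gridCopies (L : ℝ) (C : Finset Plane) (M : ℕ) : Finset Plane :=
  (C ×ˢ (Finset.range M ×ˢ Finset.range M)).image fun x => x.1 + gridPoint L x.2

lemma card_gridCopies_le (L : ℝ) (C : Finset Plane) (M : ℕ) :
    (gridCopies L C M).card ≤ C.card * M ^ 2 := by
  refine Finset.card_image_le.trans (le_of_eq ?_)
  simp [sq]

lemma add_gridPoint_mem {L : ℝ} {C : Finset Plane} {M : ℕ} {c : Plane} (hc : c ∈ C) {q : ℕ × ℕ}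
    (h1 : q.1 < M) (h2 : q.2 < M) : c + gridPoint L q ∈ gridCopies L C M :=
  Finset.mem_image.2 ⟨(c, q), by simp [hc, h1, h2], rfl⟩

lemma exists_index {L y : ℝ} (hL : 0 < L) {M : ℕ} (hM : 0 < M) (hy : y ∈ Icc 0 (L * M)) :
    ∃ i : ℕ, i < M ∧ |y - L * i| ≤ L := by
  rcases hy.2.lt_or_eq with h | h
  · refine ⟨⌊y / L⌋₊, ?_, ?_⟩
    · rw [Nat.floor_lt (div_nonneg hy.1 hL.le), div_lt_iff₀ hL]; linarith
    · have h1 := Nat.floor_le (div_nonneg hy.1 hL.le)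
      have h2 := (Nat.lt_floor_add_one (y / L)).le
      rw [le_div_iff₀ hL] at h1
      rw [div_le_iff₀ hL] at h2
      rw [abs_le]; constructor <;> linarith
  -- At the closed end `y = L * M` the floor would be the forbidden index `M`; the last index gives
  -- distance exactly `L`.
  · refine ⟨M - 1, by omega, ?_⟩
    have : ((M - 1 : ℕ) : ℝ) = M - 1 := by rw [Nat.cast_sub hM]; simp
    rw [h, this, show L * (M : ℝ) - L * (M - 1) = L by ring, abs_of_pos hL]

lemma exists_gridCopies_near {L : ℝ} (hL : 0 < L) {C : Finset Plane} {c : Plane} (hc : c ∈ C)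
    {M : ℕ} (hM : 0 < M) {y : Plane} (hy : y ∈ square (Icc 0 (L * M))) :
    ∃ p ∈ gridCopies L C M, dist y p ≤ ‖c‖ + 2 * L := by
  obtain ⟨i, hi, hi'⟩ := exists_index hL hM (hy 0)
  obtain ⟨j, hj, hj'⟩ := exists_index hL hM (hy 1)
  refine ⟨_, add_gridPoint_mem hc (q := (i, j)) hi hj, ?_⟩
  have h1 : ‖y - gridPoint L (i, j)‖ ≤ 2 * L := by
    refine le_of_sq_le_sq ?_ (by positivity)
    rw [norm_sq_eq]
    simp only [PiLp.sub_apply, gridPoint_zero, gridPoint_one]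
    have := sq_le_sq' (abs_le.1 hi').1 (abs_le.1 hi').2
    have := sq_le_sq' (abs_le.1 hj').1 (abs_le.1 hj').2
    nlinarith
  rw [dist_eq_norm, show y - (c + gridPoint L (i, j)) = (y - gridPoint L (i, j)) - c by abel]
  linarith [norm_sub_le (y - gridPoint L (i, j)) c]

/-- Every point of the box is within `E` of the copies. A cell that extends beyond distance `E + 1`
from its centre would, being star-shaped, contain a point at distance exactly `E + 1`. That point is
still in the box, since `x` has margin `2E + 1`, and it has a nearer centre. -/
lemma cell_subset_square {L : ℝ} (hL : 0 < L) {C : Finset Plane} {c : Plane} (hc : c ∈ C)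
    {M : ℕ} (hM : 0 < M) {E : ℝ} (hE : E = ‖c‖ + 2 * L) {x p : Plane}
    (hx : x ∈ square (Icc (2 * E + 1) (L * M - (2 * E + 1))))
    (hxp : x ∈ cell (gridCopies L C M) p) :
    cell (gridCopies L C M) p ⊆ square (Icc 0 (L * M)) := by
  have hE0 : 0 ≤ E := by rw [hE]; positivity
  have hdist : dist x p ≤ E := by
    have hx' : x ∈ square (Icc 0 (L * M)) := fun i =>
      ⟨by linarith [(hx i).1], by linarith [(hx i).2]⟩
    obtain ⟨q, hq, hq'⟩ := exists_gridCopies_near hL hc hM hx'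
    rw [hE]; exact (hxp q hq).trans hq'
  have hin : ∀ y : Plane, dist y p ≤ E + 1 → y ∈ square (Icc 0 (L * M)) := by
    intro y hy i
    have h1 : ‖y - x‖ ≤ 2 * E + 1 := by
      rw [← dist_eq_norm]
      linarith [dist_triangle y p x, dist_comm x p]
    have h2 := abs_le.1 ((abs_apply_le_norm (y - x) i).trans h1)
    rw [PiLp.sub_apply] at h2
    exact ⟨by linarith [(hx i).1], by linarith [(hx i).2]⟩
  intro z hz
  refine hin z ?_
  by_contra hlt
  push Not at hlt
  have hd : 0 < dist z p := by linarith
  set t := (E + 1) / dist z p with ht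
  have ht0 : 0 ≤ t := by positivity
  have ht1 : t ≤ 1 := (div_le_one hd).2 hlt.le
  have hy := cell_starShaped hz ht0 ht1
  have hyd : dist (p + t • (z - p)) p = E + 1 := by
    rw [dist_eq_norm, add_sub_cancel_left, norm_smul, Real.norm_of_nonneg ht0, ← dist_eq_norm, ht,
      div_mul_cancel₀ _ hd.ne']
  obtain ⟨q, hq, hq'⟩ := exists_gridCopies_near hL hc hM (hin _ hyd.le)
  have := (hy q hq).trans hq'
  rw [hyd] at this
  linarith

lemma exists_mem_cell {C : Finset Plane} (hC : C.Nonempty) (x : Plane) :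
    ∃ p ∈ C, x ∈ cell C p := by
  obtain ⟨p, hp, h⟩ := C.exists_min_image (fun c => dist x c) hC
  exact ⟨p, hp, h⟩

/-- The part of the square `[0,L)²` that is covered by the discs with radius `r` and centers in
`C`. -/
def covered (L r : ℝ) (C : Finset Plane) : Set Plane :=
  square (Ico 0 L) ∩ ⋃ c ∈ C, Metric.closedBall c r

lemma measurableSet_covered (L r : ℝ) (C : Finset Plane) : MeasurableSet (covered L r C) :=
  (measurableSet_square measurableSet_Ico).inter
    (C.measurableSet_biUnion fun _ _ => Metric.isClosed_closedBall.measurableSet)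

lemma volume_covered_ne_top (L r : ℝ) (C : Finset Plane) : volume (covered L r C) ≠ ∞ := by
  refine ne_top_of_le_ne_top ?_ (measure_mono inter_subset_left)
  rw [volume_square measurableSet_Ico]; simp

/-- The cells inside the box have total area at most `(L M)²`, and their parts within `r` of the
centres include the covered parts of the `(M - 2k)²` inner squares. The hypothesis `hcore`, applied
to all copies at once, compares the two. -/
lemma mul_covered_le {L r lam κ : ℝ} (hL : 0 < L) (hlam : 0 ≤ lam) (hκ : 0 ≤ κ)
    (hcore : ∀ C I : Finset Plane, I ⊆ C → (∀ c ∈ I, Bornology.IsBounded (cell C c)) →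
        ∑ c ∈ I, (volume.real (cell C c ∩ Metric.closedBall c r) - lam * volume.real (cell C c)) ≤
          C.card * κ)
    {C : Finset Plane} {c₀ : Plane} (hc₀ : c₀ ∈ C) {k M : ℕ}
    (hk : 2 * (‖c₀‖ + 2 * L) + 1 ≤ L * k) (hM : 2 * k < M) :
    ((M : ℝ) - 2 * k) ^ 2 * volume.real (covered L r C) ≤
      M ^ 2 * (lam * L ^ 2 + C.card * κ) := by
  classical
  set G := gridCopies L C M with hG
  set box := square (Icc 0 (L * M)) with hbox
  set I := G.filter fun p => cell G p ⊆ box with hI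
  have hM0 : 0 < M := by omega
  have hboxb : Bornology.IsBounded box := by
    refine isBounded_iff_forall_norm_le.2 ⟨2 * (L * M), fun x hx => ?_⟩
    refine le_of_sq_le_sq ?_ (by positivity)
    rw [norm_sq_eq]
    nlinarith [(hx 0).1, (hx 0).2, (hx 1).1, (hx 1).2]
  have hboxv : volume box = ENNReal.ofReal ((L * M) ^ 2) := by
    rw [hbox, volume_square measurableSet_Icc, Real.volume_Icc, sub_zero,
      ENNReal.ofReal_pow (by positivity)]
  have hIb : ∀ p ∈ I, cell G p ⊆ box := fun p hp => (Finset.mem_filter.1 hp).2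
  have hbd : ∀ p ∈ I, Bornology.IsBounded (cell G p) := fun p hp => hboxb.subset (hIb p hp)
  have hfin : ∀ p ∈ I, volume (cell G p) ≠ ∞ := fun p hp => (hbd p hp).measure_lt_top.ne
  have ha := hcore G I (Finset.filter_subset _ _) hbd
  have hcard : (G.card : ℝ) ≤ C.card * M ^ 2 := by exact_mod_cast card_gridCopies_le L C M
  have hb : ∑ p ∈ I, volume.real (cell G p) ≤ (L * M) ^ 2 := by
    have h1 : ∑ p ∈ I, volume (cell G p) ≤ ENNReal.ofReal ((L * M) ^ 2) := by
      rw [← hboxv, ← measure_biUnion_finset₀]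
      · exact measure_mono (iUnion₂_subset hIb)
      · intro p hp q hq hpq
        exact aedisjoint_cell (Finset.mem_filter.1 hp).1 (Finset.mem_filter.1 hq).1 hpq
      · exact fun p _ => (isClosed_cell G p).measurableSet.nullMeasurableSet
    simp only [measureReal_def]
    rw [← ENNReal.toReal_sum hfin]
    exact ENNReal.toReal_le_of_le_ofReal (by positivity) h1
  have hcnt : ((M : ℝ) - 2 * k) ^ 2 * volume.real (covered L r C) ≤
      ∑ p ∈ I, volume.real (cell G p ∩ Metric.closedBall p r) := by
    set N := Finset.Ico k (M - k) ×ˢ Finset.Ico k (M - k) with hN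
    set T : ℕ × ℕ → Set Plane := fun q => (fun x => x + -gridPoint L q) ⁻¹' covered L r C with hT
    have hTv : ∀ q, volume (T q) = volume (covered L r C) := fun q =>
      measure_preimage_add_right _ _ _
    have hTm : ∀ q, MeasurableSet (T q) := fun q =>
      (measurable_add_const _) (measurableSet_covered L r C)
    have hTd : Pairwise (Function.onFun Disjoint T) := by
      intro q q' hqq
      refine Set.disjoint_left.2 fun x hx hx' => hqq ?_
      have key : ∀ (i : Fin 2) (a b : ℕ), gridPoint L q i = L * a → gridPoint L q' i = L * b →
          a = b := by
        intro i a b h1 h2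
        have u := hx.1 i
        have u' := hx'.1 i
        rw [PiLp.add_apply, PiLp.neg_apply] at u u'
        rw [h1] at u
        rw [h2] at u'
        have l1 : L * a < L * (b + 1) := by linarith [u.1, u'.2]
        have l2 : L * b < L * (a + 1) := by linarith [u.2, u'.1]
        have m1 := lt_of_mul_lt_mul_left l1 hL.le
        have m2 := lt_of_mul_lt_mul_left l2 hL.le
        have m1' : a < b + 1 := by exact_mod_cast m1
        have m2' : b < a + 1 := by exact_mod_cast m2
        omega
      exact Prod.ext (key 0 _ _ rfl rfl) (key 1 _ _ rfl rfl)
    have hsub : (⋃ q ∈ N, T q) ⊆ ⋃ p ∈ I, cell G p ∩ Metric.closedBall p r := by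
      refine iUnion₂_subset fun q hq x hx => ?_
      obtain ⟨hx1, hx2⟩ := hx
      obtain ⟨c, hc, hxc⟩ := mem_iUnion₂.1 hx2
      simp only [hN, Finset.mem_product, Finset.mem_Ico] at hq
      have hcG : c + gridPoint L q ∈ G := add_gridPoint_mem hc (by omega) (by omega)
      obtain ⟨p, hp, hxp⟩ := exists_mem_cell ⟨_, hcG⟩ x
      have hin : x ∈ square (Icc (2 * (‖c₀‖ + 2 * L) + 1) (L * M - (2 * (‖c₀‖ + 2 * L) + 1))) := by
        have key : ∀ (i : Fin 2) (a : ℕ), k ≤ a → a < M - k → gridPoint L q i = L * a →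
            x i ∈ Icc (2 * (‖c₀‖ + 2 * L) + 1) (L * M - (2 * (‖c₀‖ + 2 * L) + 1)) := by
          intro i a h1 h2 h3
          have u := hx1 i
          rw [PiLp.add_apply, PiLp.neg_apply, h3] at u
          have h1' : L * (k : ℝ) ≤ L * a := by gcongr
          have h2' : L * ((a : ℝ) + 1) ≤ L * (M - k) := by
            refine mul_le_mul_of_nonneg_left ?_ hL.le
            have : a + 1 + k ≤ M := by omega
            have : (a : ℝ) + 1 + k ≤ M := by exact_mod_cast this
            linarith
          constructor <;> nlinarith [u.1, u.2]
        intro i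
        fin_cases i
        · exact key 0 _ hq.1.1 hq.1.2 rfl
        · exact key 1 _ hq.2.1 hq.2.2 rfl
      have hcell := cell_subset_square hL hc₀ hM0 rfl hin hxp
      refine mem_iUnion₂.2 ⟨p, Finset.mem_filter.2 ⟨hp, hcell⟩, hxp, ?_⟩
      -- The centre `p` of the cell is at least as near to `x` as the copy whose disc contains `x`.
      refine (hxp _ hcG).trans ?_
      rw [Metric.mem_closedBall, dist_eq_norm] at hxc
      rwa [dist_eq_norm, show x - (c + gridPoint L q) = x + -gridPoint L q - c by abel]
    have h1 : (N.card : ℝ≥0∞) * volume (covered L r C) ≤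
        ∑ p ∈ I, volume (cell G p ∩ Metric.closedBall p r) := by
      calc (N.card : ℝ≥0∞) * volume (covered L r C) = ∑ q ∈ N, volume (T q) := by
            simp [hTv]
        _ = volume (⋃ q ∈ N, T q) :=
            (measure_biUnion_finset (fun q _ q' _ h => hTd h) fun q _ => hTm q).symm
        _ ≤ _ := (measure_mono hsub).trans (measure_biUnion_finset_le _ _)
    have hfin' : ∀ p ∈ I, volume (cell G p ∩ Metric.closedBall p r) ≠ ∞ := fun p hp =>
      ne_top_of_le_ne_top (hfin p hp) (measure_mono inter_subset_left)
    have h2 := ENNReal.toReal_mono (ENNReal.sum_ne_top.2 hfin') h1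
    rw [ENNReal.toReal_mul, ENNReal.toReal_sum hfin', ENNReal.toReal_natCast] at h2
    have hNc : (N.card : ℝ) = ((M : ℝ) - 2 * k) ^ 2 := by
      rw [hN, Finset.card_product, Nat.card_Ico, Nat.cast_mul, Nat.cast_sub (by omega),
        Nat.cast_sub (by omega)]
      ring
    rw [hNc] at h2
    exact h2
  rw [Finset.sum_sub_distrib, ← Finset.mul_sum] at ha
  have h3 := mul_le_mul_of_nonneg_left hb hlam
  have h4 := mul_le_mul_of_nonneg_right hcard hκ
  nlinarith

/-- Fejes Tóth's theorem on partial coverings by equal discs: `n` discs cover at most as much of a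
square of area `n` as `n` concentric discs cover of `n` regular hexagons of unit area. -/
theorem volume_covered_le {R θ : ℝ} (hR : 0 < R) (hV : volume (hexagon R θ) = 1) {L : ℝ}
    (hL : 0 < L) (r : ℝ) {C : Finset Plane} (hC : C.Nonempty) (hcard : (C.card : ℝ) = L ^ 2) :
    volume.real (covered L r C) ≤ C.card * volume.real (hexagon R θ ∩ Metric.closedBall 0 r) := by
  have hV' : volume.real (hexagon R θ) = 1 := by rw [measureReal_def, hV]; simp
  -- The extreme radii are elementary: discs inside the hexagon are counted by the union bound, and
  -- for `r ≥ R` the claim only compares with the area of the square.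
  rcases le_or_gt r (inradius R) with h1 | h1
  · rw [inter_eq_self_of_subset_right
      ((Metric.closedBall_subset_closedBall h1).trans (closedBall_subset_hexagon hR θ))]
    have hball : ∀ c : Plane, volume (Metric.closedBall c r) = volume (Metric.closedBall (0 : Plane) r) :=
      fun c => Measure.addHaar_closedBall_center volume c r
    have h : volume (covered L r C) ≤ C.card * volume (Metric.closedBall (0 : Plane) r) := by
      refine ((measure_mono inter_subset_right).trans (measure_biUnion_finset_le _ _)).trans ?_
      simp [hball]
    have h2 := ENNReal.toReal_mono (ENNReal.mul_ne_top (by simp)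
      Metric.isBounded_closedBall.measure_lt_top.ne) h
    rwa [ENNReal.toReal_mul, ENNReal.toReal_natCast] at h2
  rcases le_or_gt R r with h2 | h2
  · rw [inter_eq_self_of_subset_left
      ((hexagon_subset_closedBall hR θ).trans (Metric.closedBall_subset_closedBall h2)), hV', hcard,
      mul_one]
    have h : volume (covered L r C) ≤ ENNReal.ofReal (L ^ 2) := by
      refine (measure_mono inter_subset_left).trans (le_of_eq ?_)
      rw [volume_square measurableSet_Ico, Real.volume_Ico, sub_zero, ENNReal.ofReal_pow hL.le]
    exact ENNReal.toReal_le_of_le_ofReal (by positivity) h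
  obtain ⟨lam, hlam, hκ, hcore⟩ := sum_cell_lagrangian_le_hexagon hR h1 h2 θ
  rw [hV', mul_one] at hκ
  simp only [hV', mul_one] at hcore
  obtain ⟨c₀, hc₀⟩ := hC
  -- The discarded collar is `k` squares wide, so its share vanishes as `M → ∞`. The condition
  -- `C.card = L ^ 2` then makes the terms with `lam` cancel.
  obtain ⟨k, hk⟩ := exists_nat_ge ((2 * (‖c₀‖ + 2 * L) + 1) / L)
  rw [div_le_iff₀ hL, mul_comm (k : ℝ)] at hk
  have hlim : Filter.Tendsto (fun M : ℕ => (1 - (2 * k : ℝ) / M) ^ 2 * volume.real (covered L r C))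
      Filter.atTop (𝓝 ((1 - 0) ^ 2 * volume.real (covered L r C))) :=
    ((tendsto_const_nhds.sub (tendsto_const_div_atTop_nhds_zero_nat _)).pow 2).mul_const _
  rw [sub_zero, one_pow, one_mul] at hlim
  refine le_of_tendsto hlim ?_
  filter_upwards [Filter.eventually_gt_atTop (2 * k)] with M hM
  have h := mul_covered_le hL hlam hκ hcore hc₀ hk hM
  have hM0 : (0 : ℝ) < M := by exact_mod_cast (by omega : 0 < M)
  rw [← hcard] at h
  have e : (1 - (2 * k : ℝ) / M) ^ 2 * volume.real (covered L r C) =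
      (((M : ℝ) - 2 * k) ^ 2 * volume.real (covered L r C)) / M ^ 2 := by
    field_simp
  rw [e, div_le_iff₀ (by positivity)]
  linarith


/-! ### From disc coverings to the lower bound for the distortion -/

lemma IsOrliczFunction.map_zero {φ : ℝ≥0 → ℝ≥0} (hφ : IsOrliczFunction φ) : φ 0 = 0 := by
  refine le_antisymm (ge_of_tendsto hφ.tendsto_zero ?_) zero_le
  filter_upwards [self_mem_nhdsWithin] with s hs using hφ.monotone (le_of_lt hs)

/-- Monotonicity gives a half-line. If it contained its endpoint `s`, then `s > 0` because `φ 0 =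
0`, and left continuity would put smaller points into it. -/
lemma IsOrliczFunction.superlevel {φ : ℝ≥0 → ℝ≥0} (hφ : IsOrliczFunction φ) (t : ℝ) (ht : 0 < t) :
    {s : ℝ≥0 | t < φ s} = ∅ ∨ ∃ r : ℝ≥0, {s : ℝ≥0 | t < φ s} = Ioi r := by
  rcases eq_empty_or_nonempty {s : ℝ≥0 | t < φ s} with h | h
  · exact Or.inl h
  right
  set S := {s : ℝ≥0 | t < φ s}
  have hup : ∀ s ∈ S, ∀ s', s ≤ s' → s' ∈ S := fun s hs s' hss =>
    show t < φ s' from lt_of_lt_of_le (show t < φ s from hs) (NNReal.coe_le_coe.2 (hφ.monotone hss))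
  refine ⟨sInf S, Subset.antisymm (fun s hs => ?_) fun s hs => ?_⟩
  · refine lt_of_le_of_ne (csInf_le (OrderBot.bddBelow S) hs) fun heq => ?_
    have hs0 : 0 < s := by
      refine pos_iff_ne_zero.2 fun h0 => ?_
      have h1 : t < φ s := hs
      rw [h0, hφ.map_zero, NNReal.coe_zero] at h1
      linarith
    have hc : Filter.Tendsto (fun x => (φ x : ℝ)) (𝓝[≤] s) (𝓝 (φ s)) :=
      (NNReal.continuous_coe.tendsto _).comp (hφ.left_continuous s)
    have hev : ∀ᶠ x in 𝓝[<] s, t < φ x :=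
      (hc.mono_left (nhdsWithin_mono _ Iio_subset_Iic_self)).eventually_const_lt hs
    have : (𝓝[<] s).NeBot := nhdsLT_neBot_of_exists_lt ⟨0, hs0⟩
    obtain ⟨x, hx, hxs⟩ := (hev.and self_mem_nhdsWithin).exists
    have h2 : sInf S ≤ x := csInf_le (OrderBot.bddBelow S) hx
    exact absurd hxs (not_lt.2 (heq ▸ h2))
  · obtain ⟨s', hs', hlt⟩ := exists_lt_of_csInf_lt h hs
    exact hup s' hs' s hlt.le

lemma IsOrliczFunction.measurable {φ : ℝ≥0 → ℝ≥0} (hφ : IsOrliczFunction φ) : Measurable φ :=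
  hφ.monotone.measurable

/-- Stochastic domination gives the comparison of the integrals of `φ`. -/
lemma lintegral_le_of_superlevel {φ : ℝ≥0 → ℝ≥0} (hφ : IsOrliczFunction φ) {μ ν : Measure Plane}
    {f h : Plane → ℝ≥0} (hf : Measurable f) (hh : Measurable h)
    (hle : ∀ r : ℝ≥0, μ {x | r < f x} ≤ ν {x | r < h x}) :
    ∫⁻ x, (φ (f x) : ℝ≥0∞) ∂μ ≤ ∫⁻ x, (φ (h x) : ℝ≥0∞) ∂ν := by
  have cake : ∀ (ρ : Measure Plane) (k : Plane → ℝ≥0), Measurable k →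
      ∫⁻ x, (φ (k x) : ℝ≥0∞) ∂ρ = ∫⁻ t in Ioi (0 : ℝ), ρ {x | t < φ (k x)} := by
    intro ρ k hk
    have := lintegral_eq_lintegral_meas_lt (f := fun x => (φ (k x) : ℝ)) ρ
      (ae_of_all _ fun x => NNReal.coe_nonneg _)
      (hφ.measurable.comp hk).coe_nnreal_real.aemeasurable
    simpa only [ENNReal.ofReal_coe_nnreal] using this
  rw [cake μ f hf, cake ν h hh]
  refine setLIntegral_mono' measurableSet_Ioi fun t ht => ?_
  have e : ∀ k : Plane → ℝ≥0, {x | t < φ (k x)} = k ⁻¹' {s : ℝ≥0 | t < φ s} := fun _ => rfl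
  rw [e f, e h]
  rcases hφ.superlevel t ht with h0 | ⟨r, hr⟩
  · rw [h0]; simp
  · rw [hr]; exact hle r

lemma covered_smul {L : ℝ} (hL : 0 < L) (r : ℝ) (C : Finset Plane) [DecidableEq Plane] :
    covered L r (C.image fun c => L • c) = L • covered 1 (r / L) C := by
  ext x
  rw [mem_smul_set_iff_inv_smul_mem₀ hL.ne']
  have h1 : x ∈ square (Ico 0 L) ↔ L⁻¹ • x ∈ square (Ico 0 1) := by
    refine forall_congr' fun i => ?_
    rw [PiLp.smul_apply, smul_eq_mul, inv_mul_eq_div, mem_Ico, mem_Ico, div_lt_one hL,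
      le_div_iff₀ hL, zero_mul]
  have h2 : ∀ c, x ∈ Metric.closedBall (L • c) r ↔ L⁻¹ • x ∈ Metric.closedBall c (r / L) := by
    intro c
    have hx : x = L • L⁻¹ • x := by rw [smul_smul, mul_inv_cancel₀ hL.ne', one_smul]
    rw [Metric.mem_closedBall, Metric.mem_closedBall, le_div_iff₀ hL]
    conv_lhs => rw [hx]
    rw [dist_smul₀, Real.norm_of_nonneg hL.le, mul_comm]
  simp only [covered, mem_inter_iff, mem_iUnion, h1, Finset.mem_image, exists_prop]
  refine and_congr_right fun _ => ?_
  constructor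
  · rintro ⟨_, ⟨c, hc, rfl⟩, hx⟩; exact ⟨c, hc, (h2 c).1 hx⟩
  · rintro ⟨c, hc, hx⟩; exact ⟨_, ⟨c, hc, rfl⟩, (h2 c).2 hx⟩

/-- A dilation by the square root of the number of points turns the unit square into the square
required by `volume_covered_le`. -/
lemma volume_covered_one_le {R θ : ℝ} (hR : 0 < R) (hV : volume (hexagon R θ) = 1) (r : ℝ)
    {C : Finset Plane} (hC : C.Nonempty) :
    volume (covered 1 (r / √C.card) C) ≤ volume (hexagon R θ ∩ Metric.closedBall 0 r) := by
  classical
  have hn : (0 : ℝ) < C.card := by exact_mod_cast hC.card_pos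
  have hL : 0 < √(C.card : ℝ) := Real.sqrt_pos.2 hn
  have hsq : √(C.card : ℝ) ^ 2 = C.card := Real.sq_sqrt hn.le
  have hc : (C.image fun c => √(C.card : ℝ) • c).card = C.card :=
    Finset.card_image_of_injective _ (smul_right_injective _ hL.ne')
  have h := volume_covered_le hR hV hL r (hC.image fun c => √(C.card : ℝ) • c)
    (by rw [hc, hsq])
  rw [hc, covered_smul hL, measureReal_def, Measure.addHaar_smul, finrank_euclideanSpace_fin, hsq,
    abs_of_pos hn, ENNReal.toReal_mul, ENNReal.toReal_ofReal hn.le] at h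
  refine (ENNReal.toReal_le_toReal (volume_covered_ne_top _ _ _) ?_).1 (le_of_mul_le_mul_left h hn)
  exact ne_top_of_le_ne_top (by rw [hV]; simp) (measure_mono inter_subset_left)

lemma infNndist_le_iff {C : Finset Plane} (hC : C.Nonempty) (x : Plane) (a : ℝ) :
    (Metric.infNndist x (C : Set Plane) : ℝ) ≤ a ↔ x ∈ ⋃ c ∈ C, Metric.closedBall c a := by
  rw [Metric.coe_infNndist]
  simp only [mem_iUnion, Metric.mem_closedBall, exists_prop]
  constructor
  · intro h
    obtain ⟨c, hc, he⟩ := C.finite_toSet.isCompact.exists_infDist_eq_dist hC x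
    exact ⟨c, hc, he ▸ h⟩
  · rintro ⟨c, hc, h⟩
    exact (Metric.infDist_le_dist_of_mem hc).trans h

lemma volume_unitSquare : volume unitSquare = 1 := by
  have : unitSquare = square (Ico 0 1) := rfl
  rw [this, volume_square measurableSet_Ico]; simp

/-- The distortion of a regular hexagon of unit area, with a factor in the argument. -/
noncomputable def hexDistortion (φ : ℝ≥0 → ℝ≥0) (R θ : ℝ) (a : ℝ≥0) : ℝ≥0∞ :=
  ∫⁻ u in hexagon R θ, (φ (a * ‖u‖₊) : ℝ≥0∞)

/-- The lower bound for the distortion of a codebook. -/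
lemma hexDistortion_le_distortion {φ : ℝ≥0 → ℝ≥0} (hφ : IsOrliczFunction φ) {R θ : ℝ} (hR : 0 < R)
    (hV : volume (hexagon R θ) = 1) {N η : ℝ≥0} (hη : 0 < η) {C : Finset Plane} (hC : C.Nonempty)
    (hCN : C.card ≤ ⌊N⌋₊) :
    hexDistortion φ R θ (η ^ (-(1 / 2) : ℝ)) ≤ distortion φ N η C := by
  have hn : (0 : ℝ) < C.card := by exact_mod_cast hC.card_pos
  have hN : ((C.card : ℝ≥0)) ≤ N := (Nat.cast_le.2 hCN).trans (Nat.floor_le zero_le)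
  unfold hexDistortion distortion
  refine lintegral_le_of_superlevel hφ (measurable_const.mul measurable_nnnorm)
    (measurable_const.mul (Metric.continuous_infNndist_pt _).measurable) fun r => ?_
  have hVm := (isClosed_hexagon hR θ).measurableSet
  -- On the hexagon the level `r` corresponds to the disc of radius `ρ`, on the square to discs of
  -- radius `ρ / √C.card`. Replacing `N` by the smaller `C.card` costs only an inclusion, in the
  -- needed direction.
  set ρ : ℝ := r * √η with hρ
  have hη' : (0 : ℝ) < √η := Real.sqrt_pos.2 (by exact_mod_cast hη)
  have e1 : {x : Plane | r < η ^ (-(1 / 2) : ℝ) * ‖x‖₊} = (Metric.closedBall 0 ρ)ᶜ := by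
    ext x
    rw [mem_compl_iff, mem_closedBall_zero_iff, not_le, mem_ofPred_eq, ← NNReal.coe_lt_coe,
      NNReal.coe_mul, NNReal.coe_rpow, coe_nnnorm, Real.rpow_neg η.coe_nonneg, ← Real.sqrt_eq_rpow,
      inv_mul_eq_div, lt_div_iff₀ hη', hρ]
  have e2 : (covered 1 (ρ / √C.card) C)ᶜ ∩ unitSquare ⊆
      {x : Plane | r < (N / η) ^ (1 / 2 : ℝ) * Metric.infNndist x (C : Set Plane)} := by
    rintro x ⟨hx, hxu⟩
    have h1 : ¬ (Metric.infNndist x (C : Set Plane) : ℝ) ≤ ρ / √C.card := by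
      rw [infNndist_le_iff hC]
      exact fun h => hx ⟨hxu, h⟩
    rw [not_le, div_lt_iff₀ (Real.sqrt_pos.2 hn)] at h1
    rw [mem_ofPred_eq, ← NNReal.coe_lt_coe, NNReal.coe_mul, NNReal.coe_rpow, NNReal.coe_div,
      ← Real.sqrt_eq_rpow, Real.sqrt_div N.coe_nonneg, div_mul_eq_mul_div, lt_div_iff₀ hη', ← hρ]
    refine h1.trans_le ?_
    rw [mul_comm]
    refine mul_le_mul_of_nonneg_right (Real.sqrt_le_sqrt ?_) (NNReal.coe_nonneg _)
    exact_mod_cast hN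
  rw [e1, Measure.restrict_apply Metric.isClosed_closedBall.measurableSet.compl]
  refine le_trans ?_ (Measure.le_restrict_apply _ _)
  refine le_trans ?_ (measure_mono (subset_inter e2 inter_subset_right))
  have hcov := volume_covered_one_le hR hV ρ hC
  have c1 : volume ((Metric.closedBall 0 ρ)ᶜ ∩ hexagon R θ) =
      1 - volume (hexagon R θ ∩ Metric.closedBall 0 ρ) := by
    rw [← hV, inter_comm, ← sdiff_eq, ← sdiff_self_inter, measure_sdiff inter_subset_left
      (hVm.inter Metric.isClosed_closedBall.measurableSet).nullMeasurableSet
      (ne_top_of_le_ne_top (by rw [hV]; simp) (measure_mono inter_subset_left))]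
  have c2 : volume ((covered 1 (ρ / √C.card) C)ᶜ ∩ unitSquare) =
      1 - volume (covered 1 (ρ / √C.card) C) := by
    have hsub : covered 1 (ρ / √C.card) C ⊆ unitSquare := inter_subset_left
    rw [← volume_unitSquare, inter_comm, ← sdiff_eq, measure_sdiff hsub
      (measurableSet_covered _ _ _).nullMeasurableSet (volume_covered_ne_top _ _ _)]
  rw [c1, c2]
  exact tsub_le_tsub_left hcov 1

lemma hexDistortion_le_g {φ : ℝ≥0 → ℝ≥0} (hφ : IsOrliczFunction φ) {R θ : ℝ} (hR : 0 < R)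
    (hV : volume (hexagon R θ) = 1) {η : ℝ≥0} (hη : 0 < η) :
    hexDistortion φ R θ (η ^ (-(1 / 2) : ℝ)) ≤ g φ η :=
  le_iInf₂ fun _ _ => le_iInf fun _ => le_iInf₂ fun hC hCN =>
    hexDistortion_le_distortion hφ hR hV hη hC hCN

/-- As the hexagon has unit area, the law of `U` is Lebesgue measure restricted to it. -/
lemma lintegral_uniform {φ : ℝ≥0 → ℝ≥0} (hφ : IsOrliczFunction φ) {R θ : ℝ}
    (hV : volume (hexagon R θ) = 1) {Ω : Type*} [MeasurableSpace Ω] {P : Measure Ω} {U : Ω → Plane}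
    (hU : pdf.IsUniform U (hexagon R θ) P volume) (a : ℝ≥0) :
    ∫⁻ ω, (φ (a * ‖U ω‖₊) : ℝ≥0∞) ∂P = hexDistortion φ R θ a := by
  have hmeas : Measurable fun u : Plane => (φ (a * ‖u‖₊) : ℝ≥0∞) :=
    (hφ.measurable.comp (measurable_const.mul measurable_nnnorm)).coe_nnreal_ennreal
  have hae := hU.aemeasurable (by rw [hV]; simp) (by rw [hV]; simp)
  rw [← lintegral_map' hmeas.aemeasurable hae, hU, ProbabilityTheory.cond, hV, inv_one, one_smul]
  rfl


/-! ### The hexagonal lattice and its tiling -/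

/-- The unit vector in the direction of the center of the `j`-th adjacent hexagon. -/
noncomputable def hexNormal (θ : ℝ) (j : ℤ) : Plane :=
  dir (θ + Real.pi / 6 + j * (Real.pi / 3))

lemma hexNormal_add_two (θ : ℝ) (j : ℤ) :
    hexNormal θ (j + 2) = hexNormal θ (j + 1) - hexNormal θ j := by
  unfold hexNormal
  set ω := θ + Real.pi / 6 + j * (Real.pi / 3) with hω
  have e1 : θ + Real.pi / 6 + ((j + 1 : ℤ) : ℝ) * (Real.pi / 3) = ω + Real.pi / 3 := by
    rw [hω]; push_cast; ring
  have e2 : θ + Real.pi / 6 + ((j + 2 : ℤ) : ℝ) * (Real.pi / 3) = ω + Real.pi / 3 + Real.pi / 3 := by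
    rw [hω]; push_cast; ring
  have h3 : √(3 : ℝ) ^ 2 = 3 := Real.sq_sqrt (by norm_num)
  rw [e1, e2]
  refine plane_ext ?_ ?_
  · simp only [PiLp.sub_apply, dir_zero, Real.cos_add, Real.sin_add, Real.cos_pi_div_three,
      Real.sin_pi_div_three]
    linear_combination -(Real.cos ω / 4) * h3
  · simp only [PiLp.sub_apply, dir_one, Real.cos_add, Real.sin_add, Real.cos_pi_div_three,
      Real.sin_pi_div_three]
    linear_combination -(Real.sin ω / 4) * h3

lemma hexVertex_add_hexVertex (R θ : ℝ) (k : ℕ) :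
    hexVertex R θ k + hexVertex R θ (k + 1) = (2 * inradius R) • hexNormal θ k := by
  rw [hexVertex_eq, hexVertex_eq, hexNormal, inradius]
  have e1 : θ + (k : ℝ) * (Real.pi / 3) = θ + Real.pi / 6 + ((k : ℤ) : ℝ) * (Real.pi / 3) - Real.pi / 6 := by
    push_cast; ring
  have e2 : θ + ((k + 1 : ℕ) : ℝ) * (Real.pi / 3) =
      θ + Real.pi / 6 + ((k : ℤ) : ℝ) * (Real.pi / 3) + Real.pi / 6 := by
    push_cast; ring
  rw [e1, e2]
  refine plane_ext ?_ ?_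
  · simp only [PiLp.add_apply, PiLp.smul_apply, smul_eq_mul, dir_zero, Real.cos_add (_ + _) (Real.pi / 6),
      Real.cos_sub]
    ring
  · simp only [PiLp.add_apply, PiLp.smul_apply, smul_eq_mul, dir_one, Real.sin_add (_ + _) (Real.pi / 6),
      Real.sin_sub]
    ring

lemma mem_hexLattice_iff {R θ : ℝ} {x : Plane} : x ∈ hexLattice R θ ↔
    ∃ i j : ℤ, x = (2 * inradius R) • ((i : ℝ) • hexNormal θ 0 + (j : ℝ) • hexNormal θ 1) := by
  have h1 := hexVertex_add_hexVertex R θ 0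
  have h2 := hexVertex_add_hexVertex R θ 1
  norm_num at h1 h2
  rw [hexLattice, h1, h2, Submodule.mem_span_pair]
  refine exists_congr fun i => exists_congr fun j => ?_
  rw [eq_comm, smul_add, smul_comm _ (i : ℝ), smul_comm _ (j : ℝ), Int.cast_smul_eq_zsmul,
    Int.cast_smul_eq_zsmul]

lemma smul_hexNormal_mem_hexLattice (R θ : ℝ) (j : ℤ) :
    (2 * inradius R) • hexNormal θ j ∈ hexLattice R θ := by
  have hnat : ∀ k : ℕ, (2 * inradius R) • hexNormal θ k ∈ hexLattice R θ ∧
      (2 * inradius R) • hexNormal θ (k + 1) ∈ hexLattice R θ := by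
    intro k
    induction k with
    | zero =>
      exact ⟨mem_hexLattice_iff.2 ⟨1, 0, by simp⟩, mem_hexLattice_iff.2 ⟨0, 1, by simp⟩⟩
    | succ k ih =>
      refine ⟨by exact_mod_cast ih.2, ?_⟩
      rw [show ((k + 1 : ℕ) : ℤ) + 1 = (k : ℤ) + 2 by push_cast; ring, hexNormal_add_two, smul_sub]
      exact sub_mem ih.2 ih.1
  obtain ⟨k, -, hk⟩ := exists_nat_lt_six j
  have : hexNormal θ j = hexNormal θ k := by
    simp only [hexNormal, hk, Int.cast_natCast]
  rw [this]
  exact (hnat k).1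

lemma norm_sq_lattice (θ : ℝ) (a b : ℝ) :
    ‖a • hexNormal θ 0 + b • hexNormal θ 1‖ ^ 2 = a ^ 2 + a * b + b ^ 2 := by
  have h : inner ℝ (hexNormal θ 0) (hexNormal θ 1) = 1 / 2 := by
    rw [hexNormal, hexNormal, inner_dir_dir, ← Real.cos_pi_div_three, ← Real.cos_neg]
    congr 1; push_cast; ring
  have hn : ∀ j, ‖hexNormal θ j‖ = 1 := fun j => norm_dir _
  rw [norm_add_sq_real, real_inner_smul_left, real_inner_smul_right, h, norm_smul, norm_smul, hn, hn,
    mul_one, mul_one, Real.norm_eq_abs, Real.norm_eq_abs, sq_abs, sq_abs]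
  ring

/-- The quadratic form is the squared norm in lattice coordinates. Integrality is essential: the
inequality fails for `m = 1/2`, `n = 0`. -/
lemma int_le_quadratic (m n : ℤ) : m ≤ m ^ 2 + m * n + n ^ 2 := by
  rcases le_or_gt m 0 with h | h
  · nlinarith [sq_nonneg (2 * n + m)]
  rcases le_or_gt 2 m with h2 | h2
  · nlinarith [sq_nonneg (2 * n + m)]
  obtain rfl : m = 1 := by omega
  rcases le_or_gt 0 n with h3 | h3
  · nlinarith
  · nlinarith

/-- The hexagon is contained in the Voronoi cell of the origin with respect to the lattice. -/
lemma hexagon_inner_le {R θ : ℝ} (hR : 0 < R) {u l : Plane} (hu : u ∈ hexagon R θ)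
    (hl : l ∈ hexLattice R θ) : 2 * inner ℝ u l ≤ ‖l‖ ^ 2 := by
  have hi := inradius_pos hR
  obtain ⟨i, j, rfl⟩ := mem_hexLattice_iff.1 hl
  rw [mem_hexagon_iff hR] at hu
  have hu' : ∀ k, inner ℝ u (hexNormal θ k) ≤ inradius R := hu
  have c0 := hu' 0
  have c1 := hu' 1
  have c2 := hu' 2
  have c3 := hu' 3
  have c4 := hu' 4
  have c5 := hu' 5
  have e2 := hexNormal_add_two θ 0
  have e3 := hexNormal_add_two θ 1
  have e4 := hexNormal_add_two θ 2
  have e5 := hexNormal_add_two θ 3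
  norm_num at e2 e3 e4 e5
  rw [e5, e4, e3, e2] at c5
  rw [e4, e3, e2] at c4
  rw [e3, e2] at c3
  rw [e2] at c2
  simp only [inner_sub_right] at c2 c3 c4 c5
  rw [real_inner_smul_right, inner_add_right, real_inner_smul_right, real_inner_smul_right, norm_smul,
    mul_pow, norm_sq_lattice, Real.norm_of_nonneg (by positivity)]
  set x := inner ℝ u (hexNormal θ 0)
  set y := inner ℝ u (hexNormal θ 1)
  set h := inradius R
  -- In each of the six sectors the lattice vector is a nonnegative combination of two consecutive
  -- normals. The sum of its coefficients is one of `±i`, `±j`, `±(i + j)`, and `key` bounds each of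
  -- these by using the symmetries of the form.
  suffices H : (i : ℝ) * x + j * y ≤ h * ((i : ℝ) ^ 2 + i * j + (j : ℝ) ^ 2) by nlinarith
  have key : ∀ m n : ℤ, m ^ 2 + m * n + n ^ 2 = i ^ 2 + i * j + j ^ 2 →
      h * (m : ℝ) ≤ h * ((i : ℝ) ^ 2 + i * j + (j : ℝ) ^ 2) := by
    intro m n he
    refine mul_le_mul_of_nonneg_left ?_ hi.le
    have := int_le_quadratic m n
    rw [he] at this
    exact_mod_cast this
  have k1 := key i j rfl
  have k2 := key (-i) (-j) (by ring)
  have k3 := key j i (by ring)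
  have k4 := key (-j) (-i) (by ring)
  have k5 := key (i + j) (-j) (by ring)
  have k6 := key (-(i + j)) j (by ring)
  push_cast at k1 k2 k3 k4 k5 k6
  rcases le_total 0 (i : ℝ) with hi0 | hi0 <;> rcases le_total 0 (j : ℝ) with hj0 | hj0
  · nlinarith
  · rcases le_total 0 ((i : ℝ) + j) with hs | hs
    · nlinarith
    · nlinarith
  · rcases le_total 0 ((i : ℝ) + j) with hs | hs
    · nlinarith
    · nlinarith
  · nlinarith

lemma exists_nearest_lattice {R : ℝ} (hR : 0 < R) (θ : ℝ) (x : Plane) :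
    ∃ l ∈ hexLattice R θ, ∀ l' ∈ hexLattice R θ, ‖x - l‖ ≤ ‖x - l'‖ := by
  have hi := inradius_pos hR
  obtain ⟨e, he⟩ : ∃ e : ℤ × ℤ → Plane, ∀ i j : ℤ, e (i, j) =
      (2 * inradius R) • ((i : ℝ) • hexNormal θ 0 + (j : ℝ) • hexNormal θ 1) :=
    ⟨fun q => (2 * inradius R) • ((q.1 : ℝ) • hexNormal θ 0 + (q.2 : ℝ) • hexNormal θ 1),
      fun _ _ => rfl⟩
  -- Lattice vectors with an index outside `[-K, K]` have norm at least `2 ‖x‖`, so they are no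
  -- nearer to `x` than the origin; a finite search remains.
  obtain ⟨K, hK⟩ := exists_nat_ge (2 * ‖x‖ / inradius R)
  rw [div_le_iff₀ hi] at hK
  obtain ⟨q, hq, hmin⟩ := (Finset.Icc (-(K : ℤ)) K ×ˢ Finset.Icc (-(K : ℤ)) K).exists_min_image
    (fun q => ‖x - e q‖) ⟨(0, 0), by simp⟩
  refine ⟨e q, mem_hexLattice_iff.2 ⟨q.1, q.2, he q.1 q.2⟩, fun l' hl' => ?_⟩
  obtain ⟨i, j, rfl⟩ := mem_hexLattice_iff.1 hl'
  by_cases hmem : (i, j) ∈ Finset.Icc (-(K : ℤ)) K ×ˢ Finset.Icc (-(K : ℤ)) K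
  · rw [← he]
    exact hmin (i, j) hmem
  refine (hmin (0, 0) (by simp)).trans ?_
  have h0 : e (0, 0) = 0 := by rw [he]; simp
  rw [h0, sub_zero]
  have hbig : (K : ℝ) ^ 2 ≤ (i : ℝ) ^ 2 ∨ (K : ℝ) ^ 2 ≤ (j : ℝ) ^ 2 := by
    simp only [Finset.mem_product, Finset.mem_Icc, not_and_or, not_le] at hmem
    have : ∀ m : ℤ, (m < -(K : ℤ) ∨ (K : ℤ) < m) → (K : ℝ) ^ 2 ≤ (m : ℝ) ^ 2 := by
      intro m hm
      have : (K : ℤ) ^ 2 ≤ m ^ 2 := by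
        rcases hm with h | h <;> nlinarith
      exact_mod_cast this
    rcases hmem with h | h
    · exact Or.inl (this i h)
    · exact Or.inr (this j h)
  have hnorm : 2 * ‖x‖ ≤ ‖(2 * inradius R) • ((i : ℝ) • hexNormal θ 0 + (j : ℝ) • hexNormal θ 1)‖ := by
    refine le_of_sq_le_sq ?_ (norm_nonneg _)
    rw [norm_smul, mul_pow ‖_‖, norm_sq_lattice, Real.norm_of_nonneg (by positivity)]
    have h1 : (2 * ‖x‖) ^ 2 ≤ (K * inradius R) ^ 2 := pow_le_pow_left₀ (by positivity) hK 2
    have h2 : (K : ℝ) ^ 2 ≤ 4 * ((i : ℝ) ^ 2 + i * j + (j : ℝ) ^ 2) := by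
      rcases hbig with h | h
      · nlinarith [sq_nonneg ((i : ℝ) + 2 * j)]
      · nlinarith [sq_nonneg (2 * (i : ℝ) + j)]
    nlinarith [mul_le_mul_of_nonneg_right h2 (sq_nonneg (inradius R))]
  have := norm_sub_norm_le ((2 * inradius R) • ((i : ℝ) • hexNormal θ 0 + (j : ℝ) • hexNormal θ 1)) x
  rw [norm_sub_rev] at this
  linarith

/-- The translates of the hexagon by the lattice cover the plane. -/
lemma exists_sub_mem_hexagon {R : ℝ} (hR : 0 < R) (θ : ℝ) (x : Plane) :
    ∃ l ∈ hexLattice R θ, x - l ∈ hexagon R θ := by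
  have hi := inradius_pos hR
  obtain ⟨l, hl, hmin⟩ := exists_nearest_lattice hR θ x
  refine ⟨l, hl, (mem_hexagon_iff hR θ _).2 fun j => ?_⟩
  -- Comparison of the nearest lattice point with its `j`-th neighbour yields the `j`-th half-plane
  -- of the hexagon.
  have h := hmin _ (add_mem hl (smul_hexNormal_mem_hexLattice R θ j))
  rw [← dist_eq_norm, ← dist_eq_norm, dist_le_dist_iff, add_sub_cancel_left, real_inner_smul_right,
    norm_smul, mul_pow, Real.norm_of_nonneg (by positivity), hexNormal, norm_dir] at h
  nlinarith

/-- The cell of the scaled hexagonal tiling with center `p`. -/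
def hexCell (R θ s : ℝ) (p : Plane) : Set Plane := (fun u => p + s • u) '' hexagon R θ

lemma hexCell_eq (R θ s : ℝ) (p : Plane) : hexCell R θ s p = p +ᵥ (s • hexagon R θ) := by
  ext x
  simp [hexCell, mem_vadd_set, mem_smul_set]

lemma volume_hexCell {R θ s : ℝ} (hs : 0 < s) (hV : volume (hexagon R θ) = 1) (p : Plane) :
    volume (hexCell R θ s p) = ENNReal.ofReal (s ^ 2) := by
  rw [hexCell_eq, measure_vadd, Measure.addHaar_smul, hV, finrank_euclideanSpace_fin, mul_one,
    abs_of_pos (by positivity)]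

lemma isClosed_hexCell {R : ℝ} (hR : 0 < R) (θ s : ℝ) (p : Plane) : IsClosed (hexCell R θ s p) :=
  ((Metric.isCompact_of_isClosed_isBounded (isClosed_hexagon hR θ) (isBounded_hexagon hR θ)).image
    (by fun_prop)).isClosed

/-- By `hexagon_inner_le` a common point is equidistant from the two centres, so it lies on their
bisector. -/
lemma aedisjoint_hexCell {R θ s : ℝ} (hR : 0 < R) (hs : 0 < s) {l l' : Plane}
    (hl : l ∈ hexLattice R θ) (hl' : l' ∈ hexLattice R θ) (hne : s • l ≠ s • l') :
    AEDisjoint volume (hexCell R θ s (s • l)) (hexCell R θ s (s • l')) := by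
  have key : ∀ a ∈ hexLattice R θ, ∀ b ∈ hexLattice R θ, ∀ x ∈ hexCell R θ s (s • a),
      dist x (s • a) ≤ dist x (s • b) := by
    rintro a ha b hb _ ⟨u, hu, rfl⟩
    rw [dist_le_dist_iff]
    simp only [add_sub_cancel_left]
    rw [← smul_sub, real_inner_smul_left, real_inner_smul_right, norm_smul, mul_pow,
      Real.norm_of_nonneg hs.le]
    have := hexagon_inner_le hR hu (sub_mem hb ha)
    nlinarith [mul_le_mul_of_nonneg_left this (sq_nonneg s)]
  refine measure_mono_null (fun x hx => ?_) (volume_bisector hne)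
  exact le_antisymm (key l hl l' hl' x hx.1) (key l' hl' l hl x hx.2)

/-- Cells that meet the unit square have diameter at most `2Rs`, so they fit into a square of side
`1 + 4Rs`; each has area `s²` and the overlaps are null. -/
lemma card_mul_sq_le {R θ s : ℝ} (hR : 0 < R) (hs : 0 < s) (hV : volume (hexagon R θ) = 1)
    (F : Finset Plane) (hF : (F : Set Plane) ⊆ latticeCodebook R θ s) :
    (F.card : ℝ) * s ^ 2 ≤ (1 + 4 * R * s) ^ 2 := by
  have hRs : 0 < R * s := mul_pos hR hs
  have hsub : (⋃ p ∈ F, hexCell R θ s p) ⊆ square (Icc (-(2 * R * s)) (1 + 2 * R * s)) := by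
    refine iUnion₂_subset fun p hp => ?_
    obtain ⟨l, -, -, v, hv, hpv⟩ := hF hp
    rintro _ ⟨w, hw, rfl⟩ i
    have h1 := mem_closedBall_zero_iff.1 (hexagon_subset_closedBall hR θ hv)
    have h2 := mem_closedBall_zero_iff.1 (hexagon_subset_closedBall hR θ hw)
    have h3 := abs_le.1 ((abs_apply_le_norm (w - v) i).trans ((norm_sub_le w v).trans
      (add_le_add h2 h1)))
    have h4 := hpv i
    simp only [PiLp.add_apply, PiLp.smul_apply, smul_eq_mul, PiLp.sub_apply, mem_Ico] at h3 h4 ⊢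
    constructor <;> nlinarith
  have hd : (F : Set Plane).Pairwise (Function.onFun (AEDisjoint volume) (hexCell R θ s)) := by
    intro p hp q hq hpq
    obtain ⟨l, hl, rfl, -⟩ := hF hp
    obtain ⟨l', hl', rfl, -⟩ := hF hq
    exact aedisjoint_hexCell hR hs hl hl' hpq
  have h := measure_mono (μ := volume) hsub
  rw [measure_biUnion_finset₀ hd fun p _ =>
    (isClosed_hexCell hR θ s p).measurableSet.nullMeasurableSet,
    volume_square measurableSet_Icc, Real.volume_Icc] at h
  simp only [volume_hexCell hs hV, Finset.sum_const, nsmul_eq_mul] at h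
  rw [show 1 + 2 * R * s - -(2 * R * s) = 1 + 4 * R * s by ring,
    ← ENNReal.ofReal_pow (by positivity), ← ENNReal.ofReal_natCast,
    ← ENNReal.ofReal_mul (by positivity)] at h
  exact (ENNReal.ofReal_le_ofReal_iff (by positivity)).1 h

lemma finite_latticeCodebook {R θ s : ℝ} (hR : 0 < R) (hs : 0 < s) (hV : volume (hexagon R θ) = 1) :
    (latticeCodebook R θ s).Finite := by
  by_contra hinf
  obtain ⟨n, hn⟩ := exists_nat_gt ((1 + 4 * R * s) ^ 2 / s ^ 2)
  obtain ⟨F, hF, hcard⟩ := (show (latticeCodebook R θ s).Infinite from hinf).exists_subset_card_eq n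
  have := card_mul_sq_le hR hs hV F hF
  rw [div_lt_iff₀ (by positivity), ← hcard] at hn
  linarith

lemma exists_latticeCodebook {R s : ℝ} (hR : 0 < R) (hs : 0 < s) (θ : ℝ) {x : Plane}
    (hx : x ∈ unitSquare) : ∃ p ∈ latticeCodebook R θ s, x ∈ hexCell R θ s p := by
  obtain ⟨l, hl, hv⟩ := exists_sub_mem_hexagon hR θ (s⁻¹ • x)
  have e : s • l + s • (s⁻¹ • x - l) = x := by
    rw [smul_sub, smul_smul, mul_inv_cancel₀ hs.ne', one_smul]; abel
  exact ⟨s • l, ⟨l, hl, rfl, _, hv, by rwa [e]⟩, _, hv, e⟩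

lemma nonempty_latticeCodebook {R s : ℝ} (hR : 0 < R) (hs : 0 < s) (θ : ℝ) :
    (latticeCodebook R θ s).Nonempty := by
  have h0 : (0 : Plane) ∈ unitSquare := fun i => by simp
  obtain ⟨p, hp, -⟩ := exists_latticeCodebook hR hs θ h0
  exact ⟨p, hp⟩


/-! ### The distortion of the lattice codebook -/

lemma setLIntegral_hexCell (R θ : ℝ) {s : ℝ} (hs : 0 < s) (p : Plane) (f : Plane → ℝ≥0∞) :
    ∫⁻ x in hexCell R θ s p, f x =
      ENNReal.ofReal (s ^ 2) * ∫⁻ u in hexagon R θ, f (p + s • u) := by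
  have hemb : MeasurableEmbedding fun u : Plane => p + s • u :=
    (measurableEmbedding_addLeft p).comp (measurableEmbedding_const_smul₀ hs.ne')
  have hmap : Measure.map (fun u : Plane => p + s • u) volume =
      ENNReal.ofReal (s ^ 2)⁻¹ • (volume : Measure Plane) := by
    have : (fun u : Plane => p + s • u) = (fun x => p + x) ∘ fun u => s • u := rfl
    rw [this, ← Measure.map_map (measurable_const_add p) (measurable_const_smul s),
      Measure.map_addHaar_smul _ hs.ne', Measure.map_smul, map_add_left_eq_self,
      finrank_euclideanSpace_fin, abs_of_pos (by positivity)]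
  have hpre : (fun u : Plane => p + s • u) ⁻¹' hexCell R θ s p = hexagon R θ :=
    preimage_image_eq _ hemb.injective
  have h := hemb.lintegral_map (μ := volume.restrict (hexagon R θ)) f
  rw [← hpre, ← hemb.restrict_map, hpre, hmap, Measure.restrict_smul, lintegral_smul_measure, smul_eq_mul] at h
  rw [← h, ← mul_assoc, ← ENNReal.ofReal_mul (by positivity), mul_inv_cancel₀ (by positivity),
    ENNReal.ofReal_one, one_mul]

/-- Enlarge the square to the union of its cells and bound the distance by that to the centre of the
cell. The same `c` controls both errors: `c²` bounds the total area of the cells, and `c` bounds the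
factor in the argument of `φ`. -/
lemma distortion_latticeCodebook_le {φ : ℝ≥0 → ℝ≥0} (hφ : IsOrliczFunction φ) {R θ : ℝ}
    (hR : 0 < R) (hV : volume (hexagon R θ) = 1) {s : ℝ≥0} (hs : 0 < s) {N η : ℝ≥0} (hη : 0 < η)
    {c : ℝ≥0} (hc : (c : ℝ) = 1 + 4 * R * s) (hN : √(N : ℝ) * s ≤ c) :
    distortion φ N η (latticeCodebook R θ s) ≤
      (c : ℝ≥0∞) ^ 2 * hexDistortion φ R θ (c * η ^ (-(1 / 2) : ℝ)) := by
  have hs' : (0 : ℝ) < s := by exact_mod_cast hs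
  have hfin := finite_latticeCodebook hR hs' hV (θ := θ)
  set F := hfin.toFinset with hF
  have hFC : (F : Set Plane) = latticeCodebook R θ s := hfin.coe_toFinset
  set a : ℝ≥0 := (N / η) ^ (1 / 2 : ℝ) with ha
  have ha' : a * s ≤ c * η ^ (-(1 / 2) : ℝ) := by
    rw [← NNReal.coe_le_coe, ha, NNReal.coe_mul, NNReal.coe_mul, NNReal.coe_rpow, NNReal.coe_rpow,
      NNReal.coe_div, ← Real.sqrt_eq_rpow, Real.sqrt_div N.coe_nonneg,
      Real.rpow_neg η.coe_nonneg, ← Real.sqrt_eq_rpow, div_mul_eq_mul_div, ← div_eq_mul_inv]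
    gcongr
  calc distortion φ N η (latticeCodebook R θ s)
      ≤ ∫⁻ x in ⋃ p : F, hexCell R θ s p,
          (φ (a * Metric.infNndist x (latticeCodebook R θ s)) : ℝ≥0∞) := by
        refine lintegral_mono_set fun x hx => ?_
        obtain ⟨p, hp, hxp⟩ := exists_latticeCodebook hR hs' θ hx
        exact mem_iUnion.2 ⟨⟨p, hfin.mem_toFinset.2 hp⟩, hxp⟩
    _ ≤ ∑ p ∈ F, ∫⁻ x in hexCell R θ s p,
          (φ (a * Metric.infNndist x (latticeCodebook R θ s)) : ℝ≥0∞) := by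
        refine (lintegral_iUnion_le _ _).trans (le_of_eq ?_)
        rw [tsum_fintype, Finset.sum_coe_sort F fun p => ∫⁻ x in hexCell R θ s p,
          (φ (a * Metric.infNndist x (latticeCodebook R θ s)) : ℝ≥0∞)]
    _ ≤ ∑ _p ∈ F, ENNReal.ofReal ((s : ℝ) ^ 2) *
          hexDistortion φ R θ (c * η ^ (-(1 / 2) : ℝ)) := by
        refine Finset.sum_le_sum fun p hp => ?_
        rw [setLIntegral_hexCell R θ hs']
        refine mul_le_mul_right ?_ _
        refine lintegral_mono fun u => ENNReal.coe_le_coe.2 (hφ.monotone ?_)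
        have h1 : Metric.infNndist (p + (s : ℝ) • u) (latticeCodebook R θ s) ≤ s * ‖u‖₊ := by
          rw [← NNReal.coe_le_coe, Metric.coe_infNndist]
          refine (Metric.infDist_le_dist_of_mem (hfin.mem_toFinset.1 hp)).trans (le_of_eq ?_)
          rw [dist_eq_norm, add_sub_cancel_left, norm_smul, Real.norm_of_nonneg hs'.le]
          simp
        calc _ ≤ a * (s * ‖u‖₊) := mul_le_mul_of_nonneg_left h1 zero_le
          _ = a * s * ‖u‖₊ := (mul_assoc _ _ _).symm
          _ ≤ _ := mul_le_mul_of_nonneg_right ha' zero_le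
    _ = ENNReal.ofReal (F.card * (s : ℝ) ^ 2) * hexDistortion φ R θ (c * η ^ (-(1 / 2) : ℝ)) := by
        rw [Finset.sum_const, nsmul_eq_mul, ← mul_assoc, ENNReal.ofReal_mul (by positivity),
          ENNReal.ofReal_natCast]
    _ ≤ _ := by
        refine mul_le_mul_left ?_ _
        have h := card_mul_sq_le hR hs' hV F hFC.subset
        rw [← hc] at h
        refine (ENNReal.ofReal_le_ofReal h).trans (le_of_eq ?_)
        rw [ENNReal.ofReal_pow c.coe_nonneg, ENNReal.ofReal_coe_nnreal]

/-- In the application `c` tends to `1` from above, so left continuity of `φ` does not help.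
Instead, a monotone `φ` has countably many discontinuities, each affecting only a null circle, and
dominated convergence applies on the bounded hexagon. -/
lemma tendsto_hexDistortion {φ : ℝ≥0 → ℝ≥0} (hφ : IsOrliczFunction φ) {R θ : ℝ}
    (hR : 0 < R) (hV : volume (hexagon R θ) = 1) {a : ℝ≥0} (ha : 0 < a) :
    Filter.Tendsto (fun c : ℝ≥0 => (c : ℝ≥0∞) ^ 2 * hexDistortion φ R θ (c * a)) (𝓝 1)
      (𝓝 (hexDistortion φ R θ a)) := by
  have hVm := (isClosed_hexagon hR θ).measurableSet
  have hbound : ∀ c : ℝ≥0, c ≤ 2 → ∀ u ∈ hexagon R θ,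
      (φ (c * a * ‖u‖₊) : ℝ≥0∞) ≤ φ (2 * a * R.toNNReal) := by
    intro c hc u hu
    refine ENNReal.coe_le_coe.2 (hφ.monotone ?_)
    have : ‖u‖₊ ≤ R.toNNReal := by
      rw [← NNReal.coe_le_coe, Real.coe_toNNReal _ hR.le, coe_nnnorm]
      exact mem_closedBall_zero_iff.1 (hexagon_subset_closedBall hR θ hu)
    gcongr
  have hmain : Filter.Tendsto (fun c : ℝ≥0 => hexDistortion φ R θ (c * a)) (𝓝 1)
      (𝓝 (hexDistortion φ R θ a)) := by
    refine tendsto_lintegral_filter_of_dominated_convergence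
      (fun _ => (φ (2 * a * R.toNNReal) : ℝ≥0∞)) ?_ ?_ ?_ ?_
    · exact Filter.Eventually.of_forall fun c =>
        (hφ.measurable.comp (measurable_const.mul measurable_nnnorm)).coe_nnreal_ennreal
    · filter_upwards [eventually_le_nhds (by norm_num : (1 : ℝ≥0) < 2)] with c hc
      exact (ae_restrict_iff' hVm).2 (ae_of_all _ fun u hu => hbound c hc u hu)
    · rw [setLIntegral_const, hV, mul_one]; exact ENNReal.coe_ne_top
    · have hD := hφ.monotone.countable_not_continuousAt
      have hnull : volume (⋃ d ∈ {x | ¬ContinuousAt φ x}, Metric.sphere (0 : Plane) (d / a : ℝ≥0)) = 0 :=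
        (measure_biUnion_null_iff hD).2 fun d _ => Measure.addHaar_sphere _ _ _
      refine ae_restrict_of_ae ?_
      filter_upwards [compl_mem_ae_iff.2 hnull] with u hu
      have hcont : ContinuousAt φ (a * ‖u‖₊) := by
        by_contra hc
        refine hu (mem_iUnion₂.2 ⟨a * ‖u‖₊, hc, ?_⟩)
        rw [mem_sphere_zero_iff_norm, mul_div_cancel_left₀ _ ha.ne', coe_nnnorm]
      have hin : Filter.Tendsto (fun c : ℝ≥0 => c * a * ‖u‖₊) (𝓝 1) (𝓝 (a * ‖u‖₊)) := by
        have : Continuous fun c : ℝ≥0 => c * a * ‖u‖₊ := by fun_prop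
        simpa using this.tendsto 1
      exact (ENNReal.continuous_coe.tendsto _).comp (hcont.tendsto.comp hin)
  have hpow : Filter.Tendsto (fun c : ℝ≥0 => (c : ℝ≥0∞) ^ 2) (𝓝 1) (𝓝 1) := by
    have : Continuous fun c : ℝ≥0 => ((c ^ 2 : ℝ≥0) : ℝ≥0∞) :=
      ENNReal.continuous_coe.comp (continuous_pow 2)
    simpa using this.tendsto 1
  have := ENNReal.Tendsto.mul hpow (Or.inl one_ne_zero) hmain (Or.inr ENNReal.one_ne_top)
  rwa [one_mul] at this

lemma optimalDistortion_le_distortion (φ : ℝ≥0 → ℝ≥0) {N : ℝ≥0} (η : ℝ≥0) {C : Set Plane}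
    (hC : C.Finite) (hne : C.Nonempty) (hcard : C.ncard ≤ ⌊N⌋₊) :
    optimalDistortion φ N η ≤ distortion φ N η C := by
  have h : (hC.toFinset : Set Plane) = C := hC.coe_toFinset
  have := iInf_le_of_le (f := fun D : Finset Plane => ⨅ (_ : D.Nonempty) (_ : D.card ≤ ⌊N⌋₊),
    distortion φ N η (D : Set Plane)) hC.toFinset (iInf₂_le_of_le (hC.toFinset_nonempty.2 hne)
      (by rwa [← Set.ncard_eq_toFinset_card C hC]) le_rfl)
  rwa [h] at this

lemma g_le_optimalDistortion (φ : ℝ≥0 → ℝ≥0) {N : ℝ≥0} (hN : 1 ≤ N) (η : ℝ≥0) :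
    g φ η ≤ optimalDistortion φ N η := iInf₂_le N hN

lemma exists_codebook_bounds {φ : ℝ≥0 → ℝ≥0} (hφ : IsOrliczFunction φ) {R θ : ℝ}
    (hR : 0 < R) (hV : volume (hexagon R θ) = 1) {s : ℝ} (hs : 0 < s) {N η : ℝ≥0} (hη : 0 < η)
    (hN : √(N : ℝ) * s ≤ 1 + 4 * R * s) :
    distortion φ N η (latticeCodebook R θ s) ≤ ((1 + 4 * R * s).toNNReal : ℝ≥0∞) ^ 2 *
      hexDistortion φ R θ ((1 + 4 * R * s).toNNReal * η ^ (-(1 / 2) : ℝ)) := by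
  have hc : ((1 + 4 * R * s).toNNReal : ℝ) = 1 + 4 * R * s := Real.coe_toNNReal _ (by positivity)
  have hs' : (s.toNNReal : ℝ) = s := Real.coe_toNNReal _ hs.le
  have := distortion_latticeCodebook_le hφ hR hV (s := s.toNNReal) (Real.toNNReal_pos.2 hs) hη
    (c := (1 + 4 * R * s).toNNReal) (by rw [hc, hs']) (N := N) (by rw [hc, hs']; exact hN)
  rwa [hs'] at this

lemma ncard_mul_sq_le {R θ s : ℝ} (hR : 0 < R) (hs : 0 < s) (hV : volume (hexagon R θ) = 1) :
    ((latticeCodebook R θ s).ncard : ℝ) * s ^ 2 ≤ (1 + 4 * R * s) ^ 2 := by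
  have hfin := finite_latticeCodebook hR hs hV (θ := θ)
  rw [Set.ncard_eq_toFinset_card _ hfin]
  exact card_mul_sq_le hR hs hV _ hfin.coe_toFinset.subset

end HexQuant

/-! ### The theorem: squeezing between the two bounds -/

open HexQuant in
theorem lemma2p3 (φ : ℝ≥0 → ℝ≥0) (hφ : HexQuant.IsOrliczFunction φ)
    (R θ : ℝ) (hR : 0 < R) (hV : MeasureTheory.volume (HexQuant.hexagon R θ) = 1)
    {Ω : Type*} [MeasurableSpace Ω] (P : MeasureTheory.Measure Ω)
    [MeasureTheory.IsProbabilityMeasure P] (U : Ω → HexQuant.Plane)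
    (hU : MeasureTheory.pdf.IsUniform U (HexQuant.hexagon R θ) P MeasureTheory.volume)
    (η : ℝ≥0) (hη : 0 < η) :
    HexQuant.g φ η = ∫⁻ ω, (φ (η ^ (-(1 / 2) : ℝ) * ‖U ω‖₊) : ℝ≥0∞) ∂P ∧
    Filter.Tendsto (fun N : ℝ≥0 => HexQuant.optimalDistortion φ N η) Filter.atTop
      (𝓝 (HexQuant.g φ η)) ∧
    (∀ s : ℝ, 0 < s → (HexQuant.latticeCodebook R θ s).Finite ∧
      (HexQuant.latticeCodebook R θ s).Nonempty) ∧
    Filter.Tendsto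
      (fun s : ℝ => HexQuant.distortion φ ((HexQuant.latticeCodebook R θ s).ncard : ℝ≥0) η
        (HexQuant.latticeCodebook R θ s))
      (𝓝[>] 0) (𝓝 (HexQuant.g φ η)) := by
  have ha : 0 < η ^ (-(1 / 2) : ℝ) := NNReal.rpow_pos hη
  set a := η ^ (-(1 / 2) : ℝ) with ha_def
  set G : ℝ≥0 → ℝ≥0∞ := fun c => (c : ℝ≥0∞) ^ 2 * hexDistortion φ R θ (c * a) with hG
  have hGlim : Filter.Tendsto G (𝓝 1) (𝓝 (hexDistortion φ R θ a)) :=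
    tendsto_hexDistortion hφ hR hV ha
  have hfin : ∀ s : ℝ, 0 < s → (latticeCodebook R θ s).Finite ∧ (latticeCodebook R θ s).Nonempty :=
    fun s hs => ⟨finite_latticeCodebook hR hs hV, nonempty_latticeCodebook hR hs θ⟩
  have hclim : Filter.Tendsto (fun s : ℝ => (1 + 4 * R * s).toNNReal) (𝓝 0) (𝓝 1) := by
    have : Continuous fun s : ℝ => (1 + 4 * R * s).toNNReal := by fun_prop
    simpa using this.tendsto 0
  have hlower : ∀ s : ℝ, 0 < s →
      g φ η ≤ distortion φ ((latticeCodebook R θ s).ncard : ℝ≥0) η (latticeCodebook R θ s) := by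
    intro s hs
    have hpos : 0 < (latticeCodebook R θ s).ncard :=
      (Set.ncard_pos (hfin s hs).1).2 (hfin s hs).2
    refine (g_le_optimalDistortion φ (by exact_mod_cast hpos) η).trans
      (optimalDistortion_le_distortion φ η (hfin s hs).1 (hfin s hs).2 ?_)
    rw [Nat.floor_natCast]
  have hupper : ∀ s : ℝ, 0 < s →
      distortion φ ((latticeCodebook R θ s).ncard : ℝ≥0) η (latticeCodebook R θ s) ≤
        G (1 + 4 * R * s).toNNReal := by
    intro s hs
    -- With `N` the number of points of the codebook, the condition on `√N * s` is the square root
    -- of the area bound.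
    refine exists_codebook_bounds hφ hR hV hs hη (abs_le_of_sq_le_sq' ?_ (by positivity)).2
    rw [mul_pow, Real.sq_sqrt (NNReal.coe_nonneg _), NNReal.coe_natCast]
    exact ncard_mul_sq_le hR hs hV
  have hGs : Filter.Tendsto (fun s : ℝ => G (1 + 4 * R * s).toNNReal) (𝓝[>] 0)
      (𝓝 (hexDistortion φ R θ a)) :=
    hGlim.comp (hclim.mono_left nhdsWithin_le_nhds)
  have hg : g φ η = hexDistortion φ R θ a := by
    refine le_antisymm (ge_of_tendsto hGs ?_) (hexDistortion_le_g hφ hR hV hη)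
    filter_upwards [self_mem_nhdsWithin] with s hs using (hlower s hs).trans (hupper s hs)
  refine ⟨by rw [hg, lintegral_uniform hφ hV hU], ?_, hfin, ?_⟩
  · have hsqrt : Filter.Tendsto (fun N : ℝ≥0 => √(N : ℝ) - 4 * R) Filter.atTop Filter.atTop :=
      Filter.tendsto_atTop_add_const_right _ _
        (Real.tendsto_sqrt_atTop.comp (NNReal.tendsto_coe_atTop.2 Filter.tendsto_id))
    have hup := hGlim.comp (hclim.comp (tendsto_inv_atTop_zero.comp hsqrt))
    rw [← hg] at hup
    refine tendsto_of_tendsto_of_tendsto_of_le_of_le' tendsto_const_nhds hup ?_ ?_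
    · filter_upwards [Filter.eventually_ge_atTop 1] with N hN using g_le_optimalDistortion φ hN η
    · filter_upwards [hsqrt.eventually_gt_atTop 0] with N hN
      -- This `s` solves `√N * s = 1 + 4 * R * s`, so the area bound says precisely that the lattice
      -- codebook has at most `N` points.
      set s : ℝ := (√(N : ℝ) - 4 * R)⁻¹ with hs_def
      have hs : 0 < s := inv_pos.2 hN
      have hNs : √(N : ℝ) * s = 1 + 4 * R * s := by
        have : (√(N : ℝ) - 4 * R) * s = 1 := mul_inv_cancel₀ hN.ne'
        linarith
      refine (optimalDistortion_le_distortion φ η (hfin s hs).1 (hfin s hs).2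
        (Nat.le_floor ?_)).trans (exists_codebook_bounds hφ hR hV hs hη hNs.le)
      have h := ncard_mul_sq_le hR hs hV (θ := θ)
      rw [← hNs, mul_pow, Real.sq_sqrt N.coe_nonneg] at h
      exact_mod_cast le_of_mul_le_mul_right h (by positivity)
  · rw [← hg] at hGs
    refine tendsto_of_tendsto_of_tendsto_of_le_of_le' tendsto_const_nhds hGs ?_ ?_
    · filter_upwards [self_mem_nhdsWithin] with s hs using hlower s hs
    · filter_upwards [self_mem_nhdsWithin] with s hs using hupper s hs
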